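/- For a partition $\varpi$ of $n$ let $s[\varpi]$ be the irreducible complex representation of $\mathfrak S_n$ attached to $\varpi$ ($s[n]$ trivial, $s[1^n]$ the sign). Let $d_{N,k}=\dim S_k(\Gamma_0(N))^{\mathrm{new}}$, where the new space is the orthogonal complement, for the Petersson product, of the span of the forms $f(d\tau)$ with $f\in S_k(\Gamma_0(M))$, $M\mid N$, $M\ne N$, $d\mid N/M$. Let $\Gamma(2)\subset \mathrm{SL}(2,\mathbb Z)$ be the principal congruence subgroup of level $2$. Since $\mathrm{SL}(2,\mathbb Z)/\Gamma(2)\cong\mathfrak S_3$, the action $(\gamma,f)\mapsto f|_{2k}\gamma^{-1}$ makes $S_{2k}(\Gamma(2))$ a representation of $\mathfrak S_3$. Then for every integer $k\ge 0$ $$S_{2k}(\Gamma(2))\;\cong\; d_{1,2k}\,s[3]\;\oplus\;(d_{1,2k}+d_{2,2k})\,s[2,1]\;\oplus\; d_{4,2k}\,s[1^3].$$ Let $\Gamma[2]$ be the kernel of reduction modulo $2$ on $\mathrm{Sp}(4,\mathbb Z)$ (acting on the Siegel upper half space $\mathfrak H_2$ by $\tau\mapsto(a\tau+b)(c\tau+d)^{-1}$).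 There is exactly one isomorphism $\mathrm{Sp}(4,\mathbb Z)/\Gamma[2]\cong\mathfrak S_6$ for which $$(12)\leftrightarrow\left(\begin{smallmatrix}1&0&1&0\\0&1&0&0\\0&0&1&0\\0&0&0&1\end{smallmatrix}\right),\qquad (123456)\leftrightarrow\left(\begin{smallmatrix}0&1&0&1\\1&0&1&0\\1&0&1&1\\-1&1&0&1\end{smallmatrix}\right)\pmod 2;$$ use it to identify the two groups. Let $P\subset\mathrm{Sp}(4,\mathbb Z)$ be the Klingen parabolic subgroup, the stabiliser of the line spanned by the second basis vector of $\mathbb Z^4$, and let $\pi:P\to\mathrm{SL}(2,\mathbb Z)$ be the homomorphism given by the rows and columns $1$ and $3$. Let $H\subset\mathfrak S_6$ be the image of $P$ (the stabiliser of a one-dimensional boundary component of the Satake compactification of $\Gamma[2]\backslash\mathfrak H_2$). Let $E^{(\mathbf Q)}_{2k}(\Gamma[2])$ be the space of Klingen-Eisenstein series, that is, the span of all functions $F|_{2k}\gamma^{-1}$ with $\gamma\in\mathrm{Sp}(4,\mathbb Z)$ and $$F(\tau)=\sum_{\delta=\left(\begin{smallmatrix}a&b\\c&d\end{smallmatrix}\right)\in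 (P\cap\Gamma[2])\backslash\Gamma[2]} f\big((\delta\tau)_{11}\big)\det(c\tau+d)^{-2k},\qquad f\in S_{2k}(\Gamma(2)),$$ the sum being absolutely convergent; $\mathrm{Sp}(4,\mathbb Z)$ acts on it by $(\gamma,F)\mapsto F|_{2k}\gamma^{-1}$. Then for every integer $k\ge 0$: 1. $E^{(\mathbf Q)}_{2k}(\Gamma[2])$ consists of Siegel modular forms of weight $2k$ on $\Gamma[2]$. 2. The action of $P$ on $S_{2k}(\Gamma(2))$ through $\pi$ factors through $H$, and $E^{(\mathbf Q)}_{2k}(\Gamma[2])\cong \mathrm{Ind}_H^{\mathfrak S_6}\, S_{2k}(\Gamma(2))$ as representations of $\mathfrak S_6$. 3. As a representation of $\mathfrak S_6$, $$E^{(\mathbf Q)}_{2k}(\Gamma[2])\cong d_{1,2k}\,(s[6]\oplus s[5,1])\oplus(2d_{1,2k}+d_{2,2k})\,s[4,2]\oplus(d_{1,2k}+d_{2,2k})\,(s[3,2,1]\oplus s[2^3])\oplus d_{4,2k}\,(s[3,1^3]\oplus s[2,1^4]).$$ -/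

import Mathlib

open scoped MatrixGroups ModularForm CongruenceSubgroup Modular

namespace LevelTwo

noncomputable section

/-! ## Irreducible representations of the symmetric groups -/

/-- Row of the `i`-th box in the diagram with rows of lengths `l`, the boxes being numbered
from left to right and from top to bottom. -/
def boxRow : List ℕ → ℕ → ℕ
  | [], _ => 0
  | l :: ls, i => if i < l then 0 else boxRow ls (i - l) + 1

/-- Column of the `i`-th box, with the same numbering. -/
def boxCol : List ℕ → ℕ → ℕ
  | [], _ => 0
  | l :: ls, i => if i < l then i else boxCol ls (i - l)

/-- The row lengths of the Young diagram of a partition, in decreasing order. -/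
def rowLengths {n : ℕ} (p : n.Partition) : List ℕ := p.parts.sort (· ≥ ·)

open Classical in
/-- The Young symmetrizer `c_p = a_p b_p` of the canonical tableau of `p`: `a_p` is the sum of
the permutations that preserve the rows, and `b_p` the signed sum of those that preserve
the columns. -/
def youngSymmetrizer {n : ℕ} (p : n.Partition) : MonoidAlgebra ℂ (Equiv.Perm (Fin n)) :=
  (∑ g : Equiv.Perm (Fin n),
    if ∀ i, boxRow (rowLengths p) (g i) = boxRow (rowLengths p) i
    then MonoidAlgebra.single g (1 : ℂ) else 0) *
  (∑ g : Equiv.Perm (Fin n),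
    if ∀ i, boxCol (rowLengths p) (g i) = boxCol (rowLengths p) i
    then MonoidAlgebra.single g (((Equiv.Perm.sign g : ℤˣ) : ℤ) : ℂ) else 0)

/-- The left ideal `ℂ[S_n] c_p`, as a subrepresentation of the left regular representation. -/
def irrepSub {n : ℕ} (p : n.Partition) :
    Subrepresentation (Representation.leftRegular ℂ (Equiv.Perm (Fin n))) where
  toSubmodule := LinearMap.range (LinearMap.mulRight ℂ (youngSymmetrizer p))
  apply_mem_toSubmodule g v hv := by
    obtain ⟨x, rfl⟩ := hv
    refine ⟨MonoidAlgebra.single g 1 * x, ?_⟩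
    have key : ∀ y : MonoidAlgebra ℂ (Equiv.Perm (Fin n)),
        Representation.leftRegular ℂ (Equiv.Perm (Fin n)) g y
          = MonoidAlgebra.single g 1 * y := by
      intro y
      have : (Representation.leftRegular ℂ (Equiv.Perm (Fin n)) g)
          = LinearMap.mulLeft ℂ (MonoidAlgebra.single g 1) := by
        ext; simp [Representation.ofMulAction_single]
      rw [this]; rfl
    rw [key]
    simp [mul_assoc]

/-- The irreducible representation `s[p]` of `S_n` attached to the partition `p` of `n`. -/
def irrep {n : ℕ} (p : n.Partition) :
    Representation ℂ (Equiv.Perm (Fin n)) (irrepSub p).toSubmodule :=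
  (irrepSub p).toRepresentation

/-- The direct sum over the partitions `p` of `n` of `m p` copies of `s[p]`. -/
def isotypicSum {n : ℕ} (m : n.Partition → ℕ) :=
  Representation.directSum (k := ℂ) (G := Equiv.Perm (Fin n))
    (fun i : (Σ p : n.Partition, Fin (m p)) => irrep i.1)

/-- `V`, a representation of a group `G` given with a homomorphism `φ` to `S_n` (an
identification of a quotient of `G` with `S_n`), is isomorphic to `⨁ p, m p • s[p]`, where `G`
acts on the latter through `φ`. -/
def HasDecomposition {n : ℕ} {G V : Type*} [Group G] [AddCommGroup V] [Module ℂ V]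
    (ρ : Representation ℂ G V) (φ : G →* Equiv.Perm (Fin n)) (m : n.Partition → ℕ) : Prop :=
  Nonempty (ρ.Equiv ((isotypicSum m).comp φ))

/-! ## Elliptic cusp forms -/

/-- The action of `SL(2, ℤ)` on `S_k(Γ(2))`: `γ` sends `f` to `f ∣[k] γ⁻¹`. -/
def cuspRep (k : ℤ) : Representation ℂ SL(2, ℤ) (CuspForm Γ(2) k) where
  toFun γ :=
    { toFun := fun f =>
        { toFun := ⇑f ∣[k] γ⁻¹
          slash_action_eq' := by
            rintro _ ⟨δ, hδ, rfl⟩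
            have hN : (Γ(2)).Normal := CongruenceSubgroup.Gamma_normal 2
            have h := hN.conj_mem δ hδ γ⁻¹
            have h2 := SlashInvariantFormClass.slash_action_eq f
              (Matrix.SpecialLinearGroup.mapGL ℝ (γ⁻¹ * δ * γ⁻¹⁻¹)) ⟨_, h, rfl⟩
            change (⇑f ∣[k] γ⁻¹) ∣[k] δ = ⇑f ∣[k] γ⁻¹
            change ⇑f ∣[k] (γ⁻¹ * δ * γ⁻¹⁻¹) = ⇑f at h2
            conv_rhs => rw [← h2]
            rw [← SlashAction.slash_mul, ← SlashAction.slash_mul]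
            congr 1
            group
          holo' := (CuspFormClass.holo f).slash k _
          zero_at_cusps' := by
            intro c hc
            change c.IsZeroAt (⇑f ∣[k] (Matrix.SpecialLinearGroup.mapGL ℝ γ⁻¹)) k
            rw [← OnePoint.IsZeroAt.smul_iff]
            apply CuspFormClass.zero_at_cusps f
            rw [Subgroup.IsArithmetic.isCusp_iff_isCusp_SL2Z] at hc ⊢
            exact hc.smul_of_mem ⟨_, rfl⟩ }
      map_add' := fun f g => by
        ext τ
        exact congrFun (SlashAction.add_slash k γ⁻¹ (f : UpperHalfPlane → ℂ) g) τ
      map_smul' := fun c f => by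
        ext τ
        exact congrFun (ModularForm.SL_smul_slash k γ⁻¹ (f : UpperHalfPlane → ℂ) c) τ }
  map_one' := by
    ext f τ
    change (⇑f ∣[k] (1 : SL(2, ℤ))⁻¹) τ = f τ
    simp
  map_mul' γ δ := by
    ext f τ
    change (⇑f ∣[k] (γ * δ)⁻¹) τ = ((⇑f ∣[k] δ⁻¹) ∣[k] γ⁻¹) τ
    rw [← SlashAction.slash_mul, mul_inv_rev]

/-- The Petersson product on `S_k(Γ₀(N))`: the integral of `conj f * g * y ^ k` against
`dx dy / y ^ 2` over the fundamental domain `⋃ α 𝒟` of `Γ₀(N)`, where `α` runs over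
representatives of `Γ₀(N) \ SL(2, ℤ)`. -/
def peterssonInner (N : ℕ) (k : ℤ) (f g : CuspForm (CongruenceSubgroup.Gamma0 N) k) : ℂ :=
  ∑ᶠ q : SL(2, ℤ) ⧸ CongruenceSubgroup.Gamma0 N,
    ∫ τ in (𝒟 : Set UpperHalfPlane), UpperHalfPlane.petersson k f g (q.out⁻¹ • τ)

/-- The old subspace of `S_k(Γ₀(N))`, spanned by the forms `τ ↦ f (d τ)` with
`f ∈ S_k(Γ₀(M))`, `M` a proper divisor of `N` and `d ∣ N / M`. -/
def oldSubspace (N : ℕ) (k : ℤ) : Submodule ℂ (CuspForm (CongruenceSubgroup.Gamma0 N) k) :=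
  Submodule.span ℂ {g | ∃ M d : ℕ, M * d ∣ N ∧ M ≠ N ∧
    ∃ f : CuspForm (CongruenceSubgroup.Gamma0 M) k,
      ∀ τ τ' : UpperHalfPlane, (τ' : ℂ) = d * (τ : ℂ) → g τ = f τ'}

/-- The new subspace of `S_k(Γ₀(N))`: the orthogonal complement of the old subspace for the
Petersson product (a subspace already, so that the span adds nothing). -/
def newSubspace (N : ℕ) (k : ℤ) : Submodule ℂ (CuspForm (CongruenceSubgroup.Gamma0 N) k) :=
  Submodule.span ℂ {f | ∀ g ∈ oldSubspace N k, peterssonInner N k g f = 0}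

/-- `d_{N,k} = dim S_k(Γ₀(N))^new`. -/
def newDim (N : ℕ) (k : ℤ) : ℕ := Module.finrank ℂ (newSubspace N k)

/-! ## The Siegel upper half space of degree two and the slash action of `Sp(4, ℤ)` -/

/-- The group `Sp(4, ℤ)`; the index set `Fin 2 ⊕ Fin 2` gives the block notation
`(a, b; c, d)`. -/
abbrev Sp4Z := Matrix.symplecticGroup (Fin 2) ℤ

/-- The Siegel upper half space of degree two. -/
def SiegelHalfSpace :=
  {τ : Matrix (Fin 2) (Fin 2) ℂ // τ.transpose = τ ∧ (τ.map Complex.im).PosDef}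

/-- The block `a τ + b`. -/
def siegelNum (γ : Sp4Z) (τ : SiegelHalfSpace) : Matrix (Fin 2) (Fin 2) ℂ :=
  (γ.1.toBlocks₁₁.map (Int.cast : ℤ → ℂ)) * τ.1 + γ.1.toBlocks₁₂.map (Int.cast : ℤ → ℂ)

/-- The block `c τ + d`. -/
def siegelDen (γ : Sp4Z) (τ : SiegelHalfSpace) : Matrix (Fin 2) (Fin 2) ℂ :=
  (γ.1.toBlocks₂₁.map (Int.cast : ℤ → ℂ)) * τ.1 + γ.1.toBlocks₂₂.map (Int.cast : ℤ → ℂ)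

namespace SiegelHalfSpace

/-- The relations between the blocks of a symplectic matrix, over `ℂ`, in the form used below. -/
theorem block_rel (γ : Sp4Z) (s t : Matrix (Fin 2) (Fin 2) ℂ) :
    (s * (γ.1.toBlocks₁₁.map (Int.cast : ℤ → ℂ)).transpose
        + (γ.1.toBlocks₁₂.map (Int.cast : ℤ → ℂ)).transpose)
      * (γ.1.toBlocks₂₁.map (Int.cast : ℤ → ℂ) * t + γ.1.toBlocks₂₂.map (Int.cast : ℤ → ℂ))
    - (s * (γ.1.toBlocks₂₁.map (Int.cast : ℤ → ℂ)).transpose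
        + (γ.1.toBlocks₂₂.map (Int.cast : ℤ → ℂ)).transpose)
      * (γ.1.toBlocks₁₁.map (Int.cast : ℤ → ℂ) * t + γ.1.toBlocks₁₂.map (Int.cast : ℤ → ℂ))
    = s - t := by
  have h := γ.2
  rw [← Matrix.fromBlocks_toBlocks γ.1, SymplecticGroup.fromBlocks_mem_iff] at h
  obtain ⟨h1, h2, h3⟩ := h
  have toC : ∀ {A B : Matrix (Fin 2) (Fin 2) ℤ}, A = B →
      A.map (Int.castRingHom ℂ) = B.map (Int.castRingHom ℂ) := fun h => by rw [h]
  have h1 := toC h1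
  have h2 := toC h2
  have h4 := congrArg Matrix.transpose (toC h3)
  have h3 := toC h3
  simp only [Matrix.map_mul, Matrix.transpose_map,
    Matrix.map_sub (Int.castRingHom ℂ) (fun a b => map_sub (Int.castRingHom ℂ) a b),
    Matrix.map_one (Int.castRingHom ℂ) (map_zero _) (map_one _), Matrix.transpose_sub,
    Matrix.transpose_mul, Matrix.transpose_transpose, Matrix.transpose_one] at h1 h2 h3 h4
  simp only [show (⇑(Int.castRingHom ℂ) : ℤ → ℂ) = Int.cast from rfl] at h1 h2 h3 h4
  set a := γ.1.toBlocks₁₁.map (Int.cast : ℤ → ℂ)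
  set b := γ.1.toBlocks₁₂.map (Int.cast : ℤ → ℂ)
  set c := γ.1.toBlocks₂₁.map (Int.cast : ℤ → ℂ)
  set d := γ.1.toBlocks₂₂.map (Int.cast : ℤ → ℂ)
  have e : (s * a.transpose + b.transpose) * (c * t + d)
      - (s * c.transpose + d.transpose) * (a * t + b)
      = s * (a.transpose * c - c.transpose * a) * t + s * (a.transpose * d - c.transpose * b)
        - (d.transpose * a - b.transpose * c) * t
        + (b.transpose * d - d.transpose * b) := by
    noncomm_ring
  rw [e, h1, h2, h3, h4]
  simp

theorem im_form {τ : Matrix (Fin 2) (Fin 2) ℂ} (h : τ.transpose = τ) (v : Fin 2 → ℂ) :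
    (star v ⬝ᵥ τ.mulVec v).im
      = (fun i => (v i).re) ⬝ᵥ (τ.map Complex.im).mulVec (fun i => (v i).re)
        + (fun i => (v i).im) ⬝ᵥ (τ.map Complex.im).mulVec (fun i => (v i).im) := by
  have h' : τ 1 0 = τ 0 1 := congrFun (congrFun h 0) 1
  simp [dotProduct, Matrix.mulVec, Fin.sum_univ_two, h']
  ring

theorem im_pos (τ : SiegelHalfSpace) {v : Fin 2 → ℂ} (hv : v ≠ 0) :
    0 < (star v ⬝ᵥ τ.1.mulVec v).im := by
  have nn : ∀ x : Fin 2 → ℝ, 0 ≤ x ⬝ᵥ (τ.1.map Complex.im).mulVec x := fun x => by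
    simpa using τ.2.2.posSemidef.dotProduct_mulVec_nonneg x
  have pp : ∀ x : Fin 2 → ℝ, x ≠ 0 → 0 < x ⬝ᵥ (τ.1.map Complex.im).mulVec x := fun x hx => by
    simpa using τ.2.2.dotProduct_mulVec_pos hx
  rw [im_form τ.2.1]
  by_cases h : (fun i => (v i).re) = 0
  · refine add_pos_of_nonneg_of_pos (nn _) (pp _ fun h2 => hv ?_)
    funext i
    exact Complex.ext (congrFun h i) (congrFun h2 i)
  · exact add_pos_of_pos_of_nonneg (pp _ h) (nn _)

theorem posDef_of_im_pos {τ : Matrix (Fin 2) (Fin 2) ℂ} (h : τ.transpose = τ)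
    (hp : ∀ v : Fin 2 → ℂ, v ≠ 0 → 0 < (star v ⬝ᵥ τ.mulVec v).im) :
    (τ.map Complex.im).PosDef := by
  refine Matrix.PosDef.of_dotProduct_mulVec_pos ?_ fun x hx => ?_
  · change (τ.map Complex.im).conjTranspose = _
    rw [Matrix.conjTranspose_eq_transpose_of_trivial, ← Matrix.transpose_map, h]
  · have := hp (fun i => (x i : ℂ)) (fun h0 => hx (funext fun i => by
      simpa using congrFun h0 i))
    rw [im_form h] at this
    simpa [dotProduct, Matrix.mulVec, Fin.sum_univ_two] using this

theorem conj_map (A : Matrix (Fin 2) (Fin 2) ℤ) :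
    (A.map (Int.cast : ℤ → ℂ)).conjTranspose = (A.map (Int.cast : ℤ → ℂ)).transpose := by
  ext i j; simp

theorem im_num_den (γ : Sp4Z) (τ : SiegelHalfSpace) (v : Fin 2 → ℂ) :
    (star ((siegelDen γ τ).mulVec v) ⬝ᵥ (siegelNum γ τ).mulVec v).im
      = (star v ⬝ᵥ τ.1.mulVec v).im := by
  have h := block_rel γ τ.1.conjTranspose τ.1
  have hN : (siegelNum γ τ).conjTranspose * siegelDen γ τ
      - (siegelDen γ τ).conjTranspose * siegelNum γ τ = τ.1.conjTranspose - τ.1 := by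
    rw [← h]
    simp only [siegelNum, siegelDen, Matrix.conjTranspose_add, Matrix.conjTranspose_mul, conj_map]
  have key : ∀ M N : Matrix (Fin 2) (Fin 2) ℂ, star (N.mulVec v) ⬝ᵥ M.mulVec v
      = star v ⬝ᵥ (N.conjTranspose * M).mulVec v := fun M N => by
    rw [Matrix.star_mulVec, ← Matrix.dotProduct_mulVec, Matrix.mulVec_mulVec]
  have imc : ∀ M : Matrix (Fin 2) (Fin 2) ℂ,
      (star v ⬝ᵥ (M.conjTranspose - M).mulVec v).im = -2 * (star v ⬝ᵥ M.mulVec v).im := by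
    intro M
    simp [dotProduct, Matrix.mulVec, Fin.sum_univ_two]
    ring
  have e1 := imc ((siegelDen γ τ).conjTranspose * siegelNum γ τ)
  rw [Matrix.conjTranspose_mul, Matrix.conjTranspose_conjTranspose, hN, imc] at e1
  rw [key]
  linarith

theorem isUnit_den (γ : Sp4Z) (τ : SiegelHalfSpace) : IsUnit (siegelDen γ τ).det := by
  rw [isUnit_iff_ne_zero]
  intro h0
  obtain ⟨v, hv, h⟩ := Matrix.exists_mulVec_eq_zero_iff.mpr h0
  have h1 := im_num_den γ τ v
  have h2 := im_pos τ hv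
  rw [h, star_zero, zero_dotProduct, Complex.zero_im] at h1
  linarith

/-- The action `γ τ = (a τ + b) (c τ + d)⁻¹`. -/
def act (γ : Sp4Z) (τ : SiegelHalfSpace) : SiegelHalfSpace :=
  ⟨siegelNum γ τ * (siegelDen γ τ)⁻¹, by
    have hu := isUnit_den γ τ
    have hs : (siegelNum γ τ * (siegelDen γ τ)⁻¹).transpose
        = siegelNum γ τ * (siegelDen γ τ)⁻¹ := by
      have h := block_rel γ τ.1 τ.1
      have h' : (siegelNum γ τ).transpose * siegelDen γ τ
          = (siegelDen γ τ).transpose * siegelNum γ τ := by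
        rw [← sub_eq_zero, ← sub_self τ.1, ← h]
        simp only [siegelNum, siegelDen, Matrix.transpose_add, Matrix.transpose_mul, τ.2.1]
      have hu' : IsUnit (siegelDen γ τ).transpose.det := by rwa [Matrix.det_transpose]
      rw [Matrix.transpose_mul, Matrix.transpose_nonsing_inv]
      calc (siegelDen γ τ).transpose⁻¹ * (siegelNum γ τ).transpose
          = (siegelDen γ τ).transpose⁻¹ * ((siegelNum γ τ).transpose * siegelDen γ τ)
              * (siegelDen γ τ)⁻¹ := by
            rw [Matrix.mul_assoc, Matrix.mul_assoc, Matrix.mul_nonsing_inv _ hu, Matrix.mul_one]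
        _ = _ := by
            rw [h', ← Matrix.mul_assoc, Matrix.nonsing_inv_mul _ hu', Matrix.one_mul]
    refine ⟨hs, posDef_of_im_pos hs fun v hv => ?_⟩
    have hw : (siegelDen γ τ).mulVec ((siegelDen γ τ)⁻¹.mulVec v) = v := by
      rw [Matrix.mulVec_mulVec, Matrix.mul_nonsing_inv _ hu, Matrix.one_mulVec]
    have hne : (siegelDen γ τ)⁻¹.mulVec v ≠ 0 := fun h => hv (by
      rw [← hw, h, Matrix.mulVec_zero])
    have h1 := im_num_den γ τ ((siegelDen γ τ)⁻¹.mulVec v)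
    rw [hw, Matrix.mulVec_mulVec] at h1
    rw [h1]
    exact im_pos τ hne⟩

theorem act_mul_den (γ : Sp4Z) (τ : SiegelHalfSpace) :
    (act γ τ).1 * siegelDen γ τ = siegelNum γ τ := by
  change siegelNum γ τ * (siegelDen γ τ)⁻¹ * siegelDen γ τ = _
  rw [Matrix.mul_assoc, Matrix.nonsing_inv_mul _ (isUnit_den γ τ), Matrix.mul_one]

theorem blocks_mul (γ δ : Sp4Z) :
    (γ * δ).1.toBlocks₁₁ = γ.1.toBlocks₁₁ * δ.1.toBlocks₁₁ + γ.1.toBlocks₁₂ * δ.1.toBlocks₂₁ ∧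
    (γ * δ).1.toBlocks₁₂ = γ.1.toBlocks₁₁ * δ.1.toBlocks₁₂ + γ.1.toBlocks₁₂ * δ.1.toBlocks₂₂ ∧
    (γ * δ).1.toBlocks₂₁ = γ.1.toBlocks₂₁ * δ.1.toBlocks₁₁ + γ.1.toBlocks₂₂ * δ.1.toBlocks₂₁ ∧
    (γ * δ).1.toBlocks₂₂ = γ.1.toBlocks₂₁ * δ.1.toBlocks₁₂ + γ.1.toBlocks₂₂ * δ.1.toBlocks₂₂ := by
  have h : (γ * δ).1 = Matrix.fromBlocks γ.1.toBlocks₁₁ γ.1.toBlocks₁₂ γ.1.toBlocks₂₁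
      γ.1.toBlocks₂₂ * Matrix.fromBlocks δ.1.toBlocks₁₁ δ.1.toBlocks₁₂ δ.1.toBlocks₂₁
      δ.1.toBlocks₂₂ := by
    rw [Matrix.fromBlocks_toBlocks, Matrix.fromBlocks_toBlocks]; rfl
  rw [h, Matrix.fromBlocks_multiply]
  simp

theorem map_mul_add (A B C D : Matrix (Fin 2) (Fin 2) ℤ) :
    (A * B + C * D).map (Int.cast : ℤ → ℂ)
      = A.map (Int.cast : ℤ → ℂ) * B.map (Int.cast : ℤ → ℂ)
        + C.map (Int.cast : ℤ → ℂ) * D.map (Int.cast : ℤ → ℂ) := by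
  ext i j
  simp [Matrix.mul_apply]

theorem num_mul (γ δ : Sp4Z) (τ : SiegelHalfSpace) :
    siegelNum (γ * δ) τ = siegelNum γ (act δ τ) * siegelDen δ τ := by
  obtain ⟨h1, h2, -, -⟩ := blocks_mul γ δ
  have h := act_mul_den δ τ
  conv_rhs => rw [siegelNum, Matrix.add_mul, Matrix.mul_assoc, h]
  rw [siegelNum, h1, h2, map_mul_add, map_mul_add, siegelNum, siegelDen]
  noncomm_ring

theorem den_mul (γ δ : Sp4Z) (τ : SiegelHalfSpace) :
    siegelDen (γ * δ) τ = siegelDen γ (act δ τ) * siegelDen δ τ := by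
  obtain ⟨-, -, h1, h2⟩ := blocks_mul γ δ
  have h := act_mul_den δ τ
  conv_rhs => rw [siegelDen, Matrix.add_mul, Matrix.mul_assoc, h]
  rw [siegelDen, h1, h2, map_mul_add, map_mul_add, siegelNum, siegelDen]
  noncomm_ring

theorem den_one (τ : SiegelHalfSpace) : siegelDen 1 τ = 1 := by
  have h1 : (1 : Sp4Z).1.toBlocks₂₁ = 0 := by ext i j; simp [Matrix.toBlocks₂₁]
  have h2 : (1 : Sp4Z).1.toBlocks₂₂ = 1 := by
    ext i j; simp [Matrix.toBlocks₂₂, Matrix.one_apply]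
  rw [siegelDen, h1, h2]
  ext i j
  simp [Matrix.one_apply]

theorem num_one (τ : SiegelHalfSpace) : siegelNum 1 τ = τ.1 := by
  have h1 : (1 : Sp4Z).1.toBlocks₁₂ = 0 := by ext i j; simp [Matrix.toBlocks₁₂]
  have h2 : (1 : Sp4Z).1.toBlocks₁₁ = 1 := by
    ext i j; simp [Matrix.toBlocks₁₁, Matrix.one_apply]
  rw [siegelNum, h1, h2, Matrix.map_one _ Int.cast_zero Int.cast_one,
    Matrix.map_zero _ Int.cast_zero, Matrix.one_mul, add_zero]

instance : MulAction Sp4Z SiegelHalfSpace where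
  smul := act
  one_smul τ := Subtype.ext (by
    change siegelNum 1 τ * (siegelDen 1 τ)⁻¹ = τ.1
    rw [den_one, num_one, inv_one, Matrix.mul_one])
  mul_smul γ δ τ := Subtype.ext (by
    change siegelNum (γ * δ) τ * (siegelDen (γ * δ) τ)⁻¹
      = siegelNum γ (act δ τ) * (siegelDen γ (act δ τ))⁻¹
    rw [num_mul, den_mul, Matrix.mul_inv_rev, Matrix.mul_assoc,
      Matrix.mul_nonsing_inv_cancel_left _ _ (isUnit_den δ τ)])

end SiegelHalfSpace

/-- `(F ∣_k γ)(τ) = det (c τ + d) ^ (-k) * F (γ τ)`. -/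
def siegelSlash (k : ℤ) (γ : Sp4Z) (F : SiegelHalfSpace → ℂ) : SiegelHalfSpace → ℂ :=
  fun τ => (siegelDen γ τ).det ^ (-k) * F (γ • τ)

theorem siegelSlash_mul (k : ℤ) (γ δ : Sp4Z) (F : SiegelHalfSpace → ℂ) :
    siegelSlash k (γ * δ) F = siegelSlash k δ (siegelSlash k γ F) := by
  funext τ
  simp only [siegelSlash]
  rw [SiegelHalfSpace.den_mul, Matrix.det_mul, mul_zpow, mul_smul]
  change _ = (siegelDen δ τ).det ^ (-k)
    * ((siegelDen γ (SiegelHalfSpace.act δ τ)).det ^ (-k) * F (γ • δ • τ))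
  ring

theorem siegelSlash_one (k : ℤ) (F : SiegelHalfSpace → ℂ) : siegelSlash k 1 F = F := by
  funext τ
  simp [siegelSlash, SiegelHalfSpace.den_one]

/-- The action of `Sp(4, ℤ)` on functions: `γ` sends `F` to `F ∣_k γ⁻¹`. -/
def siegelRep (k : ℤ) : Representation ℂ Sp4Z (SiegelHalfSpace → ℂ) where
  toFun γ :=
    { toFun := fun F => siegelSlash k γ⁻¹ F
      map_add' := fun F G => by funext τ; simp [siegelSlash, mul_add]
      map_smul' := fun c F => by funext τ; simp [siegelSlash]; ring }
  map_one' := by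
    ext F : 1
    change siegelSlash k 1⁻¹ F = F
    rw [inv_one, siegelSlash_one]
  map_mul' γ δ := by
    ext F : 1
    change siegelSlash k (γ * δ)⁻¹ F = siegelSlash k γ⁻¹ (siegelSlash k δ⁻¹ F)
    rw [mul_inv_rev, siegelSlash_mul]

/-- The principal congruence subgroup `Γ[2]` of `Sp(4, ℤ)`, the kernel of the reduction
modulo `2`. -/
def siegelGamma2 : Subgroup Sp4Z :=
  MonoidHom.ker (((Int.castRingHom (ZMod 2)).mapMatrix (m := Fin 2 ⊕ Fin 2)).toMonoidHom.comp
    (Matrix.symplecticGroup (Fin 2) ℤ).subtype)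

/-- The symmetric matrix with entries `τ₁₁, τ₁₂, τ₂₂`. -/
def symMat (p : Fin 3 → ℂ) : Matrix (Fin 2) (Fin 2) ℂ := !![p 0, p 1; p 1, p 2]

open Classical in
/-- Holomorphy in the three coordinates `τ₁₁, τ₁₂, τ₂₂`. -/
def IsHolomorphic (F : SiegelHalfSpace → ℂ) : Prop :=
  DifferentiableOn ℂ
    (fun p : Fin 3 → ℂ =>
      if h : (symMat p).transpose = symMat p ∧ ((symMat p).map Complex.im).PosDef
      then F ⟨symMat p, h⟩ else 0)
    {p | ((symMat p).map Complex.im).PosDef}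

/-- `F` is a Siegel modular form of degree two and weight `k` on `Γ[2]` (in degree two no
condition at the cusps is needed). -/
def IsSiegelForm (k : ℤ) (F : SiegelHalfSpace → ℂ) : Prop :=
  IsHolomorphic F ∧ ∀ γ ∈ siegelGamma2, ∀ τ, F (γ • τ) = (siegelDen γ τ).det ^ k * F τ

/-! ## The Klingen parabolic subgroup and Klingen-Eisenstein series -/

/-- The second basis vector of `ℤ⁴`. -/
def klingenVec : Fin 2 ⊕ Fin 2 → ℤ := Pi.single (Sum.inl 1) 1

/-- The Klingen parabolic subgroup of `Sp(4, ℤ)`, the stabiliser of the isotropic line spanned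
by the second basis vector. It is the stabiliser in `Sp(4, ℤ)` of the one-dimensional boundary
component that is reached for `τ₂₂ → i∞`. -/
def klingen : Subgroup Sp4Z where
  carrier := {γ | γ.1.mulVec klingenVec = klingenVec ∨ γ.1.mulVec klingenVec = -klingenVec}
  one_mem' := Or.inl (by simp)
  mul_mem' := by
    rintro γ δ (h | h) (h' | h') <;>
      simp [Set.mem_ofPred_eq, ← Matrix.mulVec_mulVec, h, h', Matrix.mulVec_neg]
  inv_mem' := by
    intro γ h
    have hi : ∀ v, (γ⁻¹).1.mulVec (γ.1.mulVec v) = v := fun v => by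
      rw [Matrix.mulVec_mulVec]
      have : (γ⁻¹).1 * γ.1 = 1 := congrArg Subtype.val (inv_mul_cancel γ)
      rw [this, Matrix.one_mulVec]
    rcases h with h | h
    · left
      have := hi klingenVec
      rwa [h] at this
    · right
      have := hi klingenVec
      rw [h, Matrix.mulVec_neg] at this
      rw [← this, neg_neg, this]

theorem klingen_col (γ : klingen) (i : Fin 2 ⊕ Fin 2) (hi : i ≠ Sum.inl 1) :
    γ.1.1 i (Sum.inl 1) = 0 := by
  rcases γ.2 with h | h <;>
  · have := congrFun h i
    simpa [klingenVec, hi] using this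

theorem klingen_unit (γ : klingen) : γ.1.1 (Sum.inl 1) (Sum.inl 1) ≠ 0 := by
  rcases γ.2 with h | h <;>
  · have := congrFun h (Sum.inl 1)
    simp [klingenVec] at this
    omega

theorem klingen_row (γ : klingen) (j : Fin 2 ⊕ Fin 2) (hj : j ≠ Sum.inr 1) :
    γ.1.1 (Sum.inr 1) j = 0 := by
  have h := SymplecticGroup.mem_iff'.mp γ.1.2
  have h' := congrFun (congrFun h (Sum.inl 1)) j
  have c0 := klingen_col γ (Sum.inl 0) (by decide)
  have c1 := klingen_col γ (Sum.inr 0) (by decide)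
  have c2 := klingen_col γ (Sum.inr 1) (by decide)
  have u := klingen_unit γ
  have hz : (Matrix.J (Fin 2) ℤ) (Sum.inl 1) j = 0 := by
    revert hj
    rcases j with j | j <;> fin_cases j <;> simp [Matrix.J]
  rw [hz] at h'
  simp [Matrix.mul_apply, Matrix.J, Fin.sum_univ_two, Matrix.one_apply, c0, c1, c2] at h'
  tauto

/-- The submatrix formed by the rows and columns `1` and `3`. -/
def klingenBlockMat (γ : klingen) : Matrix (Fin 2) (Fin 2) ℤ :=
  !![γ.1.1 (Sum.inl 0) (Sum.inl 0), γ.1.1 (Sum.inl 0) (Sum.inr 0);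
    γ.1.1 (Sum.inr 0) (Sum.inl 0), γ.1.1 (Sum.inr 0) (Sum.inr 0)]

theorem klingenBlockMat_det (γ : klingen) : (klingenBlockMat γ).det = 1 := by
  have h := SymplecticGroup.mem_iff'.mp γ.1.2
  have h' := congrFun (congrFun h (Sum.inl 0)) (Sum.inr 0)
  have r0 := klingen_row γ (Sum.inl 0) (by decide)
  have r1 := klingen_row γ (Sum.inr 0) (by decide)
  simp [Matrix.mul_apply, Matrix.J, Fin.sum_univ_two, Matrix.one_apply, r0, r1] at h'
  rw [klingenBlockMat, Matrix.det_fin_two_of]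
  linarith

theorem klingenBlockMat_mul (γ δ : klingen) :
    klingenBlockMat (γ * δ) = klingenBlockMat γ * klingenBlockMat δ := by
  have c0 := klingen_col γ (Sum.inl 0) (by decide)
  have c1 := klingen_col γ (Sum.inr 0) (by decide)
  have r0 := klingen_row δ (Sum.inl 0) (by decide)
  have r1 := klingen_row δ (Sum.inr 0) (by decide)
  ext i j
  fin_cases i <;> fin_cases j <;>
    simp [klingenBlockMat, Matrix.mul_apply, Fin.sum_univ_two, c0, c1, r0, r1]

theorem klingenBlockMat_one : klingenBlockMat 1 = 1 := by
  ext i j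
  fin_cases i <;> fin_cases j <;> simp [klingenBlockMat]

/-- The homomorphism to `SL(2, ℤ)` given by the rows and columns `1` and `3`; it describes the
action of the Klingen parabolic on the boundary component. -/
def klingenBlock : klingen →* SL(2, ℤ) where
  toFun γ := ⟨klingenBlockMat γ, klingenBlockMat_det γ⟩
  map_one' := Subtype.ext klingenBlockMat_one
  map_mul' γ δ := Subtype.ext (klingenBlockMat_mul γ δ)

theorem im_entry_pos (τ : SiegelHalfSpace) : 0 < (τ.1 0 0).im := by
  simpa using τ.2.2.diag_pos (i := 0)

/-- The function `τ ↦ f (τ₁₁)`. -/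
def klingenLift {k : ℤ} (f : CuspForm Γ(2) k) : SiegelHalfSpace → ℂ :=
  fun τ => f ⟨τ.1 0 0, im_entry_pos τ⟩

/-- `F` is the Klingen-Eisenstein series on `Γ[2]` of the cusp form `f` on `Γ(2)`:
`F τ = ∑ f ((γ τ)₁₁) * det (c τ + d) ^ (-k)`, an (absolutely) convergent sum over representatives
`γ` of `(klingen ∩ Γ[2]) \ Γ[2]`. The representatives are the inverses of representatives of the
left cosets. -/
def IsKlingenSeries (k : ℤ) (f : CuspForm Γ(2) k) (F : SiegelHalfSpace → ℂ) : Prop :=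
  ∀ τ, HasSum
    (fun q : siegelGamma2 ⧸ klingen.subgroupOf siegelGamma2 =>
      siegelSlash k ((q.out : siegelGamma2)⁻¹ : siegelGamma2).1 (klingenLift f) τ) (F τ)

/-- The space `E^(Q)_k(Γ[2])` of Klingen-Eisenstein series, spanned by the Klingen-Eisenstein
series attached to all the one-dimensional cusps, that is by all translates under `Sp(4, ℤ)`
of the series above, as a subrepresentation of the space of functions. -/
def klingenEisenstein (k : ℤ) : Subrepresentation (siegelRep k) where
  toSubmodule := Submodule.span ℂ
    {F | ∃ (γ : Sp4Z) (f : CuspForm Γ(2) k) (F₀ : SiegelHalfSpace → ℂ),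
      IsKlingenSeries k f F₀ ∧ F = siegelRep k γ F₀}
  apply_mem_toSubmodule g v hv := by
    induction hv using Submodule.span_induction with
    | mem x hx =>
      obtain ⟨γ, f, F₀, h, rfl⟩ := hx
      refine Submodule.subset_span ⟨g * γ, f, F₀, h, ?_⟩
      rw [map_mul]
      rfl
    | zero => rw [map_zero]; exact Submodule.zero_mem _
    | add x y _ _ hx hy => rw [map_add]; exact Submodule.add_mem _ hx hy
    | smul c x _ hx => rw [map_smul]; exact Submodule.smul_mem _ c hx

/-! ## The identifications with symmetric groups, and the multiplicities -/

/-- `φ` induces an isomorphism of `SL(2, ℤ) / Γ(2)` with `S_3`. -/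
def IsS3Identification (φ : SL(2, ℤ) →* Equiv.Perm (Fin 3)) : Prop :=
  Function.Surjective φ ∧ φ.ker = Γ(2)

/-- The element of `Sp(4, ℤ)` whose class corresponds to `(12)`. -/
def matTransposition : Sp4Z :=
  ⟨Matrix.fromBlocks !![1, 0; 0, 1] !![1, 0; 0, 0] !![0, 0; 0, 0] !![1, 0; 0, 1], by
    rw [SymplecticGroup.mem_iff]; decide⟩

/-- The element of `Sp(4, ℤ)` whose class corresponds to `(123456)`. -/
def matCycle : Sp4Z :=
  ⟨Matrix.fromBlocks !![0, 1; 1, 0] !![0, 1; 1, 0] !![1, 0; -1, 1] !![1, 1; 0, 1], by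
    rw [SymplecticGroup.mem_iff]; decide⟩

/-- `φ` induces the isomorphism of `Sp(4, ℤ) / Γ[2]` with `S_6` for which the classes of the two
matrices above correspond to `(12)` and to `(123456)`. -/
def IsS6Identification (φ : Sp4Z →* Equiv.Perm (Fin 6)) : Prop :=
  Function.Surjective φ ∧ φ.ker = siegelGamma2 ∧
    φ matTransposition = Equiv.swap 0 1 ∧ φ matCycle = finRotate 6

/-- Multiplicities in `d_{1,2k} s[3] + (d_{1,2k} + d_{2,2k}) s[2,1] + d_{4,2k} s[1³]`. -/
def cuspMult (k : ℕ) (p : (3).Partition) : ℕ :=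
  if p.parts = {3} then newDim 1 (2 * k)
  else if p.parts = {2, 1} then newDim 1 (2 * k) + newDim 2 (2 * k)
  else if p.parts = {1, 1, 1} then newDim 4 (2 * k)
  else 0

/-- Multiplicities in `d_{1,2k} (s[6] + s[5,1]) + (2 d_{1,2k} + d_{2,2k}) s[4,2]
+ (d_{1,2k} + d_{2,2k}) (s[3,2,1] + s[2³]) + d_{4,2k} (s[3,1³] + s[2,1⁴])`. -/
def klingenMult (k : ℕ) (p : (6).Partition) : ℕ :=
  if p.parts = {6} ∨ p.parts = {5, 1} then newDim 1 (2 * k)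
  else if p.parts = {4, 2} then 2 * newDim 1 (2 * k) + newDim 2 (2 * k)
  else if p.parts = {3, 2, 1} ∨ p.parts = {2, 2, 2} then newDim 1 (2 * k) + newDim 2 (2 * k)
  else if p.parts = {3, 1, 1, 1} ∨ p.parts = {2, 1, 1, 1, 1} then newDim 4 (2 * k)
  else 0

end

end LevelTwo

namespace LevelTwo

noncomputable section

/-! ## Young symmetrizers -/

/-! Put w = 2k. Elliptic part: `T` and `lowerUnipotent` act on S_w(Γ(2)) as two transpositions
generating S₃. Their fixed spaces are S_w(Γ₀(2)) and S_w(Γ⁰(2)), whose intersection is S_w(SL(2,ℤ)),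
of dimension d₁. The slash operator of diag(2,1), which is F(τ) ↦ F(2τ) up to a constant, carries
forms on Γ(2) to forms on Γ₀(4) and forms on Γ⁰(2) to forms on Γ₀(2). Hence the old space of level 4
is the image of the sum of the two fixed spaces, and d₄ is the codimension of that sum, which is the
multiplicity of the sign. In level 2 the old space is S_w(1) plus its dilate; the sum is direct
(`eq_zero_of_dilate_mem`), so a fixed space has dimension 2d₁ + d₂, and s[2,1] occurs (2d₁ + d₂) -
d₁ times. This is `isCuspAction_cuspRep`; it rests on `newDim_add_finrank_oldSubspace`, the positive
definiteness of the Petersson product.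

Klingen series: each term is bounded by a power -w/2 of a positive definite quadratic form evaluated
at the last row of the matrix (`norm_siegelSlash_klingenLift_le`), and distinct cosets have distinct
last rows in ℤ⁴. So the series converges for w ≥ 6, and below that there are no cusp forms on Γ(2)
(`Gamma_two_eq_zero`). Normality of Γ[2] makes the series compatible with P, which gives an
equivariant map from the induced representation onto the Klingen space. Letting τ₂₂ → i∞ recovers f
from its own series and kills the translates that belong to other boundary components, so the map is
injective (`IsS6Identification.klingen_ind_equiv`).

Finite groups: Sp(4, 𝔽₂) permutes the six odd quadratic forms, which is the identification with S₆.
The image H of P is the centraliser of a transposition, of index 15, and it acts on cusp forms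
through S₄ → S₃. The multiplicities in the induced representation are found with Young symmetrizers.
For each diagram an explicit evaluation produces as many independent vectors in the image of the
symmetrizer as the claimed multiplicity; these generate independent copies of the irreducible
representation (`sumOrbit_injective`), and the bound 15 · (3d₁ + 2d₂ + d₄) for the dimension leaves
room for nothing else (`IsCuspAction.ind_equiv_isotypicSum`). -/

theorem sum_sq_range_lt {A : Finset ℕ} (h : A ≠ Finset.range A.card) :
    ∑ t ∈ Finset.range A.card, t ^ 2 < ∑ t ∈ A, t ^ 2 := by
  set R := Finset.range A.card with hR
  have hc : (A \ R).card = (R \ A).card := by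
    have h1 := Finset.card_sdiff_add_card_inter A R
    have h2 := Finset.card_sdiff_add_card_inter R A
    rw [Finset.inter_comm] at h2
    have : R.card = A.card := by simp [hR]
    omega
  have hne : (A \ R).Nonempty := by
    rw [Finset.nonempty_iff_ne_empty]
    intro h0
    have hsub : A ⊆ R := by rwa [Finset.sdiff_eq_empty_iff_subset] at h0
    exact h (Finset.eq_of_subset_of_card_le hsub (by simp [hR]))
  rw [← Finset.sum_inter_add_sum_sdiff R A, ← Finset.sum_inter_add_sum_sdiff A R,
    Finset.inter_comm R A]
  refine Nat.add_lt_add_left ?_ _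
  have hne' : (R \ A).Nonempty := by
    rw [← Finset.card_pos, ← hc, Finset.card_pos]; exact hne
  -- The two differences have the same size, the elements of `R \ A` lie below `A.card`, and those
  -- of `A \ R` do not.
  calc ∑ t ∈ R \ A, t ^ 2 < ∑ _t ∈ R \ A, A.card ^ 2 := by
        refine Finset.sum_lt_sum_of_nonempty hne' fun t ht => ?_
        have : t < A.card := by simpa [hR] using (Finset.mem_sdiff.mp ht).1
        exact Nat.pow_lt_pow_left this (by norm_num)
    _ = ∑ _t ∈ A \ R, A.card ^ 2 := by simp [hc]
    _ ≤ ∑ t ∈ A \ R, t ^ 2 := by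
        refine Finset.sum_le_sum fun t ht => ?_
        have : A.card ≤ t := by simpa [hR] using (Finset.mem_sdiff.mp ht).2
        exact Nat.pow_le_pow_left this 2

theorem sum_sq_range_le (A : Finset ℕ) :
    ∑ t ∈ Finset.range A.card, t ^ 2 ≤ ∑ t ∈ A, t ^ 2 := by
  by_cases h : A = Finset.range A.card
  · rw [← h]
  · exact (sum_sq_range_lt h).le

/-- `row` and `col` are the row and column coordinates of a numbering of the boxes of a
Young diagram with left-justified rows. -/
structure IsTableau {n : ℕ} (row col : Fin n → ℕ) : Prop where
  inj : ∀ i j, row i = row j → col i = col j → i = j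
  left : ∀ i, ∀ t < col i, ∃ j, row j = row i ∧ col j = t

/-! ### Extremal property of tableaux and von Neumann's lemma -/

section Tableau

variable {n : ℕ} {row col : Fin n → ℕ}

/-- Rows are left-justified, so the columns met in a row form a downward closed set, hence an
initial segment. -/
theorem IsTableau.image_col (h : IsTableau row col) (s : ℕ) :
    (Finset.univ.filter fun i => row i = s).image col
      = Finset.range (Finset.univ.filter fun i => row i = s).card := by
  set A := (Finset.univ.filter fun i => row i = s).image col with hA
  have hcard : A.card = (Finset.univ.filter fun i => row i = s).card := by
    refine Finset.card_image_of_injOn fun i hi j hj hij => ?_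
    simp only [Finset.coe_filter, Finset.mem_univ, true_and, Set.mem_ofPred_eq] at hi hj
    exact h.inj i j (hi.trans hj.symm) hij
  have hdown : ∀ x ∈ A, ∀ t < x, t ∈ A := by
    intro x hx t ht
    obtain ⟨i, hi, rfl⟩ := Finset.mem_image.mp hx
    obtain ⟨j, hj, hjt⟩ := h.left i t ht
    refine Finset.mem_image.mpr ⟨j, ?_, hjt⟩
    simp only [Finset.mem_filter, Finset.mem_univ, true_and] at hi ⊢
    rw [hj, hi]
  rw [← hcard]
  have hsub : A ⊆ Finset.range A.card := by
    intro x hx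
    have h1 : Finset.range (x + 1) ⊆ A := by
      intro t ht
      rcases Nat.lt_or_ge t x with h2 | h2
      · exact hdown x hx t h2
      · have : t = x := by have := Finset.mem_range.mp ht; omega
        rwa [this]
    have := Finset.card_le_card h1
    rw [Finset.card_range] at this
    exact Finset.mem_range.mpr (by omega)
  exact Finset.eq_of_subset_of_card_le hsub (by simp)

theorem sum_fiberwise_sq (f c : Fin n → ℕ) (hinj : ∀ i j, f i = f j → c i = c j → i = j) :
    ∑ i, c i ^ 2 = ∑ s ∈ Finset.univ.image f,
      ∑ t ∈ (Finset.univ.filter fun i => f i = s).image c, t ^ 2 := by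
  rw [← Finset.sum_fiberwise_of_maps_to (g := f) (t := Finset.univ.image f)
    (fun i _ => Finset.mem_image_of_mem f (Finset.mem_univ i))]
  refine Finset.sum_congr rfl fun s _ => ?_
  rw [Finset.sum_image]
  intro i hi j hj hij
  simp only [Finset.coe_filter, Finset.mem_univ, true_and, Set.mem_ofPred_eq] at hi hj
  exact hinj i j (hi.trans hj.symm) hij

theorem card_filter_comp (row : Fin n → ℕ) (g : Equiv.Perm (Fin n)) (s : ℕ) :
    (Finset.univ.filter fun i => row (g i) = s).card
      = (Finset.univ.filter fun i => row i = s).card := by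
  refine Finset.card_bij (fun i _ => g i) ?_ ?_ ?_
  · intro i hi; simpa using hi
  · intro i _ j _ h; exact g.injective h
  · intro j hj
    exact ⟨g.symm j, by simpa using hj, by simp⟩

theorem image_comp_perm (row : Fin n → ℕ) (g : Equiv.Perm (Fin n)) :
    Finset.univ.image (fun i => row (g i)) = Finset.univ.image row := by
  ext s
  simp only [Finset.mem_image, Finset.mem_univ, true_and]
  exact ⟨fun ⟨i, hi⟩ => ⟨g i, hi⟩, fun ⟨i, hi⟩ => ⟨g.symm i, by simpa using hi⟩⟩

/-- Among sets of natural numbers of a given size the initial segment has the least sum of squares,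
and the rows of a tableau are filled by initial segments. The sum of the squares of the columns
takes the place of the dominance order: it is a cruder invariant, but it separates the diagrams that
are needed. -/
theorem IsTableau.sum_le (h : IsTableau row col) (g : Equiv.Perm (Fin n)) (c : Fin n → ℕ)
    (hinj : ∀ i j, row (g i) = row (g j) → c i = c j → i = j) :
    ∑ i, col i ^ 2 ≤ ∑ i, c i ^ 2 := by
  rw [sum_fiberwise_sq row col h.inj, sum_fiberwise_sq _ c hinj, image_comp_perm]
  refine Finset.sum_le_sum fun s _ => ?_
  rw [h.image_col s, ← card_filter_comp row g s]
  have hcard : ((Finset.univ.filter fun i => row (g i) = s).image c).card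
      = (Finset.univ.filter fun i => row (g i) = s).card := by
    refine Finset.card_image_of_injOn fun i hi j hj hij => ?_
    simp only [Finset.coe_filter, Finset.mem_univ, true_and, Set.mem_ofPred_eq] at hi hj
    exact hinj i j (hi.trans hj.symm) hij
  rw [← hcard]
  exact sum_sq_range_le _

/-- The equality case of the minimum: the columns found in each fibre of `row ∘ g` must already be
an initial segment, so the boxes can be matched. The resulting `q` preserves columns and `g * q⁻¹`
preserves rows, which is von Neumann's factorisation. -/
theorem IsTableau.exists_perm (h : IsTableau row col) (g : Equiv.Perm (Fin n))
    (hinj : ∀ i j, row (g i) = row (g j) → col i = col j → i = j) :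
    ∃ q : Equiv.Perm (Fin n), ∀ i, row (q i) = row (g i) ∧ col (q i) = col i := by
  have hcard : ∀ s, ((Finset.univ.filter fun i => row (g i) = s).image col).card
      = (Finset.univ.filter fun i => row i = s).card := by
    intro s
    rw [← card_filter_comp row g s]
    refine Finset.card_image_of_injOn fun i hi j hj hij => ?_
    simp only [Finset.coe_filter, Finset.mem_univ, true_and, Set.mem_ofPred_eq] at hi hj
    exact hinj i j (hi.trans hj.symm) hij
  have key : ∀ s, (Finset.univ.filter fun i => row (g i) = s).image col
      = (Finset.univ.filter fun i => row i = s).image col := by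
    by_contra hcon
    push Not at hcon
    obtain ⟨s, hs⟩ := hcon
    -- A single row whose columns are not the initial segment would make the total strictly larger
    -- than itself.
    have hlt : ∑ i, col i ^ 2 < ∑ i, col i ^ 2 := by
      conv_lhs => rw [sum_fiberwise_sq row col h.inj]
      conv_rhs => rw [sum_fiberwise_sq _ col hinj, image_comp_perm]
      refine Finset.sum_lt_sum (fun s _ => ?_) ⟨s, ?_, ?_⟩
      · rw [h.image_col s, ← hcard]
        exact sum_sq_range_le _
      · by_contra hns
        apply hs
        have e1 : (Finset.univ.filter fun i => row i = s) = ∅ := by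
          ext i
          simp only [Finset.mem_filter, Finset.mem_univ, true_and, Finset.notMem_empty, iff_false]
          rintro rfl
          exact hns (Finset.mem_image_of_mem _ (Finset.mem_univ _))
        have e2 := hcard s
        rw [e1, Finset.card_empty, Finset.card_eq_zero] at e2
        rw [e2, e1, Finset.image_empty]
      · rw [h.image_col s, ← hcard]
        apply sum_sq_range_lt
        rw [hcard, ← h.image_col s]
        exact hs
    exact lt_irrefl _ hlt
  have hex : ∀ i, ∃ j, row j = row (g i) ∧ col j = col i := by
    intro i
    have : col i ∈ (Finset.univ.filter fun j => row j = row (g i)).image col := by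
      rw [← key]
      exact Finset.mem_image_of_mem _ (by simp)
    simpa using this
  choose q hq using hex
  have hqi : Function.Injective q := by
    intro i j hij
    apply hinj
    · rw [← (hq i).1, ← (hq j).1, hij]
    · rw [← (hq i).2, ← (hq j).2, hij]
  exact ⟨Equiv.ofBijective q (Finite.injective_iff_bijective.mp hqi), hq⟩

open Classical in
/-- The sum of the permutations that preserve the rows. -/
def rowSum (row : Fin n → ℕ) : MonoidAlgebra ℂ (Equiv.Perm (Fin n)) :=
  ∑ g : Equiv.Perm (Fin n),
    if ∀ i, row (g i) = row i then MonoidAlgebra.single g (1 : ℂ) else 0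

open Classical in
/-- The signed sum of the permutations that preserve the columns. -/
def colSum (col : Fin n → ℕ) : MonoidAlgebra ℂ (Equiv.Perm (Fin n)) :=
  ∑ g : Equiv.Perm (Fin n),
    if ∀ i, col (g i) = col i
    then MonoidAlgebra.single g (((Equiv.Perm.sign g : ℤˣ) : ℤ) : ℂ) else 0

theorem rowSum_mul_single (row : Fin n → ℕ) (t : Equiv.Perm (Fin n))
    (ht : ∀ i, row (t i) = row i) :
    rowSum row * MonoidAlgebra.single t 1 = rowSum row := by
  classical
  rw [rowSum, Finset.sum_mul]
  refine Fintype.sum_equiv (Equiv.mulRight t) _ _ fun g => ?_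
  have : (∀ i, row ((g * t) i) = row i) ↔ ∀ i, row (g i) = row i := by
    constructor
    · intro h i
      have := h (t.symm i)
      have h2 := ht (t.symm i)
      simp only [Equiv.Perm.mul_apply, Equiv.apply_symm_apply] at this h2
      rw [this, h2]
    · intro h i
      rw [Equiv.Perm.mul_apply, h, ht]
  by_cases hg : ∀ i, row (g i) = row i
  · have hg' : ∀ i, row (Equiv.mulRight t g i) = row i := this.mpr hg
    rw [if_pos hg, if_pos hg', MonoidAlgebra.single_mul_single, one_mul]
    rfl
  · have hg' : ¬ ∀ i, row (Equiv.mulRight t g i) = row i := fun h => hg (this.mp h)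
    rw [if_neg hg, if_neg hg', zero_mul]

theorem single_mul_colSum (col : Fin n → ℕ) (t : Equiv.Perm (Fin n))
    (ht : ∀ i, col (t i) = col i) :
    MonoidAlgebra.single t 1 * colSum col
      = (((Equiv.Perm.sign t : ℤˣ) : ℤ) : ℂ) • colSum col := by
  classical
  rw [colSum, Finset.mul_sum, Finset.smul_sum]
  refine Fintype.sum_equiv (Equiv.mulLeft t) _ _ fun g => ?_
  have : (∀ i, col ((t * g) i) = col i) ↔ ∀ i, col (g i) = col i := by
    constructor
    · intro h i
      rw [← h i, Equiv.Perm.mul_apply, ht]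
    · intro h i
      rw [Equiv.Perm.mul_apply, ht, h]
  by_cases hg : ∀ i, col (g i) = col i
  · have hg' : ∀ i, col (Equiv.mulLeft t g i) = col i := this.mpr hg
    rw [if_pos hg, if_pos hg', MonoidAlgebra.single_mul_single, one_mul,
      MonoidAlgebra.smul_single, Equiv.coe_mulLeft, Equiv.Perm.sign_mul]
    congr 1
    rcases Int.units_eq_one_or (Equiv.Perm.sign t) with h | h <;> simp [h]
  · have hg' : ¬ ∀ i, col (Equiv.mulLeft t g i) = col i := fun h => hg (this.mp h)
    rw [if_neg hg, if_neg hg', mul_zero, smul_zero]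

/-- The transposition of `i` and `j` preserves columns, and its conjugate by `g` preserves rows.
Inserting it therefore leaves the product unchanged from one side and changes its sign from the
other. -/
theorem rowSum_single_colSum_eq_zero (row col : Fin n → ℕ) (g : Equiv.Perm (Fin n))
    {i j : Fin n} (hij : i ≠ j) (hr : row (g i) = row (g j)) (hc : col i = col j) :
    rowSum row * MonoidAlgebra.single g 1 * colSum col = 0 := by
  have ht : ∀ x, row (Equiv.swap (g i) (g j) x) = row x := by
    intro x
    by_cases h1 : x = g i
    · rw [h1, Equiv.swap_apply_left, hr]
    · by_cases h2 : x = g j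
      · rw [h2, Equiv.swap_apply_right, hr]
      · rw [Equiv.swap_apply_of_ne_of_ne h1 h2]
  have hs : ∀ x, col (Equiv.swap i j x) = col x := by
    intro x
    by_cases h1 : x = i
    · rw [h1, Equiv.swap_apply_left, hc]
    · by_cases h2 : x = j
      · rw [h2, Equiv.swap_apply_right, hc]
      · rw [Equiv.swap_apply_of_ne_of_ne h1 h2]
  have e : Equiv.swap (g i) (g j) * g = g * Equiv.swap i j := by
    rw [Equiv.mul_swap_eq_swap_mul]
  have h1 : rowSum row * MonoidAlgebra.single g 1 * colSum col
      = - (rowSum row * MonoidAlgebra.single g 1 * colSum col) := by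
    calc rowSum row * MonoidAlgebra.single g 1 * colSum col
        = rowSum row * (MonoidAlgebra.single (Equiv.swap (g i) (g j)) 1
            * MonoidAlgebra.single g 1) * colSum col := by
          rw [← mul_assoc, rowSum_mul_single _ _ ht]
      _ = rowSum row * MonoidAlgebra.single g 1
            * (MonoidAlgebra.single (Equiv.swap i j) 1 * colSum col) := by
          rw [MonoidAlgebra.single_mul_single, e, ← mul_assoc, mul_assoc (rowSum row) _
            (MonoidAlgebra.single (Equiv.swap i j) 1), MonoidAlgebra.single_mul_single]
      _ = _ := by
          rw [single_mul_colSum _ _ hs, Equiv.Perm.sign_swap hij]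
          simp
  have h2 : (2 : ℂ) • (rowSum row * MonoidAlgebra.single g 1 * colSum col) = 0 := by
    rw [two_smul]; nth_rewrite 1 [h1]; simp
  exact (smul_eq_zero.mp h2).resolve_left two_ne_zero

/-- Either `g` factors into a row and a column permutation, which are absorbed up to a sign, or two
entries share a row and a column and the product vanishes. -/
theorem IsTableau.rowSum_single_colSum (h : IsTableau row col) (g : Equiv.Perm (Fin n)) :
    ∃ e : ℂ, rowSum row * MonoidAlgebra.single g 1 * colSum col
      = e • (rowSum row * colSum col) := by
  by_cases hinj : ∀ i j, row (g i) = row (g j) → col i = col j → i = j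
  · obtain ⟨q, hq⟩ := h.exists_perm g hinj
    have hr : ∀ i, row ((g * q⁻¹) i) = row i := by
      intro i
      have := (hq (q⁻¹ i)).1
      rw [Equiv.Perm.mul_apply, ← this, ← Equiv.Perm.mul_apply, mul_inv_cancel,
        Equiv.Perm.one_apply]
    refine ⟨(((Equiv.Perm.sign q : ℤˣ) : ℤ) : ℂ), ?_⟩
    have e : (MonoidAlgebra.single g (1 : ℂ)) = MonoidAlgebra.single (g * q⁻¹) 1
        * MonoidAlgebra.single q 1 := by
      rw [MonoidAlgebra.single_mul_single, inv_mul_cancel_right, one_mul]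
    rw [e, ← mul_assoc, rowSum_mul_single _ _ hr, mul_assoc,
      single_mul_colSum _ _ (fun i => (hq i).2), mul_smul_comm]
  · push Not at hinj
    obtain ⟨i, j, h1, h2, h3⟩ := hinj
    exact ⟨0, by rw [rowSum_single_colSum_eq_zero row col g h3 h1 h2, zero_smul]⟩

theorem IsTableau.rowSum_mul_colSum (h : IsTableau row col)
    (x : MonoidAlgebra ℂ (Equiv.Perm (Fin n))) :
    ∃ e : ℂ, rowSum row * x * colSum col = e • (rowSum row * colSum col) := by
  induction x using MonoidAlgebra.induction_linear with
  | zero => exact ⟨0, by simp⟩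
  | add x y hx hy =>
    obtain ⟨a, ha⟩ := hx
    obtain ⟨b, hb⟩ := hy
    exact ⟨a + b, by rw [mul_add, add_mul, ha, hb, add_smul]⟩
  | single g r =>
    obtain ⟨e, he⟩ := h.rowSum_single_colSum g
    refine ⟨r * e, ?_⟩
    rw [mul_smul, ← he, ← smul_mul_assoc, ← mul_smul_comm, MonoidAlgebra.smul_single, smul_eq_mul,
      mul_one]

/-- A sum of squares below the minimum excludes that any `g` separates the boxes, so each group
element admits a transposition that kills the product. -/
theorem IsTableau.rowSum_mul_colSum_eq_zero (h : IsTableau row col) {col' : Fin n → ℕ}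
    (hlt : ∑ i, col' i ^ 2 < ∑ i, col i ^ 2) (x : MonoidAlgebra ℂ (Equiv.Perm (Fin n))) :
    rowSum row * x * colSum col' = 0 := by
  induction x using MonoidAlgebra.induction_linear with
  | zero => simp
  | add x y hx hy => rw [mul_add, add_mul, hx, hy, add_zero]
  | single g r =>
    by_cases hinj : ∀ i j, row (g i) = row (g j) → col' i = col' j → i = j
    · exact absurd (h.sum_le g col' hinj) (not_le.mpr hlt)
    · push Not at hinj
      obtain ⟨i, j, h1, h2, h3⟩ := hinj
      have e : MonoidAlgebra.single g r = r • MonoidAlgebra.single g (1 : ℂ) := by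
        rw [MonoidAlgebra.smul_single, smul_eq_mul, mul_one]
      rw [e, mul_smul_comm, smul_mul_assoc, rowSum_single_colSum_eq_zero row col' g h3 h1 h2,
        smul_zero]

end Tableau

/-! ### The trace form of a group algebra -/

section TraceForm

variable {G : Type*} [Group G]

theorem coeff_one_mul_comm (x y : MonoidAlgebra ℂ G) :
    (x * y).coeff 1 = (y * x).coeff 1 := by
  induction x using MonoidAlgebra.induction_linear with
  | zero => simp
  | add a b ha hb => simp [add_mul, mul_add, ha, hb]
  | single g r =>
    induction y using MonoidAlgebra.induction_linear with
    | zero => simp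
    | add a b ha hb => simp [add_mul, mul_add, ha, hb]
    | single h s =>
      classical
      rw [MonoidAlgebra.single_mul_single, MonoidAlgebra.single_mul_single,
        MonoidAlgebra.coeff_single, MonoidAlgebra.coeff_single, Finsupp.single_apply,
        Finsupp.single_apply, mul_comm r s]
      have : g * h = 1 ↔ h * g = 1 := mul_eq_one_comm
      by_cases h1 : g * h = 1
      · rw [if_pos h1, if_pos (this.mp h1)]
      · rw [if_neg h1, if_neg (fun h2 => h1 (this.mpr h2))]

/-- Nondegeneracy of the form given by the coefficient of a product at `1`: testing against `g⁻¹`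
reads off the coefficient at `g`. -/
theorem eq_zero_of_coeff_one_mul (x : MonoidAlgebra ℂ G)
    (h : ∀ z : MonoidAlgebra ℂ G, (z * x).coeff 1 = 0) : x = 0 := by
  ext g
  have := h (MonoidAlgebra.single g⁻¹ 1)
  rw [MonoidAlgebra.coeff_single_mul_apply] at this
  simpa using this

/-- The trace form is symmetric and nondegenerate, so one-sided vanishing is symmetric. Two diagrams
thus need to be compared in one order only. -/
theorem mul_mul_eq_zero_comm {c d : MonoidAlgebra ℂ G}
    (h : ∀ x, c * x * d = 0) (x : MonoidAlgebra ℂ G) : d * x * c = 0 := by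
  apply eq_zero_of_coeff_one_mul
  intro z
  have : z * (d * x * c) = (z * d * x) * c := by noncomm_ring
  rw [this, coeff_one_mul_comm]
  have : c * (z * d * x) = (c * z * d) * x := by noncomm_ring
  rw [this, h, zero_mul]
  simp

theorem trace_mulRight [Fintype G] (x : MonoidAlgebra ℂ G) :
    LinearMap.trace ℂ _ (LinearMap.mulRight ℂ x) = Fintype.card G * x.coeff 1 := by
  classical
  let b : Module.Basis G ℂ (MonoidAlgebra ℂ G) := ⟨MonoidAlgebra.coeffLinearEquiv ℂ⟩
  have hb : ∀ g, b g = MonoidAlgebra.single g 1 := fun g => by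
    apply b.repr.injective
    rw [Module.Basis.repr_self]
    rfl
  rw [LinearMap.trace_eq_matrix_trace ℂ b, Matrix.trace]
  have : ∀ g, (LinearMap.toMatrix b b (LinearMap.mulRight ℂ x)).diag g = x.coeff 1 := by
    intro g
    rw [Matrix.diag_apply, LinearMap.toMatrix_apply, hb]
    change (MonoidAlgebra.single g 1 * x).coeff g = _
    rw [MonoidAlgebra.coeff_single_mul_apply]
    simp
  rw [Finset.sum_congr rfl fun g _ => this g]
  simp

/-- Right multiplication by `a⁻¹ • c` is a projection onto this range, so its rank is its trace, and
the trace only sees the coefficient at `1`. For Young symmetrizers this gives the dimension as the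
group order divided by the factor `a`. -/
theorem finrank_range_mulRight [Fintype G] {c : MonoidAlgebra ℂ G} {a : ℂ} (ha : a ≠ 0)
    (hc : c * c = a • c) :
    (Module.finrank ℂ (LinearMap.range (LinearMap.mulRight ℂ c)) : ℂ) * a
      = Fintype.card G * c.coeff 1 := by
  have hproj : LinearMap.IsProj (LinearMap.range (LinearMap.mulRight ℂ c))
      (LinearMap.mulRight ℂ (a⁻¹ • c)) := by
    refine ⟨fun x => ⟨a⁻¹ • x, by simp⟩, ?_⟩
    rintro _ ⟨x, rfl⟩
    simp only [LinearMap.mulRight_apply, mul_smul_comm, mul_assoc, hc]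
    rw [smul_smul, inv_mul_cancel₀ ha, one_smul]
  have := hproj.trace
  rw [trace_mulRight] at this
  rw [← this, MonoidAlgebra.coeff_smul]
  simp only [Finsupp.coe_smul, Pi.smul_apply, smul_eq_mul]
  field_simp

end TraceForm

end

end LevelTwo

namespace LevelTwo

noncomputable section

/-! ### Decompositions from highest weight vectors -/

section Decomposition

variable {n : ℕ}

/-- The row of the `i`-th box of the diagram of `p`. -/
def rowOf (p : n.Partition) (i : Fin n) : ℕ := boxRow (rowLengths p) i

/-- The column of the `i`-th box of the diagram of `p`. -/
def colOf (p : n.Partition) (i : Fin n) : ℕ := boxCol (rowLengths p) i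

theorem youngSymmetrizer_eq (p : n.Partition) :
    youngSymmetrizer p = rowSum (rowOf p) * colSum (colOf p) := rfl

theorem youngSymmetrizer_mul_self {p : n.Partition} (h : IsTableau (rowOf p) (colOf p))
    (x : MonoidAlgebra ℂ (Equiv.Perm (Fin n))) :
    ∃ e : ℂ, youngSymmetrizer p * x * youngSymmetrizer p = e • youngSymmetrizer p := by
  obtain ⟨e, he⟩ := h.rowSum_mul_colSum (colSum (colOf p) * x * rowSum (rowOf p))
  refine ⟨e, ?_⟩
  rw [youngSymmetrizer_eq, ← he]
  noncomm_ring

theorem youngSymmetrizer_mul_of_lt {p q : n.Partition} (h : IsTableau (rowOf p) (colOf p))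
    (hlt : ∑ i, colOf q i ^ 2 < ∑ i, colOf p i ^ 2)
    (x : MonoidAlgebra ℂ (Equiv.Perm (Fin n))) :
    youngSymmetrizer p * x * youngSymmetrizer q = 0 := by
  have he := h.rowSum_mul_colSum_eq_zero hlt (colSum (colOf p) * x * rowSum (rowOf q))
  rw [youngSymmetrizer_eq, youngSymmetrizer_eq, ← he]
  noncomm_ring

theorem youngSymmetrizer_mul_eq_zero {p q : n.Partition} (hp : IsTableau (rowOf p) (colOf p))
    (hq : IsTableau (rowOf q) (colOf q)) (hne : ∑ i, colOf p i ^ 2 ≠ ∑ i, colOf q i ^ 2)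
    (x : MonoidAlgebra ℂ (Equiv.Perm (Fin n))) :
    youngSymmetrizer p * x * youngSymmetrizer q = 0 := by
  rcases lt_or_gt_of_ne hne with h | h
  · exact mul_mul_eq_zero_comm (youngSymmetrizer_mul_of_lt hq h) x
  · exact youngSymmetrizer_mul_of_lt hp h x

theorem leftRegular_apply (g : Equiv.Perm (Fin n)) (y : MonoidAlgebra ℂ (Equiv.Perm (Fin n))) :
    Representation.leftRegular ℂ (Equiv.Perm (Fin n)) g y = MonoidAlgebra.single g 1 * y := by
  have : (Representation.leftRegular ℂ (Equiv.Perm (Fin n)) g)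
      = LinearMap.mulLeft ℂ (MonoidAlgebra.single g 1) := by
    ext; simp [Representation.ofMulAction_single]
  rw [this]; rfl

variable {V : Type*} [AddCommGroup V] [Module ℂ V]

/-- The orbit map `y ↦ y v` on the left ideal of `p`. -/
def irrepOrbit (ρ : Representation ℂ (Equiv.Perm (Fin n)) V) (p : n.Partition) (v : V) :
    (irrepSub p).toSubmodule →ₗ[ℂ] V :=
  ((LinearMap.applyₗ v).comp ρ.asAlgebraHom.toLinearMap).comp (irrepSub p).toSubmodule.subtype

theorem irrepOrbit_apply (ρ : Representation ℂ (Equiv.Perm (Fin n)) V) (p : n.Partition) (v : V)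
    (y : (irrepSub p).toSubmodule) : irrepOrbit ρ p v y = ρ.asAlgebraHom y.1 v := rfl

theorem irrepOrbit_irrep (ρ : Representation ℂ (Equiv.Perm (Fin n)) V) (p : n.Partition) (v : V)
    (g : Equiv.Perm (Fin n)) (y : (irrepSub p).toSubmodule) :
    irrepOrbit ρ p v (irrep p g y) = ρ g (irrepOrbit ρ p v y) := by
  rw [irrepOrbit_apply, irrepOrbit_apply]
  have : (irrep p g y).1 = MonoidAlgebra.single g 1 * y.1 := leftRegular_apply g y.1
  rw [this, map_mul, Representation.asAlgebraHom_single_one]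
  rfl

/-- The map from a direct sum of irreducible representations given by a family of vectors. -/
def sumOrbit (ρ : Representation ℂ (Equiv.Perm (Fin n)) V) (m : n.Partition → ℕ)
    (u : ∀ p, Fin (m p) → V) :
    DirectSum (Σ p : n.Partition, Fin (m p)) (fun i => (irrepSub i.1).toSubmodule) →ₗ[ℂ] V where
  toFun x := ∑ i : Σ p : n.Partition, Fin (m p), irrepOrbit ρ i.1 (u i.1 i.2) (x i)
  map_add' x y := by simp only [DirectSum.add_apply, map_add, Finset.sum_add_distrib]
  map_smul' c x := by
    simp only [DirectSum.smul_apply, map_smul, Finset.smul_sum, RingHom.id_apply]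

theorem sumOrbit_apply (ρ : Representation ℂ (Equiv.Perm (Fin n)) V) (m : n.Partition → ℕ)
    (u : ∀ p, Fin (m p) → V)
    (x : DirectSum (Σ p : n.Partition, Fin (m p)) (fun i => (irrepSub i.1).toSubmodule)) :
    sumOrbit ρ m u x = ∑ i : Σ p : n.Partition, Fin (m p), ρ.asAlgebraHom (x i).1 (u i.1 i.2) := by
  rfl

theorem sumOrbit_isotypicSum (ρ : Representation ℂ (Equiv.Perm (Fin n)) V)
    (m : n.Partition → ℕ) (u : ∀ p, Fin (m p) → V) (g : Equiv.Perm (Fin n))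
    (x : DirectSum (Σ p : n.Partition, Fin (m p)) (fun i => (irrepSub i.1).toSubmodule)) :
    sumOrbit ρ m u (isotypicSum m g x) = ρ g (sumOrbit ρ m u x) := by
  rw [sumOrbit_apply, sumOrbit_apply, map_sum]
  refine Finset.sum_congr rfl fun i _ => ?_
  have : (isotypicSum m g x) i = irrep i.1 g (x i) := by
    simp [isotypicSum, Representation.directSum, DirectSum.lmap_apply]
  rw [this]
  exact irrepOrbit_irrep ρ i.1 _ g (x i)

/-- Vectors in the image of a symmetrizer play the role of highest weight vectors. Multiplying a
relation by `c_p z` removes every other diagram and turns each component of type `p` into a multiple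
of `c_p`. Since `c_p` scales the chosen vectors by `a p ≠ 0`, their independence forces the
multiples to vanish. -/
theorem sumOrbit_injective (ρ : Representation ℂ (Equiv.Perm (Fin n)) V)
    (m : n.Partition → ℕ) (a : n.Partition → ℂ)
    (h1 : ∀ p, m p ≠ 0 → IsTableau (rowOf p) (colOf p))
    (h2 : ∀ p q, m p ≠ 0 → m q ≠ 0 → p ≠ q → ∑ i, colOf p i ^ 2 ≠ ∑ i, colOf q i ^ 2)
    (h3 : ∀ p, m p ≠ 0 → a p ≠ 0 ∧
      youngSymmetrizer p * youngSymmetrizer p = a p • youngSymmetrizer p)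
    (u : ∀ p, Fin (m p) → V) (hu : ∀ p, LinearIndependent ℂ (u p))
    (hc : ∀ p i, ∃ v, u p i = ρ.asAlgebraHom (youngSymmetrizer p) v) :
    Function.Injective (sumOrbit ρ m u) := by
  rw [injective_iff_map_eq_zero]
  intro x hx
  rw [sumOrbit_apply] at hx
  have hm : ∀ p, Fin (m p) → m p ≠ 0 := fun p i => (Fin.pos i).ne'
  have hfix : ∀ p i, ρ.asAlgebraHom (youngSymmetrizer p) (u p i) = a p • u p i := by
    intro p i
    obtain ⟨v, hv⟩ := hc p i
    rw [hv, ← Module.End.mul_apply, ← map_mul, (h3 p (hm p i)).2, map_smul]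
    rfl
  ext ⟨p, i⟩ : 2
  change (x ⟨p, i⟩).1 = 0
  have hp := hm p i
  have key : ∀ z, youngSymmetrizer p * z * (x ⟨p, i⟩).1 = 0 := by
    intro z
    choose y hy using fun j : Fin (m p) => (x ⟨p, j⟩).2
    choose e he using fun j : Fin (m p) => youngSymmetrizer_mul_self (h1 p hp) (z * y j)
    have hyj : ∀ j, youngSymmetrizer p * z * (x ⟨p, j⟩).1 = e j • youngSymmetrizer p := by
      intro j
      rw [← he j, ← hy j, LinearMap.mulRight_apply]
      noncomm_ring
    have h0 := congrArg (ρ.asAlgebraHom (youngSymmetrizer p * z)) hx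
    rw [map_sum, map_zero, Fintype.sum_sigma, Finset.sum_eq_single p] at h0
    · have h0' : ∑ j, (e j * a p) • u p j = 0 := by
        rw [← h0]
        refine Finset.sum_congr rfl fun j _ => ?_
        rw [← Module.End.mul_apply, ← map_mul, hyj, map_smul, LinearMap.smul_apply, hfix, smul_smul]
      have := Fintype.linearIndependent_iff.mp (hu p) _ h0' i
      have hei : e i = 0 := (mul_eq_zero.mp this).resolve_right (h3 p hp).1
      rw [hyj, hei, zero_smul]
    · intro q _ hqp
      refine Finset.sum_eq_zero fun j _ => ?_
      obtain ⟨w, hw⟩ := (x ⟨q, j⟩).2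
      rw [← Module.End.mul_apply, ← map_mul]
      have : youngSymmetrizer p * z * (x ⟨q, j⟩).1 = 0 := by
        rw [← hw, LinearMap.mulRight_apply]
        have := youngSymmetrizer_mul_eq_zero (h1 p hp) (h1 q (hm q j))
          (h2 p q hp (hm q j) (Ne.symm hqp)) (z * w)
        rw [← this]
        noncomm_ring
      rw [this, map_zero, LinearMap.zero_apply]
    · intro h; exact absurd (Finset.mem_univ p) h
  -- Having `c_p z x = 0` for all `z` is not yet `x = 0`. But `x` lies in the left ideal of `c_p`,
  -- so `x c_p` is a nonzero multiple of `x`, and the symmetry of the trace form moves `c_p` to the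
  -- other side.
  apply eq_zero_of_coeff_one_mul
  intro z
  obtain ⟨y, hy⟩ := (x ⟨p, i⟩).2
  have hxc : (x ⟨p, i⟩).1 * youngSymmetrizer p = a p • (x ⟨p, i⟩).1 := by
    rw [← hy, LinearMap.mulRight_apply, mul_assoc, (h3 p hp).2, mul_smul_comm]
  have : a p * (z * (x ⟨p, i⟩).1).coeff 1 = 0 := by
    have e1 : a p • (z * (x ⟨p, i⟩).1) = (z * (x ⟨p, i⟩).1) * youngSymmetrizer p := by
      rw [mul_assoc, hxc, mul_smul_comm]
    have e2 := congrArg (fun w => w.coeff 1) e1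
    simp only [coeff_one_mul_comm _ (youngSymmetrizer p), ← mul_assoc, key] at e2
    simpa using e2
  exact (mul_eq_zero.mp this).resolve_left (h3 p hp).1

theorem finrank_sum_irrep (m : n.Partition → ℕ) :
    Module.finrank ℂ
      (DirectSum (Σ p : n.Partition, Fin (m p)) (fun i => (irrepSub i.1).toSubmodule))
      = ∑ p, m p * Module.finrank ℂ (irrepSub p).toSubmodule := by
  rw [Module.finrank_directSum, Fintype.sum_sigma]
  refine Finset.sum_congr rfl fun p _ => ?_
  change ∑ _j : Fin (m p), Module.finrank ℂ (irrepSub p).toSubmodule = _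
  rw [Finset.sum_const, Finset.card_univ, Fintype.card_fin, smul_eq_mul]

theorem surjective_of_finrank_le {U : Type*} [AddCommMonoid U] [Module ℂ U]
    [FiniteDimensional ℂ V] (f : U →ₗ[ℂ] V) (hf : Function.Injective f)
    (h : Module.finrank ℂ V ≤ Module.finrank ℂ U) : Function.Surjective f := by
  have heq := le_antisymm (LinearMap.finrank_le_finrank_of_injective hf) h
  exact LinearMap.range_eq_top.mp
    (Submodule.eq_top_of_finrank_eq ((LinearMap.finrank_range_of_inj hf).trans heq))

theorem nonempty_equiv_of_bijective {G U : Type*} [Monoid G] [AddCommMonoid U] [Module ℂ U]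
    {ρ : Representation ℂ G V} {σ : Representation ℂ G U} (f : U →ₗ[ℂ] V)
    (hf : Function.Bijective f) (h : ∀ g x, f (σ g x) = ρ g (f x)) : Nonempty (ρ.Equiv σ) :=
  ⟨(Representation.Equiv.mk (LinearEquiv.ofBijective f hf)
    fun g => LinearMap.ext fun x => h g x).symm⟩

theorem sumOrbit_bijective [FiniteDimensional ℂ V]
    (ρ : Representation ℂ (Equiv.Perm (Fin n)) V)
    (m : n.Partition → ℕ) (u : ∀ p, Fin (m p) → V)
    (hinj : Function.Injective (sumOrbit ρ m u))
    (hdim : Module.finrank ℂ V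
      ≤ ∑ p, m p * Module.finrank ℂ (irrepSub p).toSubmodule) :
    Function.Bijective (sumOrbit ρ m u) :=
  ⟨hinj, surjective_of_finrank_le _ hinj (hdim.trans_eq (finrank_sum_irrep m).symm)⟩

theorem nonempty_equiv_isotypicSum (ρ : Representation ℂ (Equiv.Perm (Fin n)) V)
    (m : n.Partition → ℕ) (u : ∀ p, Fin (m p) → V)
    (h : Function.Bijective (sumOrbit ρ m u)) : Nonempty (ρ.Equiv (isotypicSum m)) :=
  nonempty_equiv_of_bijective (sumOrbit ρ m u) h (sumOrbit_isotypicSum ρ m u)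

/-- Lower bounds for the multiplicities together with an upper bound for the dimension suffice: the
injection of the direct sum is then bijective. No complete reducibility and no irreducibility of the
left ideals is invoked. -/
theorem equiv_isotypicSum [FiniteDimensional ℂ V]
    (ρ : Representation ℂ (Equiv.Perm (Fin n)) V)
    (m : n.Partition → ℕ) (a : n.Partition → ℂ)
    (h1 : ∀ p, m p ≠ 0 → IsTableau (rowOf p) (colOf p))
    (h2 : ∀ p q, m p ≠ 0 → m q ≠ 0 → p ≠ q → ∑ i, colOf p i ^ 2 ≠ ∑ i, colOf q i ^ 2)
    (h3 : ∀ p, m p ≠ 0 → a p ≠ 0 ∧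
      youngSymmetrizer p * youngSymmetrizer p = a p • youngSymmetrizer p)
    (u : ∀ p, Fin (m p) → V) (hu : ∀ p, LinearIndependent ℂ (u p))
    (hc : ∀ p i, ∃ v, u p i = ρ.asAlgebraHom (youngSymmetrizer p) v)
    (hdim : Module.finrank ℂ V
      ≤ ∑ p, m p * Module.finrank ℂ (irrepSub p).toSubmodule) :
    Nonempty (ρ.Equiv (isotypicSum m)) := by
  exact nonempty_equiv_isotypicSum ρ m u
    (sumOrbit_bijective ρ m u (sumOrbit_injective ρ m a h1 h2 h3 u hu hc) hdim)

/-- A representation that is trivial on the kernel of a surjection comes from the quotient. -/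
theorem exists_comp_eq {G Q : Type*} [Group G] [Group Q] (φ : G →* Q)
    (hφ : Function.Surjective φ) (ρ : Representation ℂ G V) (h : ∀ g ∈ φ.ker, ρ g = 1) :
    ∃ σ : Representation ℂ Q V, ∀ g, σ (φ g) = ρ g := by
  have key : ∀ a b, φ a = φ b → ρ a = ρ b := by
    intro a b hab
    have h1 := h (b⁻¹ * a) (by rw [MonoidHom.mem_ker, map_mul, map_inv, hab, inv_mul_cancel])
    have : a = b * (b⁻¹ * a) := by group
    rw [this, map_mul, h1, mul_one]
  refine ⟨⟨⟨fun q => ρ (Function.surjInv hφ q), ?_⟩, fun q r => ?_⟩, fun g => ?_⟩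
  · rw [key _ 1 (by rw [Function.surjInv_eq hφ, map_one]), map_one]
  · change ρ _ = ρ _ * ρ _
    rw [← map_mul]
    exact key _ _ (by rw [map_mul, Function.surjInv_eq hφ, Function.surjInv_eq hφ, Function.surjInv_eq hφ])
  · exact key _ _ (Function.surjInv_eq hφ _)

end Decomposition

end

end LevelTwo

namespace LevelTwo

noncomputable section

/-! ### Coefficients of Young symmetrizers -/

section Coefficient

/-- The product over `y ∈ l` of the sign of `y - x`, and `0` if `x ∈ l`. -/
def pairSign (x : ℕ) : List ℕ → ℤ
  | [] => 1
  | y :: l => bif Nat.beq x y then 0 else bif Nat.ble x y then pairSign x l else -pairSign x l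

/-- The sign of the permutation that sorts a list of numbers, and `0` if there is a repetition. -/
def listSign : List ℕ → ℤ
  | [] => 1
  | x :: l => bif pairSign x l == 0 then 0 else pairSign x l * listSign l

/-- The coefficient of `g` in the Young symmetrizer of a tableau. -/
def youngCoeff {n : ℕ} (row col : Fin n → ℕ) (g : Fin n → Fin n) : ℤ :=
  listSign (List.ofFn fun i => 8 * row (g i) + col i)

theorem pairSign_cons (x y : ℕ) (l : List ℕ) : pairSign x (y :: l)
    = if x = y then 0 else if x ≤ y then pairSign x l else -pairSign x l := by
  have h1 : Nat.beq x y = decide (x = y) := by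
    rw [Bool.eq_iff_iff, Nat.beq_eq, decide_eq_true_iff]
  have h2 : Nat.ble x y = decide (x ≤ y) := by
    rw [Bool.eq_iff_iff, Nat.ble_eq, decide_eq_true_iff]
  rw [pairSign, h1, h2, Bool.cond_decide, Bool.cond_decide]

theorem pairSign_eq_zero {x : ℕ} {l : List ℕ} (h : x ∈ l) : pairSign x l = 0 := by
  induction l with
  | nil => simp at h
  | cons y l ih =>
    rw [pairSign_cons]
    rcases eq_or_ne x y with rfl | hxy
    · simp
    · rw [ih ((List.mem_cons.mp h).resolve_left hxy)]
      simp

theorem listSign_cons (x : ℕ) (l : List ℕ) : listSign (x :: l) = pairSign x l * listSign l := by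
  rw [listSign]
  by_cases h : pairSign x l = 0
  · rw [h, zero_mul]; rfl
  · rw [beq_false_of_ne h, cond_false]

theorem listSign_eq_zero {l : List ℕ} (h : ¬ l.Nodup) : listSign l = 0 := by
  induction l with
  | nil => simp at h
  | cons x l ih =>
    rw [listSign_cons]
    by_cases hx : x ∈ l
    · rw [pairSign_eq_zero hx, zero_mul]
    · rw [ih (fun h' => h (List.nodup_cons.mpr ⟨hx, h'⟩)), mul_zero]

theorem pairSign_ofFn (x : ℕ) {n : ℕ} (f : Fin n → ℕ) (h : ∀ i, x ≠ f i) :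
    pairSign x (List.ofFn f) = ∏ i, if x < f i then 1 else -1 := by
  induction n with
  | zero => simp [pairSign]
  | succ n ih =>
    rw [List.ofFn_succ, Fin.prod_univ_succ, pairSign_cons, ih _ fun i => h _]
    have h0 := h 0
    by_cases hlt : x < f 0
    · simp [hlt, hlt.le, h0]
    · have hle : ¬ x ≤ f 0 := fun h' => hlt (lt_of_le_of_ne h' h0)
      simp [hlt, hle, h0]

theorem listSign_ofFn {n : ℕ} (f : Fin n → ℕ) (h : Function.Injective f) :
    listSign (List.ofFn f) = ∏ i, ∏ j ∈ Finset.Ioi i, if f i < f j then 1 else -1 := by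
  induction n with
  | zero => simp [listSign]
  | succ n ih =>
    rw [List.ofFn_succ, Fin.prod_univ_succ, listSign_cons,
      ih (fun i => f i.succ) fun i j hij => Fin.succ_injective _ (h hij),
      pairSign_ofFn _ _ fun i => h.ne (Fin.succ_ne_zero i).symm, Fin.prod_Ioi_zero]
    simp_rw [Fin.prod_Ioi_succ]

/-- The code 8 * row + col increases along the boxes in reading order, so the code of the box `t i`
compares with the others exactly as `t i` does, and the sorting sign counts the inversions of `t`.
-/
theorem youngCoeff_eq_sign {n : ℕ} {row col : Fin n → ℕ}
    (hm : StrictMono fun i => 8 * row i + col i) (g : Fin n → Fin n) (t : Equiv.Perm (Fin n))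
    (ht : ∀ i, row (t i) = row (g i) ∧ col (t i) = col i) :
    youngCoeff row col g = ((Equiv.Perm.sign t : ℤˣ) : ℤ) := by
  have hf : (fun i => 8 * row (g i) + col i) = fun i => 8 * row (t i) + col (t i) := by
    funext i; rw [(ht i).1, (ht i).2]
  have hlt : ∀ i j, 8 * row (t i) + col (t i) < 8 * row (t j) + col (t j) ↔ t i < t j :=
    fun i j => hm.lt_iff_lt
  rw [youngCoeff, hf, listSign_ofFn (fun i => 8 * row (t i) + col (t i))
      (hm.injective.comp t.injective),
    Equiv.Perm.sign_eq_prod_prod_Ioi, Units.coe_prod]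
  refine Finset.prod_congr rfl fun i _ => ?_
  rw [Units.coe_prod]
  refine Finset.prod_congr rfl fun j _ => ?_
  by_cases h : t i < t j
  · rw [if_pos ((hlt i j).mpr h), if_pos h]; rfl
  · rw [if_neg (fun h' => h ((hlt i j).mp h')), if_neg h]; rfl

theorem youngCoeff_eq_zero {n : ℕ} {row col : Fin n → ℕ} (g : Fin n → Fin n) {i j : Fin n}
    (hij : i ≠ j) (h1 : row (g i) = row (g j)) (h2 : col i = col j) : youngCoeff row col g = 0 := by
  refine listSign_eq_zero fun h => hij ?_
  rw [List.nodup_ofFn] at h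
  apply h
  change 8 * row (g i) + col i = 8 * row (g j) + col j
  rw [h1, h2]

theorem rowSum_coeff {n : ℕ} (row : Fin n → ℕ) (g : Equiv.Perm (Fin n)) :
    (rowSum row).coeff g = if ∀ i, row (g i) = row i then 1 else 0 := by
  classical
  rw [rowSum, MonoidAlgebra.coeff_sum, Finsupp.finsetSum_apply, Finset.sum_eq_single g]
  · split_ifs with h <;> simp
  · intro h _ hne
    split_ifs <;> simp [hne]
  · simp

/-- At most one column permutation `t` makes `g t⁻¹` a row permutation, because it must send `i` to
the box in the row of `g i` and the column of `i`. The coefficient is the sign of `t`, or zero if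
two boxes collide. This closed formula replaces the double sum over the group and makes the later
finite checks feasible. -/
theorem rowSum_mul_colSum_coeff {n : ℕ} {row col : Fin n → ℕ} (h : IsTableau row col)
    (hm : StrictMono fun i => 8 * row i + col i) (g : Equiv.Perm (Fin n)) :
    (rowSum row * colSum col).coeff g = (youngCoeff row col g : ℂ) := by
  classical
  have hsum : (rowSum row * colSum col).coeff g = ∑ t : Equiv.Perm (Fin n),
      if ∀ i, row (t i) = row (g i) ∧ col (t i) = col i
      then (((Equiv.Perm.sign t : ℤˣ) : ℤ) : ℂ) else 0 := by
    rw [colSum, Finset.mul_sum, MonoidAlgebra.coeff_sum, Finsupp.finsetSum_apply]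
    refine Finset.sum_congr rfl fun t _ => ?_
    by_cases hc : ∀ i, col (t i) = col i
    · rw [if_pos hc, MonoidAlgebra.coeff_mul_single_apply, rowSum_coeff]
      have : (∀ i, row ((g * t⁻¹) i) = row i) ↔ ∀ i, row (t i) = row (g i) ∧ col (t i) = col i := by
        constructor
        · intro h' i
          have := h' (t i)
          rw [Equiv.Perm.mul_apply, Equiv.Perm.inv_def, Equiv.symm_apply_apply] at this
          exact ⟨this.symm, hc i⟩
        · intro h' i
          have := (h' (t⁻¹ i)).1
          rw [Equiv.Perm.inv_def, Equiv.apply_symm_apply] at this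
          exact this.symm
      by_cases h2 : ∀ i, row (t i) = row (g i) ∧ col (t i) = col i
      · rw [if_pos (this.mpr h2), if_pos h2, one_mul]
      · rw [if_neg fun h3 => h2 (this.mp h3), if_neg h2, zero_mul]
    · rw [if_neg hc, if_neg fun h2 => hc fun i => (h2 i).2]
      simp
  rw [hsum]
  by_cases hinj : ∀ i j, row (g i) = row (g j) → col i = col j → i = j
  · obtain ⟨t, ht⟩ := h.exists_perm g hinj
    rw [youngCoeff_eq_sign hm g t ht, Finset.sum_eq_single t, if_pos ht]
    · intro t' _ hne
      rw [if_neg]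
      intro ht'
      refine hne (Equiv.ext fun i => h.inj _ _ ?_ ?_)
      · rw [(ht i).1, (ht' i).1]
      · rw [(ht i).2, (ht' i).2]
    · simp
  · push Not at hinj
    obtain ⟨i, j, h1, h2, hij⟩ := hinj
    rw [youngCoeff_eq_zero g hij h1 h2, Int.cast_zero]
    refine Finset.sum_eq_zero fun t _ => if_neg fun ht => hij ?_
    apply t.injective
    exact h.inj _ _ (by rw [(ht i).1, (ht j).1, h1]) (by rw [(ht i).2, (ht j).2, h2])

theorem youngCoeff_one {n : ℕ} {row col : Fin n → ℕ}
    (hm : StrictMono fun i => 8 * row i + col i) : youngCoeff row col (1 : Equiv.Perm (Fin n)) = 1 := by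
  rw [youngCoeff_eq_sign hm _ 1 fun i => ⟨rfl, rfl⟩]; simp

/-- The factor by which a Young symmetrizer differs from an idempotent, from its coefficients. -/
def youngFactor {n : ℕ} (row col : Fin n → ℕ) : ℤ :=
  ∑ g : Equiv.Perm (Fin n), bif youngCoeff row col g == 0 then 0
    else youngCoeff row col g * youngCoeff row col ⇑g⁻¹

/-- The square is already known to be a multiple of the symmetrizer. Since the coefficient at `1` of
the symmetrizer is `1`, the multiple is the coefficient at `1` of the square. -/
theorem rowSum_mul_colSum_sq {n : ℕ} {row col : Fin n → ℕ} (h : IsTableau row col)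
    (hm : StrictMono fun i => 8 * row i + col i) :
    (rowSum row * colSum col) * (rowSum row * colSum col)
      = (youngFactor row col : ℂ) • (rowSum row * colSum col) := by
  classical
  obtain ⟨e, he⟩ := h.rowSum_mul_colSum (colSum col * rowSum row)
  have he' : (rowSum row * colSum col) * (rowSum row * colSum col)
      = e • (rowSum row * colSum col) := by rw [← he]; noncomm_ring
  have h1 := congrArg (fun w => w.coeff 1) he'
  have hdec : rowSum row * colSum col = ∑ g : Equiv.Perm (Fin n),
      MonoidAlgebra.single g ((rowSum row * colSum col).coeff g) := by
    conv_lhs => rw [← MonoidAlgebra.sum_coeff_single (rowSum row * colSum col)]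
    exact Finsupp.sum_fintype _ _ fun _ => by simp
  simp only [MonoidAlgebra.coeff_smul, Finsupp.smul_apply, rowSum_mul_colSum_coeff h hm,
    youngCoeff_one hm] at h1
  have h2 : ((rowSum row * colSum col) * (rowSum row * colSum col)).coeff 1
      = (youngFactor row col : ℂ) := by
    conv_lhs => enter [1, 1, 1]; rw [hdec]
    rw [Finset.sum_mul, MonoidAlgebra.coeff_sum, Finsupp.finsetSum_apply, youngFactor, Int.cast_sum]
    refine Finset.sum_congr rfl fun g _ => ?_
    rw [MonoidAlgebra.coeff_single_mul_apply, mul_one, rowSum_mul_colSum_coeff h hm,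
      rowSum_mul_colSum_coeff h hm]
    by_cases h0 : youngCoeff row col g = 0
    · simp [h0]
    · rw [beq_false_of_ne h0, cond_false, Int.cast_mul]
  rw [h2] at h1
  rw [he', h1]
  simp

end Coefficient

end

end LevelTwo

namespace LevelTwo

noncomputable section

/-! ### Diagrams -/

section Shape

/-- The diagram with rows of lengths `l` has its boxes in the rows `row` and columns `col`, and
`a` is the factor by which its Young symmetrizer differs from an idempotent. -/
structure IsShape {n : ℕ} (l : List ℕ) (row col : Fin n → ℕ) (a : ℤ) : Prop where
  sorted : l.Pairwise (· ≥ ·)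
  row_eq : ∀ i : Fin n, boxRow l i = row i
  col_eq : ∀ i : Fin n, boxCol l i = col i
  inj : ∀ i j, row i = row j → col i = col j → i = j
  left : ∀ i, ∀ t < col i, ∃ j, row j = row i ∧ col j = t
  lt : ∀ i j, i < j → 8 * row i + col i < 8 * row j + col j
  factor : youngFactor row col = a
  factor_ne : a ≠ 0

variable {n : ℕ} {l : List ℕ} {row col : Fin n → ℕ} {a : ℤ} {p : n.Partition}

theorem IsShape.isTableau (h : IsShape l row col a) : IsTableau row col := ⟨h.inj, h.left⟩

theorem rowLengths_eq (hp : p.parts = (l : Multiset ℕ)) (h : l.Pairwise (· ≥ ·)) :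
    rowLengths p = l := by
  rw [rowLengths, hp]
  exact List.Perm.eq_of_pairwise' (Multiset.pairwise_sort _ _) h
    (Multiset.coe_eq_coe.mp (Multiset.sort_eq _ _))

theorem IsShape.rowOf_eq (h : IsShape l row col a) (hp : p.parts = (l : Multiset ℕ)) :
    rowOf p = row := by
  funext i; rw [rowOf, rowLengths_eq hp h.sorted, h.row_eq]

theorem IsShape.colOf_eq (h : IsShape l row col a) (hp : p.parts = (l : Multiset ℕ)) :
    colOf p = col := by
  funext i; rw [colOf, rowLengths_eq hp h.sorted, h.col_eq]

theorem IsShape.youngSymmetrizer_sq (h : IsShape l row col a) (hp : p.parts = (l : Multiset ℕ)) :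
    youngSymmetrizer p * youngSymmetrizer p = (a : ℂ) • youngSymmetrizer p := by
  rw [youngSymmetrizer_eq, h.rowOf_eq hp, h.colOf_eq hp, ← h.factor]
  exact rowSum_mul_colSum_sq h.isTableau fun i j hij => h.lt i j hij

theorem IsShape.youngSymmetrizer_coeff (h : IsShape l row col a)
    (hp : p.parts = (l : Multiset ℕ)) (g : Equiv.Perm (Fin n)) :
    (youngSymmetrizer p).coeff g = (youngCoeff row col g : ℂ) := by
  rw [youngSymmetrizer_eq, h.rowOf_eq hp, h.colOf_eq hp]
  exact rowSum_mul_colSum_coeff h.isTableau (fun i j hij => h.lt i j hij) g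

theorem IsShape.finrank_irrep (h : IsShape l row col a) (hp : p.parts = (l : Multiset ℕ)) :
    (Module.finrank ℂ (irrepSub p).toSubmodule : ℤ) * a = n.factorial := by
  have h1 := finrank_range_mulRight (G := Equiv.Perm (Fin n)) (Int.cast_ne_zero.mpr h.factor_ne)
    (h.youngSymmetrizer_sq hp)
  rw [h.youngSymmetrizer_coeff hp, youngCoeff_one fun i j hij => h.lt i j hij,
    Fintype.card_perm, Fintype.card_fin, Int.cast_one, mul_one] at h1
  exact_mod_cast h1

theorem asAlgebraHom_eq_sum {V G : Type*} [AddCommGroup V] [Module ℂ V] [Group G] [Fintype G]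
    (ρ : Representation ℂ G V) (c : MonoidAlgebra ℂ G) (v : V) :
    ρ.asAlgebraHom c v = ∑ g, c.coeff g • ρ g v := by
  rw [Representation.asAlgebraHom_def, MonoidAlgebra.lift_apply, Finsupp.sum_fintype _ _ (by simp),
    LinearMap.sum_apply]
  rfl

theorem IsShape.asAlgebraHom {V : Type*} [AddCommGroup V] [Module ℂ V]
    (h : IsShape l row col a) (hp : p.parts = (l : Multiset ℕ))
    (ρ : Representation ℂ (Equiv.Perm (Fin n)) V) (v : V) :
    ρ.asAlgebraHom (youngSymmetrizer p) v
      = ∑ g : Equiv.Perm (Fin n), (youngCoeff row col g : ℂ) • ρ g v := by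
  rw [asAlgebraHom_eq_sum]
  exact Finset.sum_congr rfl fun g _ => by rw [h.youngSymmetrizer_coeff hp]

/-- If the symmetrizer of `p`, applied to the image of `U` under `f`, can be undone up to a
factor, then it has `dim U` independent vectors in its image. -/
theorem exists_family {V W : Type*} [AddCommGroup V] [Module ℂ V] [AddCommGroup W] [Module ℂ W]
    [FiniteDimensional ℂ W]
    (ρ : Representation ℂ (Equiv.Perm (Fin n)) V) (p : n.Partition) (f : W →ₗ[ℂ] V)
    (P : V →ₗ[ℂ] W) (U : Submodule ℂ W) {N : ℂ} (hN : N ≠ 0) {m : ℕ} (hm : Module.finrank ℂ U = m)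
    (h : ∀ w ∈ U, P (ρ.asAlgebraHom (youngSymmetrizer p) (f w)) = N • w) :
    ∃ u : Fin m → V, LinearIndependent ℂ u ∧
      ∀ i, ∃ v, u i = ρ.asAlgebraHom (youngSymmetrizer p) v := by
  subst hm
  let b := Module.finBasis ℂ U
  refine ⟨fun i => ρ.asAlgebraHom (youngSymmetrizer p) (f (b i)), ?_, fun i => ⟨_, rfl⟩⟩
  have h1 : LinearIndependent ℂ fun i => (N • (b i : W)) := by
    have h2 := b.linearIndependent.map' U.subtype (Submodule.ker_subtype U)
    have h3 := h2.units_smul fun _ => Units.mk0 N hN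
    exact h3
  refine LinearIndependent.of_comp P ?_
  convert h1 using 2 with i
  exact h _ (b i).2

end Shape

/-! ### The diagrams of size 3 and 6 that occur -/

section Diagrams

/-- Here and for the other diagrams the last number is the product of the hook lengths, that is n!
divided by the dimension of the irreducible representation. -/
theorem isShape_three : IsShape (n := 3) [3] ![0, 0, 0] ![0, 1, 2] 6 := by
  constructor <;> decide +kernel
theorem isShape_two_one : IsShape (n := 3) [2, 1] ![0, 0, 1] ![0, 1, 0] 3 := by
  constructor <;> decide +kernel
theorem isShape_one_one_one : IsShape (n := 3) [1, 1, 1] ![0, 1, 2] ![0, 0, 0] 6 := by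
  constructor <;> decide +kernel

theorem isShape_six : IsShape (n := 6) [6] ![0, 0, 0, 0, 0, 0] ![0, 1, 2, 3, 4, 5] 720 := by
  constructor <;> decide +kernel
theorem isShape_five_one :
    IsShape (n := 6) [5, 1] ![0, 0, 0, 0, 0, 1] ![0, 1, 2, 3, 4, 0] 144 := by
  constructor <;> decide +kernel
theorem isShape_four_two :
    IsShape (n := 6) [4, 2] ![0, 0, 0, 0, 1, 1] ![0, 1, 2, 3, 0, 1] 80 := by
  constructor <;> decide +kernel
theorem isShape_three_two_one :
    IsShape (n := 6) [3, 2, 1] ![0, 0, 0, 1, 1, 2] ![0, 1, 2, 0, 1, 0] 45 := by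
  constructor <;> decide +kernel
theorem isShape_two_two_two :
    IsShape (n := 6) [2, 2, 2] ![0, 0, 1, 1, 2, 2] ![0, 1, 0, 1, 0, 1] 144 := by
  constructor <;> decide +kernel
theorem isShape_three_one_one_one :
    IsShape (n := 6) [3, 1, 1, 1] ![0, 0, 0, 1, 2, 3] ![0, 1, 2, 0, 0, 0] 72 := by
  constructor <;> decide +kernel
theorem isShape_two_one_one_one_one :
    IsShape (n := 6) [2, 1, 1, 1, 1] ![0, 0, 1, 2, 3, 4] ![0, 1, 0, 0, 0, 0] 144 := by
  constructor <;> decide +kernel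

end Diagrams

end

end LevelTwo

namespace LevelTwo

noncomputable section

/-! ### Representations of `S₃` from the fixed spaces of two transpositions -/

section SymmetricThree

variable {W : Type*} [AddCommGroup W] [Module ℂ W]

/-- `X` and `Y` generate an action of `S₃` on `W` (as two transpositions), in which the trivial
and the sign representation and the standard representation have the multiplicities `d₁`, `d₄`,
and `d₁ + d₂`. -/
structure IsCuspAction (X Y : Module.End ℂ W) (d₁ d₂ d₄ : ℕ) : Prop where
  X_sq : X * X = 1
  Y_sq : Y * Y = 1
  braid : X * Y * X = Y * X * Y
  inv : Module.finrank ℂ ↥(LinearMap.ker (X - 1) ⊓ LinearMap.ker (Y - 1)) = d₁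
  fix : Module.finrank ℂ ↥(LinearMap.ker (X - 1)) = 2 * d₁ + d₂
  std : Module.finrank ℂ ↥(LinearMap.ker (X - 1) ⊓ LinearMap.ker (1 + X * Y + Y * X)) = d₁ + d₂
  sgn : Module.finrank ℂ ↥(LinearMap.ker (X + 1) ⊓ LinearMap.ker (Y + 1)) = d₄
  total : Module.finrank ℂ W = 3 * d₁ + 2 * d₂ + d₄

theorem mem_ker_sub_one {X : Module.End ℂ W} {w : W} : w ∈ LinearMap.ker (X - 1) ↔ X w = w := by
  rw [LinearMap.mem_ker, LinearMap.sub_apply, Module.End.one_apply, sub_eq_zero]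

theorem mem_ker_add_one {X : Module.End ℂ W} {w : W} : w ∈ LinearMap.ker (X + 1) ↔ X w = -w := by
  rw [LinearMap.mem_ker, LinearMap.add_apply, Module.End.one_apply, add_eq_zero_iff_eq_neg]

/-- A sum over a finite group, as a sum over a list that contains the support. -/
theorem sum_eq_sum_of_injective {G ι M : Type*} [Fintype G] [Fintype ι] [AddCommMonoid M]
    (e : ι → G) (he : Function.Injective e) (F : G → M) (hF : ∀ g, F g ≠ 0 → ∃ i, e i = g) :
    ∑ g, F g = ∑ i, F (e i) := by
  classical
  rw [← Finset.sum_image (f := F) (s := Finset.univ) fun i _ j _ h => he h]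
  refine (Finset.sum_subset (Finset.subset_univ _) fun g _ hg => ?_).symm
  by_contra h
  obtain ⟨i, hi⟩ := hF g h
  exact hg (Finset.mem_image.mpr ⟨i, Finset.mem_univ _, hi⟩)

/-- The elements of `S₃` as words in two transpositions. -/
def word {M : Type*} [Monoid M] (x y : M) : Fin 6 → M :=
  ![1, x, y, x * y, y * x, x * y * x]

theorem map_word {M N : Type*} [Monoid M] [Monoid N] (f : M →* N) (x y : M) (i : Fin 6) :
    f (word x y i) = word (f x) (f y) i := by
  fin_cases i <;> simp [word]

theorem sum_word_apply (X Y : Module.End ℂ W) (c : Fin 6 → ℂ) (w : W) :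
    ∑ i, c i • word X Y i w = c 0 • w + c 1 • X w + c 2 • Y w + c 3 • X (Y w) + c 4 • Y (X w)
      + c 5 • X (Y (X w)) := by
  rw [Fin.sum_univ_six]; rfl

theorem sum_word_of_inv {X Y : Module.End ℂ W} {w : W}
    (hw : w ∈ LinearMap.ker (X - 1) ⊓ LinearMap.ker (Y - 1)) (c : Fin 6 → ℤ) {N : ℤ}
    (hN : c 0 + c 1 + c 2 + c 3 + c 4 + c 5 = N) :
    ∑ i, (c i : ℂ) • word X Y i w = (N : ℂ) • w := by
  subst hN
  rw [sum_word_apply X Y (fun i => (c i : ℂ)), mem_ker_sub_one.mp hw.1, mem_ker_sub_one.mp hw.2,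
    mem_ker_sub_one.mp hw.1]
  push_cast
  module

theorem sum_word_of_sgn {X Y : Module.End ℂ W} {w : W}
    (hw : w ∈ LinearMap.ker (X + 1) ⊓ LinearMap.ker (Y + 1)) (c : Fin 6 → ℤ) {N : ℤ}
    (hN : c 0 - c 1 - c 2 + c 3 + c 4 - c 5 = N) :
    ∑ i, (c i : ℂ) • word X Y i w = (N : ℂ) • w := by
  subst hN
  rw [sum_word_apply X Y (fun i => (c i : ℂ)), mem_ker_add_one.mp hw.1, map_neg,
    mem_ker_add_one.mp hw.2, neg_neg, map_neg, mem_ker_add_one.mp hw.1, neg_neg]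
  push_cast
  module

/-- On a vector fixed by `X` the words `y` and `y x` agree, and so do `x y` and `x y x`. The two
conditions say that these pairs cancel. -/
theorem sum_word_of_fix {X Y : Module.End ℂ W} {w : W} (hw : w ∈ LinearMap.ker (X - 1))
    (c : Fin 6 → ℤ) (h1 : c 2 + c 4 = 0) (h2 : c 3 + c 5 = 0) {N : ℤ}
    (hN : c 0 + c 1 = N) :
    ∑ i, (c i : ℂ) • word X Y i w = (N : ℂ) • w := by
  subst hN
  rw [sum_word_apply X Y (fun i => (c i : ℂ)), mem_ker_sub_one.mp hw,
    eq_neg_of_add_eq_zero_right h1, eq_neg_of_add_eq_zero_right h2]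
  push_cast
  module

/-- The kernel of `1 + X Y + Y X`, the sum over the rotations, is the part of type s[2,1]; each copy
contains one line fixed by `X`. On that line `X Y w = -w - Y w`, and the condition on the
coefficients removes what is left of `Y w`. -/
theorem sum_word_of_std {X Y : Module.End ℂ W} {w : W}
    (hw : w ∈ LinearMap.ker (X - 1) ⊓ LinearMap.ker (1 + X * Y + Y * X))
    (c : Fin 6 → ℤ) (h : c 2 + c 4 = c 3 + c 5) {N : ℤ}
    (hN : c 0 + c 1 - c 2 - c 4 = N) :
    ∑ i, (c i : ℂ) • word X Y i w = (N : ℂ) • w := by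
  subst hN
  have h1 := mem_ker_sub_one.mp hw.1
  have h2 : w + X (Y w) + Y (X w) = 0 := hw.2
  rw [h1] at h2
  have h3 : X (Y w) = -w - Y w := by rw [← sub_eq_zero, ← h2]; abel
  have h4 : c 5 = c 2 + c 4 - c 3 := by omega
  rw [sum_word_apply X Y (fun i => (c i : ℂ)), h1, h3, h4]
  push_cast
  module

theorem word_three_injective :
    Function.Injective (word (Equiv.swap (0 : Fin 3) 1) (Equiv.swap (0 : Fin 3) 2)) := by
  decide +kernel

theorem word_three_surjective (g : Equiv.Perm (Fin 3)) :
    ∃ i, word (Equiv.swap (0 : Fin 3) 1) (Equiv.swap (0 : Fin 3) 2) i = g := by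
  revert g; decide +kernel

theorem IsShape.asAlgebraHom_three {l : List ℕ} {row col : Fin 3 → ℕ} {a : ℤ}
    {p : (3).Partition} (h : IsShape l row col a) (hp : p.parts = (l : Multiset ℕ))
    (ρ : Representation ℂ (Equiv.Perm (Fin 3)) W) (c : Fin 6 → ℤ)
    (hc : ∀ i, youngCoeff row col
      (word (Equiv.swap 0 1) (Equiv.swap 0 2) i : Equiv.Perm (Fin 3))
      = c i) (v : W) :
    ρ.asAlgebraHom (youngSymmetrizer p) v
      = ∑ i, (c i : ℂ) • word (ρ (Equiv.swap 0 1)) (ρ (Equiv.swap 0 2)) i v := by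
  rw [h.asAlgebraHom hp,
    sum_eq_sum_of_injective _ word_three_injective _ fun g _ => word_three_surjective g]
  exact Finset.sum_congr rfl fun i _ => by rw [map_word, hc]

theorem sum_irrep_le {n r : ℕ} (m : n.Partition → ℕ) (P : Fin r → n.Partition)
    (hP : Function.Injective P) :
    ∑ i, m (P i) * Module.finrank ℂ (irrepSub (P i)).toSubmodule
      ≤ ∑ p, m p * Module.finrank ℂ (irrepSub p).toSubmodule := by
  classical
  rw [← Finset.sum_image (f := fun p => m p * Module.finrank ℂ (irrepSub p).toSubmodule)
    (s := Finset.univ) fun i _ j _ h => hP h]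
  exact Finset.sum_le_sum_of_subset (Finset.subset_univ _)

/-- Decompositions from one family of vectors for each of the diagrams in a list. -/
theorem equiv_isotypicSum_of_shapes {n r : ℕ} {V : Type*} [AddCommGroup V] [Module ℂ V]
    [FiniteDimensional ℂ V] (ρ : Representation ℂ (Equiv.Perm (Fin n)) V)
    (m : n.Partition → ℕ) (l : Fin r → List ℕ) (row col : Fin r → Fin n → ℕ) (a : Fin r → ℤ)
    (hl : ∀ i, IsShape (l i) (row i) (col i) (a i))
    (hm : ∀ p, m p ≠ 0 → ∃ i, p.parts = (l i : Multiset ℕ))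
    (hcol : Function.Injective fun i => ∑ j, col i j ^ 2)
    (P : Fin r → n.Partition) (hP : ∀ i, (P i).parts = (l i : Multiset ℕ))
    (hu : ∀ i, ∃ u : Fin (m (P i)) → V, LinearIndependent ℂ u ∧
      ∀ j, ∃ v, u j = ρ.asAlgebraHom (youngSymmetrizer (P i)) v)
    (hdim : Module.finrank ℂ V
      ≤ ∑ i, m (P i) * Module.finrank ℂ (irrepSub (P i)).toSubmodule) :
    Nonempty (ρ.Equiv (isotypicSum m)) := by
  have hm' : ∀ p, m p ≠ 0 → ∃ i, p = P i := fun p hp => by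
    obtain ⟨i, hi⟩ := hm p hp
    exact ⟨i, Nat.Partition.ext (hi.trans (hP i).symm)⟩
  have hPinj : Function.Injective P := fun i j hij => hcol (by
    have h1 := (hl i).colOf_eq (hP i)
    have h2 := (hl j).colOf_eq (hP j)
    rw [hij] at h1
    change ∑ x, col i x ^ 2 = ∑ x, col j x ^ 2
    rw [← h1, ← h2])
  have key : ∀ p, ∃ (α : ℂ) (u : Fin (m p) → V), (m p ≠ 0 → α ≠ 0 ∧
      youngSymmetrizer p * youngSymmetrizer p = α • youngSymmetrizer p) ∧
      LinearIndependent ℂ u ∧ ∀ j, ∃ v, u j = ρ.asAlgebraHom (youngSymmetrizer p) v := by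
    intro p
    by_cases hp : m p = 0
    · have : IsEmpty (Fin (m p)) := by rw [hp]; infer_instance
      exact ⟨0, isEmptyElim, fun h => absurd hp h, linearIndependent_empty_type,
        fun j => isEmptyElim j⟩
    · obtain ⟨i, rfl⟩ := hm' p hp
      obtain ⟨u, h1, h2⟩ := hu i
      exact ⟨a i, u, fun _ => ⟨Int.cast_ne_zero.mpr (hl i).factor_ne,
        (hl i).youngSymmetrizer_sq (hP i)⟩, h1, h2⟩
  choose α u h3 hui huc using key
  refine equiv_isotypicSum ρ m α (fun p hp => ?_) (fun p q hp hq hpq => ?_) h3 u hui huc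
    (hdim.trans (sum_irrep_le m P hPinj))
  · obtain ⟨i, rfl⟩ := hm' p hp
    rw [(hl i).rowOf_eq (hP i), (hl i).colOf_eq (hP i)]
    exact (hl i).isTableau
  · obtain ⟨i, rfl⟩ := hm' p hp
    obtain ⟨j, rfl⟩ := hm' q hq
    rw [(hl i).colOf_eq (hP i), (hl j).colOf_eq (hP j)]
    exact fun h => hpq (congrArg P (hcol h))

/-- The partition with the given parts. -/
def partitionOf (l : List ℕ) (h : ∀ i ∈ l, 0 < i) {n : ℕ} (hs : l.sum = n) : n.Partition :=
  ⟨(l : Multiset ℕ), fun {i} hi => h i hi, hs⟩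

theorem finrank_irrep_eq {n : ℕ} {l : List ℕ} {row col : Fin n → ℕ} {a : ℤ}
    (h : IsShape l row col a) {p : n.Partition} (hp : p.parts = (l : Multiset ℕ)) {d : ℕ}
    (hd : (d : ℤ) * a = n.factorial) : Module.finrank ℂ (irrepSub p).toSubmodule = d := by
  have h1 := h.finrank_irrep hp
  rw [← hd] at h1
  exact_mod_cast mul_right_cancel₀ h.factor_ne h1

theorem cuspMult_ne_zero {k : ℕ} {p : (3).Partition} (h : cuspMult k p ≠ 0) :
    p.parts = {3} ∨ p.parts = {2, 1} ∨ p.parts = {1, 1, 1} := by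
  contrapose! h
  rw [cuspMult, if_neg h.1, if_neg h.2.1, if_neg h.2.2]

/-- The decomposition of a representation of `S₃`. -/
theorem IsCuspAction.equiv_isotypicSum [FiniteDimensional ℂ W] (k : ℕ)
    (ρ : Representation ℂ (Equiv.Perm (Fin 3)) W)
    (h : IsCuspAction (ρ (Equiv.swap 0 1)) (ρ (Equiv.swap 0 2)) (newDim 1 (2 * k))
      (newDim 2 (2 * k)) (newDim 4 (2 * k))) :
    Nonempty (ρ.Equiv (isotypicSum (cuspMult k))) := by
  let P : Fin 3 → (3).Partition := ![partitionOf [3] (by decide) rfl,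
    partitionOf [2, 1] (by decide) rfl, partitionOf [1, 1, 1] (by decide) rfl]
  have m0 : cuspMult k (P 0) = newDim 1 (2 * k) := if_pos rfl
  have m1 : cuspMult k (P 1) = newDim 1 (2 * k) + newDim 2 (2 * k) :=
    (if_neg (by decide)).trans (if_pos rfl)
  have m2 : cuspMult k (P 2) = newDim 4 (2 * k) :=
    (if_neg (by decide)).trans ((if_neg (by decide)).trans (if_pos rfl))
  have hsh : ∀ i, IsShape ((![[3], [2, 1], [1, 1, 1]] : Fin 3 → List ℕ) i)
      ((![![0, 0, 0], ![0, 0, 1], ![0, 1, 2]] : Fin 3 → Fin 3 → ℕ) i)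
      ((![![0, 1, 2], ![0, 1, 0], ![0, 0, 0]] : Fin 3 → Fin 3 → ℕ) i)
      ((![6, 3, 6] : Fin 3 → ℤ) i) := by
    intro i; fin_cases i
    exacts [isShape_three, isShape_two_one, isShape_one_one_one]
  have hP : ∀ i, (P i).parts = ((![[3], [2, 1], [1, 1, 1]] : Fin 3 → List ℕ) i : Multiset ℕ) := by
    intro i; fin_cases i <;> rfl
  refine equiv_isotypicSum_of_shapes ρ _ _ _ _ _ hsh (fun p hp => ?_) (by decide) P hP
    (fun i => ?_) ?_
  · rcases cuspMult_ne_zero hp with h | h | h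
    exacts [⟨0, h⟩, ⟨1, h⟩, ⟨2, h⟩]
  · fin_cases i
    · refine exists_family ρ (P 0) LinearMap.id LinearMap.id _ (N := ((6 : ℤ) : ℂ))
        (by norm_num)
        (h.inv.trans m0.symm) fun w hw => ?_
      rw [LinearMap.id_apply, LinearMap.id_apply, (hsh 0).asAlgebraHom_three (hP 0) ρ
        ![1, 1, 1, 1, 1, 1] (by decide +kernel), sum_word_of_inv hw _ (N := 6) (by decide)]
    · refine exists_family ρ (P 1) LinearMap.id LinearMap.id _ (N := ((3 : ℤ) : ℂ))
        (by norm_num)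
        (h.std.trans m1.symm) fun w hw => ?_
      rw [LinearMap.id_apply, LinearMap.id_apply, (hsh 1).asAlgebraHom_three (hP 1) ρ
        ![1, 1, -1, -1, 0, 0] (by decide +kernel), sum_word_of_std hw _ (by decide) (N := 3) (by decide)]
    · refine exists_family ρ (P 2) LinearMap.id LinearMap.id _ (N := ((6 : ℤ) : ℂ))
        (by norm_num)
        (h.sgn.trans m2.symm) fun w hw => ?_
      rw [LinearMap.id_apply, LinearMap.id_apply, (hsh 2).asAlgebraHom_three (hP 2) ρ
        ![1, -1, -1, 1, 1, -1] (by decide +kernel), sum_word_of_sgn hw _ (N := 6) (by decide)]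
  -- The count is d₁ · 1 + (d₁ + d₂) · 2 + d₄ · 1, equal to the total dimension.
  · rw [Fin.sum_univ_three, m0, m1, m2, finrank_irrep_eq (hsh 0) (hP 0) (d := 1) (by decide),
      finrank_irrep_eq (hsh 1) (hP 1) (d := 2) (by decide),
      finrank_irrep_eq (hsh 2) (hP 2) (d := 1) (by decide), h.total]
    omega

end SymmetricThree

end

end LevelTwo

namespace LevelTwo

noncomputable section

/-! ### Induced representations -/

section Induced

variable {G W : Type*} [Group G] [AddCommGroup W] [Module ℂ W] {H : Subgroup G}

/-- The element `h ⊗ w` of the induced representation. -/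
def indMk (σ : Representation ℂ H W) (h : G) : W →ₗ[ℂ] Representation.IndV H.subtype σ :=
  Representation.IndV.mk H.subtype σ h

theorem ind_indMk (σ : Representation ℂ H W) (g h : G) (w : W) :
    Representation.ind H.subtype σ g (indMk σ h w) = indMk σ (h * g⁻¹) w :=
  Representation.ind_mk H.subtype σ g h w

theorem indMk_mul (σ : Representation ℂ H W) (x : H) (h : G) (w : W) :
    indMk σ (x * h) (σ x w) = indMk σ h w := by
  have := Representation.Coinvariants.mk_self_apply
    (Representation.tprod ((Representation.leftRegular ℂ G).comp H.subtype) σ) x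
    (MonoidAlgebra.single h 1 ⊗ₜ w)
  rw [Representation.tprod_apply, TensorProduct.map_tmul] at this
  rw [indMk, indMk]
  simpa [Representation.IndV.mk] using this

theorem indMk_eq (σ : Representation ℂ H W) (x : H) (h : G) (w : W) :
    indMk σ (x * h) w = indMk σ h (σ x⁻¹ w) := by
  rw [← indMk_mul σ x h, ← Module.End.mul_apply, ← map_mul, mul_inv_cancel, map_one,
    Module.End.one_apply]

theorem ind_induction {σ : Representation ℂ H W} {p : Representation.IndV H.subtype σ → Prop}
    (hmk : ∀ h w, p (indMk σ h w)) (hadd : ∀ x y, p x → p y → p (x + y)) (v) : p v := by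
  have h0 : p 0 := by simpa using hmk 1 0
  induction v using Representation.Coinvariants.induction_on with
  | _ v =>
    induction v with
    | zero => simpa using h0
    | add x y hx hy => rw [map_add]; exact hadd _ _ hx hy
    | tmul a w =>
      induction a using MonoidAlgebra.induction_linear with
      | zero => simpa using h0
      | add a b ha hb => rw [TensorProduct.add_tmul, map_add]; exact hadd _ _ ha hb
      | single g r =>
        have : Representation.Coinvariants.mk
            (Representation.tprod ((Representation.leftRegular ℂ G).comp H.subtype) σ)
            (MonoidAlgebra.single g r ⊗ₜ w) = indMk σ g (r • w) := by
          rw [indMk, Representation.IndV.mk, LinearMap.comp_apply, TensorProduct.mk_apply,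
            ← TensorProduct.smul_tmul, MonoidAlgebra.smul_single, smul_eq_mul, mul_one]
        rw [this]
        exact hmk g _

/-- The linear map on the induced representation with given values `f h w` at `h ⊗ w`. -/
def indLift {U : Type*} [AddCommGroup U] [Module ℂ U] (σ : Representation ℂ H W)
    (f : G → W →ₗ[ℂ] U) (hf : ∀ (x : H) (h : G) (w : W), f (x * h) (σ x w) = f h w) :
    Representation.IndV H.subtype σ →ₗ[ℂ] U :=
  Representation.Coinvariants.lift _
    (TensorProduct.lift ((Finsupp.lsum ℂ fun h : G => (LinearMap.toSpanSingleton ℂ (W →ₗ[ℂ] U) (f h))).comp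
      (MonoidAlgebra.coeffLinearEquiv ℂ).toLinearMap)) fun x => by
    refine TensorProduct.ext (MonoidAlgebra.lhom_ext' fun h => LinearMap.ext_ring ?_)
    ext w
    simp [hf]

theorem indLift_indMk {U : Type*} [AddCommGroup U] [Module ℂ U] (σ : Representation ℂ H W)
    (f : G → W →ₗ[ℂ] U) (hf : ∀ (x : H) (h : G) (w : W), f (x * h) (σ x w) = f h w)
    (h : G) (w : W) : indLift σ f hf (indMk σ h w) = f h w := by
  rw [indLift, indMk, Representation.IndV.mk, LinearMap.comp_apply,
    Representation.Coinvariants.lift_mk]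
  simp

open Classical in
/-- A representation of a subgroup, extended by zero to a function on the group. -/
def extendZero (σ : Representation ℂ H W) (g : G) : Module.End ℂ W :=
  if h : g ∈ H then σ ⟨g, h⟩ else 0

theorem extendZero_mem (σ : Representation ℂ H W) {g : G} (h : g ∈ H) :
    extendZero σ g = σ ⟨g, h⟩ := dif_pos h

theorem extendZero_notMem (σ : Representation ℂ H W) {g : G} (h : g ∉ H) :
    extendZero σ g = 0 := dif_neg h

theorem extendZero_mul (σ : Representation ℂ H W) {g h : G} (hg : g ∈ H) (hh : h ∈ H) :
    extendZero σ (g * h) = extendZero σ g * extendZero σ h := by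
  rw [extendZero_mem σ hg, extendZero_mem σ hh, extendZero_mem σ (H.mul_mem hg hh), ← map_mul]
  rfl

/-- The component at the trivial coset. -/
def indComponent (σ : Representation ℂ H W) : Representation.IndV H.subtype σ →ₗ[ℂ] W :=
  indLift σ (fun h => extendZero σ h⁻¹) fun x h w => by
    by_cases hh : h ∈ H
    · rw [mul_inv_rev, extendZero_mul σ (H.inv_mem hh) (H.inv_mem x.2), Module.End.mul_apply,
        extendZero_mem σ (H.inv_mem x.2), ← Module.End.mul_apply (σ _) (σ x), ← map_mul]
      have : (⟨(x : G)⁻¹, H.inv_mem x.2⟩ : H) * x = 1 := Subtype.ext (inv_mul_cancel _)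
      rw [this, map_one, Module.End.one_apply]
    · rw [extendZero_notMem, extendZero_notMem]
      · rfl
      · rwa [inv_mem_iff]
      · rwa [inv_mem_iff, H.mul_mem_cancel_left x.2]

theorem indComponent_indMk (σ : Representation ℂ H W) (h : G) (w : W) :
    indComponent σ (indMk σ h w) = extendZero σ h⁻¹ w := indLift_indMk _ _ _ _ _

/-- Moving `x ∈ H` across the tensor sign reduces `h ⊗ w` to one representative of each coset `H h`;
these are the inverses of representatives of `G ⧸ H`. Besides the bound for the dimension, this
gives the normal form in which injectivity of the map to Klingen series is tested. -/
theorem indMk_sum_surjective [Finite (G ⧸ H)] [Fintype (G ⧸ H)] (σ : Representation ℂ H W) :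
    Function.Surjective (∑ q : G ⧸ H, (indMk σ q.out⁻¹).comp (LinearMap.proj q) :
      (G ⧸ H → W) →ₗ[ℂ] Representation.IndV H.subtype σ) := by
  classical
  intro v
  induction v using ind_induction with
  | hmk h w =>
    obtain ⟨x, hx⟩ := QuotientGroup.mk_out_eq_mul H h⁻¹
    have hh : h = (x : G) * ((h⁻¹ : G) : G ⧸ H).out⁻¹ := by rw [hx]; group
    refine ⟨Pi.single ((h⁻¹ : G) : G ⧸ H) (σ x⁻¹ w), ?_⟩
    rw [LinearMap.sum_apply, Finset.sum_eq_single ((h⁻¹ : G) : G ⧸ H)]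
    · rw [LinearMap.comp_apply, LinearMap.proj_apply, Pi.single_eq_same, ← indMk_eq, ← hh]
    · intro q _ hq
      rw [LinearMap.comp_apply, LinearMap.proj_apply, Pi.single_eq_of_ne hq, map_zero]
    · simp
  | hadd x y hx hy =>
    obtain ⟨a, rfl⟩ := hx
    obtain ⟨b, rfl⟩ := hy
    exact ⟨a + b, map_add _ _ _⟩

theorem finite_ind [Finite G] [FiniteDimensional ℂ W] (σ : Representation ℂ H W) :
    FiniteDimensional ℂ (Representation.IndV H.subtype σ) := by
  have := Fintype.ofFinite (G ⧸ H)
  exact Module.Finite.of_surjective _ (indMk_sum_surjective σ)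

theorem finrank_ind_le [Finite G] [FiniteDimensional ℂ W] (σ : Representation ℂ H W) :
    Module.finrank ℂ (Representation.IndV H.subtype σ) ≤ H.index * Module.finrank ℂ W := by
  have := Fintype.ofFinite (G ⧸ H)
  refine (LinearMap.finrank_le_finrank_of_surjective (indMk_sum_surjective σ)).trans_eq ?_
  rw [Module.finrank_pi_fintype, Finset.sum_const, Finset.card_univ, smul_eq_mul,
    Subgroup.index_eq_card, Nat.card_eq_fintype_card]

end Induced

/-! ### Induction from the centraliser of a transposition in S₆ -/

section SymmetricSix

variable {W : Type*} [AddCommGroup W] [Module ℂ W] {H : Subgroup (Equiv.Perm (Fin 6))}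

/-- The kernel of the map from the centralizer of a transposition to `S₃`. -/
def kleinWord : Fin 8 → Equiv.Perm (Fin 6) :=
  let a : Equiv.Perm (Fin 6) := Equiv.swap 0 1 * Equiv.swap 4 5
  let b : Equiv.Perm (Fin 6) := Equiv.swap 0 4 * Equiv.swap 1 5
  let z : Equiv.Perm (Fin 6) := Equiv.swap 2 3
  ![1, a, b, a * b, z, z * a, z * b, z * (a * b)]

/-- The elements of the centralizer of the transposition `(2 3)`. -/
def centralizerWord (i : Fin 6 × Fin 8) : Equiv.Perm (Fin 6) :=
  kleinWord i.2 * word (Equiv.swap 0 1) (Equiv.swap 0 4) i.1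

/-- `g` stabilizes `{2, 3}`. -/
def stabPair (g : Equiv.Perm (Fin 6)) : Prop := (g 2 = 2 ∨ g 2 = 3) ∧ (g 3 = 2 ∨ g 3 = 3)

instance : DecidablePred stabPair := fun g => by unfold stabPair; infer_instance

theorem centralizerWord_injective : Function.Injective centralizerWord := by
  decide +kernel

theorem exists_centralizerWord (g : Equiv.Perm (Fin 6)) :
    stabPair g → ∃ i, centralizerWord i = g := by
  revert g; decide +kernel

theorem stabPair_kleinWord : ∀ j, stabPair (kleinWord j) := by decide +kernel

theorem stabPair_word :
    ∀ i, stabPair (word (Equiv.swap 0 1) (Equiv.swap 0 4) i) := by decide +kernel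

theorem card_stabPair : (Finset.univ.filter stabPair).card = 48 := by decide +kernel

theorem index_of_stabPair (hH : ∀ g, g ∈ H ↔ stabPair g) : H.index = 15 := by
  classical
  have h1 : Nat.card H = 48 := by
    rw [← card_stabPair, Nat.card_eq_fintype_card, Fintype.card_subtype]
    congr 1
    ext g
    simp [hH]
  have h2 := H.card_mul_index
  rw [h1, Nat.card_eq_fintype_card, Fintype.card_perm, Fintype.card_fin] at h2
  have : (6).factorial = 720 := rfl
  omega

/-- A representation of the centralizer of a transposition that comes from `S₃`. -/
structure IsInflated (σ : Representation ℂ H W) (X Y : Module.End ℂ W) : Prop where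
  mem : ∀ g, g ∈ H ↔ stabPair g
  swap01 : extendZero σ (Equiv.swap 0 1) = X
  swap45 : extendZero σ (Equiv.swap 4 5) = X
  swap04 : extendZero σ (Equiv.swap 0 4) = Y
  swap15 : extendZero σ (Equiv.swap 1 5) = Y
  swap23 : extendZero σ (Equiv.swap 2 3) = 1
  X_sq : X * X = 1
  Y_sq : Y * Y = 1

/-- The transpositions (0 1) and (4 5) act alike, and so do (0 4) and (1 5). Their products act as
`X * X` and `Y * Y`, so the representation descends along S₂ × S₄ → S₃. -/
theorem IsInflated.kleinWord {σ : Representation ℂ H W} {X Y : Module.End ℂ W}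
    (h : IsInflated σ X Y) (j : Fin 8) : extendZero σ (kleinWord j) = 1 := by
  have m : ∀ g, stabPair g → g ∈ H := fun g => (h.mem g).mpr
  have ha : extendZero σ (Equiv.swap 0 1 * Equiv.swap 4 5) = 1 := by
    rw [extendZero_mul σ (m _ (by decide)) (m _ (by decide)), h.swap01, h.swap45, h.X_sq]
  have hb : extendZero σ (Equiv.swap 0 4 * Equiv.swap 1 5) = 1 := by
    rw [extendZero_mul σ (m _ (by decide)) (m _ (by decide)), h.swap04, h.swap15, h.Y_sq]
  have hab : extendZero σ (Equiv.swap 0 1 * Equiv.swap 4 5 * (Equiv.swap 0 4 * Equiv.swap 1 5))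
      = 1 := by
    rw [extendZero_mul σ (m _ (by decide)) (m _ (by decide)), ha, hb, one_mul]
  have h1 : extendZero σ 1 = 1 := by
    rw [extendZero_mem σ H.one_mem]; exact map_one σ
  have hz : ∀ g, stabPair g → extendZero σ g = 1 → extendZero σ (Equiv.swap 2 3 * g) = 1 := by
    intro g hg hg1
    rw [extendZero_mul σ (m _ (by decide)) (m _ hg), h.swap23, hg1, one_mul]
  fin_cases j
  exacts [h1, ha, hb, hab, h.swap23, hz _ (by decide) ha, hz _ (by decide) hb,
    hz _ (by decide) hab]

theorem IsInflated.word {σ : Representation ℂ H W} {X Y : Module.End ℂ W}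
    (h : IsInflated σ X Y) (i : Fin 6) :
    extendZero σ (word (Equiv.swap 0 1) (Equiv.swap 0 4) i) = LevelTwo.word X Y i := by
  have m : ∀ g, stabPair g → g ∈ H := fun g => (h.mem g).mpr
  have hxy : extendZero σ (Equiv.swap 0 1 * Equiv.swap 0 4) = X * Y := by
    rw [extendZero_mul σ (m _ (by decide)) (m _ (by decide)), h.swap01, h.swap04]
  fin_cases i
  · change extendZero σ 1 = 1
    rw [extendZero_mem σ H.one_mem]; exact map_one σ
  · exact h.swap01
  · exact h.swap04
  · exact hxy
  · change extendZero σ (Equiv.swap 0 4 * Equiv.swap 0 1) = Y * X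
    rw [extendZero_mul σ (m _ (by decide)) (m _ (by decide)), h.swap01, h.swap04]
  · change extendZero σ (Equiv.swap 0 1 * Equiv.swap 0 4 * Equiv.swap 0 1) = X * Y * X
    rw [extendZero_mul σ (m _ (by decide)) (m _ (by decide)), hxy, h.swap01]

/-- Only the group elements `g y x⁻¹` with `y ∈ H` contribute to the component at the trivial coset.
Collecting them along the kernel of order 8 turns the symmetrizer of S₆ into an element of the group
algebra of S₃ acting on `W`, with six integers as coefficients. -/
theorem IsShape.indComponent_symmetrizer {l : List ℕ} {row col : Fin 6 → ℕ} {a : ℤ}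
    {p : (6).Partition} (hs : IsShape l row col a) (hp : p.parts = (l : Multiset ℕ))
    {σ : Representation ℂ H W} {X Y : Module.End ℂ W} (h : IsInflated σ X Y)
    (g x : Equiv.Perm (Fin 6)) (c : Fin 6 → ℤ)
    (hc : ∀ i, ∑ j, youngCoeff row col ⇑(g * centralizerWord (i, j) * x⁻¹) = c i) (w : W) :
    indComponent σ (Representation.ind H.subtype σ g⁻¹
      ((Representation.ind H.subtype σ).asAlgebraHom (youngSymmetrizer p) (indMk σ x⁻¹ w)))
      = ∑ i, (c i : ℂ) • LevelTwo.word X Y i w := by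
  rw [hs.asAlgebraHom hp, map_sum, map_sum,
    ← Fintype.sum_equiv ((Equiv.mulLeft g).trans (Equiv.mulRight x⁻¹)) (fun y =>
      (youngCoeff row col ⇑(g * y * x⁻¹) : ℂ) • extendZero σ y w) _ fun y => ?_,
    sum_eq_sum_of_injective _ centralizerWord_injective, Fintype.sum_prod_type]
  · refine Finset.sum_congr rfl fun i _ => ?_
    rw [← hc i, Int.cast_sum, Finset.sum_smul]
    refine Finset.sum_congr rfl fun j _ => ?_
    congr 1
    rw [centralizerWord, extendZero_mul σ ((h.mem _).mpr (stabPair_kleinWord j))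
      ((h.mem _).mpr (stabPair_word i)), h.kleinWord, h.word, one_mul]
  · intro y hy
    refine exists_centralizerWord y ((h.mem y).mp ?_)
    by_contra hn
    rw [extendZero_notMem σ hn, LinearMap.zero_apply, smul_zero] at hy
    exact hy rfl
  · rw [map_smul, map_smul, ind_indMk, ind_indMk, indComponent_indMk]
    congr 3
    simp [mul_assoc]

theorem klingenMult_ne_zero {k : ℕ} {p : (6).Partition} (h : klingenMult k p ≠ 0) :
    p.parts = {6} ∨ p.parts = {5, 1} ∨ p.parts = {4, 2} ∨ p.parts = {3, 2, 1} ∨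
      p.parts = {2, 2, 2} ∨ p.parts = {3, 1, 1, 1} ∨ p.parts = {2, 1, 1, 1, 1} := by
  contrapose! h
  obtain ⟨h1, h2, h3, h4, h5, h6, h7⟩ := h
  rw [klingenMult, if_neg (not_or.mpr ⟨h1, h2⟩), if_neg h3, if_neg (not_or.mpr ⟨h4, h5⟩),
    if_neg (not_or.mpr ⟨h6, h7⟩)]

/-- The decomposition of a representation of `S₆` induced from the centralizer of a
transposition. -/
theorem IsCuspAction.ind_equiv_isotypicSum [FiniteDimensional ℂ W] (k : ℕ)
    {σ : Representation ℂ H W} {X Y : Module.End ℂ W} (hσ : IsInflated σ X Y)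
    (h : IsCuspAction X Y (newDim 1 (2 * k)) (newDim 2 (2 * k)) (newDim 4 (2 * k))) :
    Nonempty ((Representation.ind H.subtype σ).Equiv (isotypicSum (klingenMult k))) := by
  let P : Fin 7 → (6).Partition := ![partitionOf [6] (by decide) rfl,
    partitionOf [5, 1] (by decide) rfl, partitionOf [4, 2] (by decide) rfl,
    partitionOf [3, 2, 1] (by decide) rfl, partitionOf [2, 2, 2] (by decide) rfl,
    partitionOf [3, 1, 1, 1] (by decide) rfl, partitionOf [2, 1, 1, 1, 1] (by decide) rfl]
  have m0 : klingenMult k (P 0) = newDim 1 (2 * k) := if_pos (by decide)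
  have m1 : klingenMult k (P 1) = newDim 1 (2 * k) := if_pos (by decide)
  have m2 : klingenMult k (P 2) = 2 * newDim 1 (2 * k) + newDim 2 (2 * k) :=
    (if_neg (by decide)).trans (if_pos rfl)
  have m3 : klingenMult k (P 3) = newDim 1 (2 * k) + newDim 2 (2 * k) :=
    (if_neg (by decide)).trans ((if_neg (by decide)).trans (if_pos (by decide)))
  have m4 : klingenMult k (P 4) = newDim 1 (2 * k) + newDim 2 (2 * k) :=
    (if_neg (by decide)).trans ((if_neg (by decide)).trans (if_pos (by decide)))
  have m5 : klingenMult k (P 5) = newDim 4 (2 * k) := (if_neg (by decide)).trans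
    ((if_neg (by decide)).trans ((if_neg (by decide)).trans (if_pos (by decide))))
  have m6 : klingenMult k (P 6) = newDim 4 (2 * k) := (if_neg (by decide)).trans
    ((if_neg (by decide)).trans ((if_neg (by decide)).trans (if_pos (by decide))))
  have hsh : ∀ i, IsShape ((![[6], [5, 1], [4, 2], [3, 2, 1], [2, 2, 2], [3, 1, 1, 1],
      [2, 1, 1, 1, 1]] : Fin 7 → List ℕ) i)
      ((![![0, 0, 0, 0, 0, 0], ![0, 0, 0, 0, 0, 1], ![0, 0, 0, 0, 1, 1], ![0, 0, 0, 1, 1, 2],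
        ![0, 0, 1, 1, 2, 2], ![0, 0, 0, 1, 2, 3], ![0, 0, 1, 2, 3, 4]] : Fin 7 → Fin 6 → ℕ) i)
      ((![![0, 1, 2, 3, 4, 5], ![0, 1, 2, 3, 4, 0], ![0, 1, 2, 3, 0, 1], ![0, 1, 2, 0, 1, 0],
        ![0, 1, 0, 1, 0, 1], ![0, 1, 2, 0, 0, 0], ![0, 1, 0, 0, 0, 0]] : Fin 7 → Fin 6 → ℕ) i)
      ((![720, 144, 80, 45, 144, 72, 144] : Fin 7 → ℤ) i) := by
    intro i; fin_cases i
    exacts [isShape_six, isShape_five_one, isShape_four_two, isShape_three_two_one,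
      isShape_two_two_two, isShape_three_one_one_one, isShape_two_one_one_one_one]
  have hP : ∀ i, (P i).parts = ((![[6], [5, 1], [4, 2], [3, 2, 1], [2, 2, 2], [3, 1, 1, 1],
      [2, 1, 1, 1, 1]] : Fin 7 → List ℕ) i : Multiset ℕ) := by
    intro i; fin_cases i <;> rfl
  have := finite_ind σ
  set ρ := Representation.ind H.subtype σ
  -- The subspace `U` is modelled on Frobenius reciprocity. Invariants serve for [6] and [5,1]; the
  -- vectors fixed by `X`, one line for each trivial and each standard constituent, serve for [4,2];
  -- the fixed lines of the standard part serve for [3,2,1] and [2³]; the sign part serves for the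
  -- last two. The shifts `g` and `x` are chosen to make the scalar `N` nonzero.
  have fam : ∀ (i : Fin 7) (g x : Equiv.Perm (Fin 6)) (U : Submodule ℂ W) (N : ℤ) (_ : N ≠ 0)
      (_ : Module.finrank ℂ U = klingenMult k (P i))
      (_ : ∀ w ∈ U, (indComponent σ).comp (ρ g⁻¹)
        (ρ.asAlgebraHom (youngSymmetrizer (P i)) (indMk σ x⁻¹ w)) = (N : ℂ) • w),
      ∃ u : Fin (klingenMult k (P i)) → Representation.IndV H.subtype σ, LinearIndependent ℂ u ∧
        ∀ j, ∃ v, u j = ρ.asAlgebraHom (youngSymmetrizer (P i)) v :=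
    fun i g x U N hN hU hw => exists_family ρ (P i) (indMk σ x⁻¹)
      ((indComponent σ).comp (ρ g⁻¹)) U (Int.cast_ne_zero.mpr hN) hU hw
  refine equiv_isotypicSum_of_shapes ρ _ _ _ _ _ hsh (fun p hp => ?_) (by decide) P hP
    (fun i => ?_) ?_
  · rcases klingenMult_ne_zero hp with h | h | h | h | h | h | h
    exacts [⟨0, h⟩, ⟨1, h⟩, ⟨2, h⟩, ⟨3, h⟩, ⟨4, h⟩, ⟨5, h⟩, ⟨6, h⟩]
  · fin_cases i
    · refine fam 0 1 1 _ 48 (by decide) (h.inv.trans m0.symm) fun w hw => ?_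
      exact ((hsh 0).indComponent_symmetrizer (hP 0) hσ 1 1 ![8, 8, 8, 8, 8, 8]
        (by decide +kernel) w).trans (sum_word_of_inv hw _ (by decide))
    -- Without the shift the coefficients sum to zero over `H`, as (0 5) is both a column
    -- transposition of this tableau and an element of `H`.
    · refine fam 1 1 (Equiv.swap 3 5) _ (-12) (by decide) (h.inv.trans m1.symm) fun w hw => ?_
      exact ((hsh 1).indComponent_symmetrizer (hP 1) hσ 1 (Equiv.swap 3 5)
        ![-2, -2, -2, -2, -2, -2] (by decide +kernel) w).trans (sum_word_of_inv hw _ (by decide))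
    · refine fam 2 1 (Equiv.swap 2 4 * Equiv.swap 3 5) _ 8 (by decide) (h.fix.trans m2.symm)
        fun w hw => ?_
      exact ((hsh 2).indComponent_symmetrizer (hP 2) hσ 1 (Equiv.swap 2 4 * Equiv.swap 3 5)
        ![4, 4, 0, 0, 0, 0] (by decide +kernel) w).trans
        (sum_word_of_fix hw _ (by decide) (by decide) (by decide))
    · refine fam 3 1 1 _ 6 (by decide) (h.std.trans m3.symm) fun w hw => ?_
      exact ((hsh 3).indComponent_symmetrizer (hP 3) hσ 1 1 ![2, 2, 0, 0, -2, -2]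
        (by decide +kernel) w).trans (sum_word_of_std hw _ (by decide) (by decide))
    · refine fam 4 1 1 _ 24 (by decide) (h.std.trans m4.symm) fun w hw => ?_
      exact ((hsh 4).indComponent_symmetrizer (hP 4) hσ 1 1 ![8, 8, -8, -8, 0, 0]
        (by decide +kernel) w).trans (sum_word_of_std hw _ (by decide) (by decide))
    · refine fam 5 (Equiv.swap 1 3) 1 _ 12 (by decide) (h.sgn.trans m5.symm) fun w hw => ?_
      exact ((hsh 5).indComponent_symmetrizer (hP 5) hσ (Equiv.swap 1 3) 1
        ![2, -2, -2, 2, 2, -2] (by decide +kernel) w).trans (sum_word_of_sgn hw _ (by decide))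
    · refine fam 6 (Equiv.swap 1 2) (Equiv.swap 1 2) _ 24 (by decide) (h.sgn.trans m6.symm)
        fun w hw => ?_
      exact ((hsh 6).indComponent_symmetrizer (hP 6) hσ (Equiv.swap 1 2) (Equiv.swap 1 2)
        ![4, -4, -4, 4, 4, -4] (by decide +kernel) w).trans (sum_word_of_sgn hw _ (by decide))
  -- Both sides are 45 d₁ + 30 d₂ + 15 d₄: the index 15 times 3 d₁ + 2 d₂ + d₄ on the left, and
  -- multiplicities times the dimensions 1, 5, 9, 16, 5, 10, 5 on the right.
  · refine (finrank_ind_le σ).trans ?_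
    rw [Fin.sum_univ_seven, m0, m1, m2, m3, m4, m5, m6, index_of_stabPair hσ.mem,
      finrank_irrep_eq (hsh 0) (hP 0) (d := 1) (by decide),
      finrank_irrep_eq (hsh 1) (hP 1) (d := 5) (by decide),
      finrank_irrep_eq (hsh 2) (hP 2) (d := 9) (by decide),
      finrank_irrep_eq (hsh 3) (hP 3) (d := 16) (by decide),
      finrank_irrep_eq (hsh 4) (hP 4) (d := 5) (by decide),
      finrank_irrep_eq (hsh 5) (hP 5) (d := 10) (by decide),
      finrank_irrep_eq (hsh 6) (hP 6) (d := 5) (by decide), h.total]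
    omega

end SymmetricSix

end

end LevelTwo

namespace LevelTwo

noncomputable section

/-! ### The identifications with symmetric groups -/

section PermutationAction

/-- The permutation representation on a finite invariant family. -/
theorem exists_perm_hom {G X : Type*} [Group G] {n : ℕ} (a : G → X → X) (h1 : ∀ x, a 1 x = x)
    (hmul : ∀ g h x, a (g * h) x = a g (a h x)) (v : Fin n → X) (hv : Function.Injective v)
    (h : ∀ g i, ∃ j, v j = a g (v i)) :
    ∃ φ : G →* Equiv.Perm (Fin n), ∀ g i, v (φ g i) = a g (v i) := by
  choose f hf using h
  let F : G →* Function.End (Fin n) :=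
    { toFun := f
      map_one' := funext fun i => hv (by rw [hf, h1]; rfl)
      map_mul' := fun g h => funext fun i => hv (by
        rw [hf, hmul]
        change _ = v (f g (f h i))
        rw [hf, hf]) }
  exact ⟨F.toHomPerm, hf⟩

end PermutationAction

/-! ### S₃ as the permutations of the nonzero vectors of 𝔽₂² -/

section SpecialLinear

/-- The lower triangular unipotent matrix. -/
def lowerUnipotent : SL(2, ℤ) := ⟨!![1, 0; 1, 1], by decide⟩

theorem mem_Gamma_two (γ : SL(2, ℤ)) : γ ∈ Γ(2) ↔ γ.1.map (Int.cast : ℤ → ZMod 2) = 1 := by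
  rw [CongruenceSubgroup.Gamma_mem']
  constructor
  · intro h
    exact congrArg Subtype.val h
  · intro h
    exact Subtype.ext h

theorem map_mul_two {ι : Type*} [Fintype ι] [DecidableEq ι] (A B : Matrix ι ι ℤ) :
    (A * B).map (Int.cast : ℤ → ZMod 2) = A.map (Int.cast : ℤ → ZMod 2) * B.map (Int.cast : ℤ → ZMod 2) :=
  Matrix.map_mul (f := Int.castRingHom (ZMod 2))

/-- SL(2, ℤ) permutes the three nonzero vectors modulo 2. They are listed so that `T` gives the
transposition (0 1). A matrix that fixes the two basis vectors is the identity modulo 2, which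
determines the kernel. -/
theorem exists_isS3Identification : ∃ φ, IsS3Identification φ := by
  let v : Fin 3 → (Fin 2 → ZMod 2) := ![![0, 1], ![1, 1], ![1, 0]]
  have hv : Function.Injective v := by decide
  have hne : ∀ x : Fin 2 → ZMod 2, x ≠ 0 → ∃ j, v j = x := by decide
  have hv0 : ∀ i, v i ≠ 0 := by decide
  let a : SL(2, ℤ) → (Fin 2 → ZMod 2) → (Fin 2 → ZMod 2) :=
    fun γ x => (γ.1.map (Int.cast : ℤ → ZMod 2)).mulVec x
  have ha1 : ∀ x, a 1 x = x := fun x => by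
    change ((1 : Matrix (Fin 2) (Fin 2) ℤ).map (Int.cast : ℤ → ZMod 2)).mulVec x = x
    rw [Matrix.map_one _ Int.cast_zero Int.cast_one, Matrix.one_mulVec]
  have hamul : ∀ g h x, a (g * h) x = a g (a h x) := fun g h x => by
    change ((g.1 * h.1).map (Int.cast : ℤ → ZMod 2)).mulVec x = _
    rw [map_mul_two, ← Matrix.mulVec_mulVec]
  obtain ⟨φ, hφ⟩ := exists_perm_hom a ha1 hamul v hv fun g i => hne _ fun h0 => hv0 i (by
    have := hamul g⁻¹ g (v i)
    rw [h0, inv_mul_cancel, ha1] at this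
    rw [this]
    exact Matrix.mulVec_zero _)
  refine ⟨φ, fun g => ?_, ?_⟩
  · have hT : φ ModularGroup.T = Equiv.swap 0 1 := Equiv.ext fun i => hv (by
      rw [hφ]; revert i; decide)
    -- Modulo 2 this product exchanges the two basis vectors.
    have hL : φ (lowerUnipotent * ModularGroup.T * lowerUnipotent) = Equiv.swap 0 2 :=
      Equiv.ext fun i => hv (by rw [hφ]; revert i; decide)
    obtain ⟨i, rfl⟩ := word_three_surjective g
    rw [← hT, ← hL, ← map_word]
    exact ⟨_, rfl⟩
  · ext γ
    rw [MonoidHom.mem_ker, mem_Gamma_two]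
    constructor
    · intro h
      have h2 : ∀ i, a γ (v i) = v i := fun i => by rw [← hφ, h]; rfl
      have e0 := h2 0
      have e2 := h2 2
      ext i j
      have e0' := congrFun e0 i
      have e2' := congrFun e2 i
      simp only [a, v, Matrix.mulVec, dotProduct, Fin.sum_univ_two] at e0' e2'
      fin_cases j
      · fin_cases i <;> simpa using e2'
      · fin_cases i <;> simpa using e0'
    · intro h
      refine Equiv.ext fun i => hv ?_
      rw [hφ]
      change (γ.1.map (Int.cast : ℤ → ZMod 2)).mulVec _ = _
      rw [h, Matrix.one_mulVec]
      rfl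

end SpecialLinear

/-! ### Sp(4, 𝔽₂) acting on the six odd quadratic forms -/

section Symplectic

/-- Reduction modulo `2`. -/
def siegelMod (γ : Sp4Z) : Matrix (Fin 2 ⊕ Fin 2) (Fin 2 ⊕ Fin 2) (ZMod 2) :=
  γ.1.map (Int.cast : ℤ → ZMod 2)

theorem siegelMod_mul (γ δ : Sp4Z) : siegelMod (γ * δ) = siegelMod γ * siegelMod δ :=
  map_mul_two _ _

theorem siegelMod_one : siegelMod 1 = 1 := Matrix.map_one _ Int.cast_zero Int.cast_one

theorem mem_siegelGamma2 (γ : Sp4Z) : γ ∈ siegelGamma2 ↔ siegelMod γ = 1 := Iff.rfl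

theorem eq_of_siegelMod_eq {G : Type*} [Group G] {φ : Sp4Z →* G} (hφ : φ.ker = siegelGamma2)
    {γ δ : Sp4Z} (h : siegelMod γ = siegelMod δ) : φ γ = φ δ := by
  rw [← mul_inv_eq_one, ← map_inv, ← map_mul, ← MonoidHom.mem_ker, hφ, mem_siegelGamma2,
    siegelMod_mul, h, ← siegelMod_mul, mul_inv_cancel, siegelMod_one]

/-- The symplectic form modulo `2`. -/
def formMod (x y : Fin 2 ⊕ Fin 2 → ZMod 2) : ZMod 2 :=
  x ⬝ᵥ (Matrix.J (Fin 2) (ZMod 2)).mulVec y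

theorem formMod_mulVec (γ : Sp4Z) (x y : Fin 2 ⊕ Fin 2 → ZMod 2) :
    formMod ((siegelMod γ).mulVec x) ((siegelMod γ).mulVec y) = formMod x y := by
  have h := SymplecticGroup.mem_iff'.mp γ.2
  have h2 := congrArg (fun A => A.map (Int.cast : ℤ → ZMod 2)) h
  simp only [map_mul_two, Matrix.transpose_map] at h2
  have hJ : (Matrix.J (Fin 2) ℤ).map (Int.cast : ℤ → ZMod 2) = Matrix.J (Fin 2) (ZMod 2) := by
    decide
  rw [hJ] at h2
  rw [formMod, formMod, Matrix.mulVec_mulVec, ← Matrix.vecMul_transpose,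
    ← Matrix.dotProduct_mulVec, Matrix.mulVec_mulVec, ← Matrix.mul_assoc]
  exact congrArg (fun A => x ⬝ᵥ Matrix.mulVec A y) h2

/-- The quadratic form with given values on the standard basis, and the symplectic form as its
polar form. -/
def quadForm (b : Fin 2 ⊕ Fin 2 → ZMod 2) (x : Fin 2 ⊕ Fin 2 → ZMod 2) : ZMod 2 :=
  b (Sum.inl 0) * x (Sum.inl 0) + b (Sum.inl 1) * x (Sum.inl 1) + b (Sum.inr 0) * x (Sum.inr 0)
    + b (Sum.inr 1) * x (Sum.inr 1) + x (Sum.inl 0) * x (Sum.inr 0)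
    + x (Sum.inl 1) * x (Sum.inr 1)

/-- `q` is a quadratic form with the symplectic form as its polar form. -/
def IsPolar (q : (Fin 2 ⊕ Fin 2 → ZMod 2) → ZMod 2) : Prop :=
  ∀ x y, q (x + y) = q x + q y + formMod x y

theorem formMod_eq (x y : Fin 2 ⊕ Fin 2 → ZMod 2) :
    formMod x y = x (Sum.inl 0) * y (Sum.inr 0) + x (Sum.inl 1) * y (Sum.inr 1)
      + x (Sum.inr 0) * y (Sum.inl 0) + x (Sum.inr 1) * y (Sum.inl 1) := by
  simp [formMod, dotProduct, Matrix.mulVec, Matrix.J, Fin.sum_univ_two, Matrix.one_apply]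
  ring_nf

theorem isPolar_quadForm (b : Fin 2 ⊕ Fin 2 → ZMod 2) : IsPolar (quadForm b) := by
  intro x y
  rw [formMod_eq]
  simp only [quadForm, Pi.add_apply]
  ring

/-- The polar form and the values on a basis determine a quadratic form. This leaves sixteen
candidates, which can be enumerated. -/
theorem IsPolar.eq_quadForm {q : (Fin 2 ⊕ Fin 2 → ZMod 2) → ZMod 2} (h : IsPolar q) :
    q = quadForm fun i => q (Pi.single i 1) := by
  have h0 : q 0 = 0 := by
    have := h 0 0
    rw [add_zero, formMod_eq] at this
    simpa using this
  have hsmul : ∀ (i) (c : ZMod 2), q (Pi.single i c) = q (Pi.single i 1) * c := by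
    intro i c
    have : c = 0 ∨ c = 1 := by revert c; decide
    rcases this with rfl | rfl
    · rw [Pi.single_zero, h0, mul_zero]
    · rw [mul_one]
  funext x
  have hx : x = Pi.single (Sum.inl 0) (x (Sum.inl 0)) + Pi.single (Sum.inl 1) (x (Sum.inl 1))
      + Pi.single (Sum.inr 0) (x (Sum.inr 0)) + Pi.single (Sum.inr 1) (x (Sum.inr 1)) := by
    funext i
    rcases i with i | i <;> fin_cases i <;> simp
  conv_lhs => rw [hx]
  rw [h, h, h, hsmul _ (x (Sum.inl 0)), hsmul _ (x (Sum.inl 1)), hsmul _ (x (Sum.inr 0)),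
    hsmul _ (x (Sum.inr 1))]
  simp only [formMod_eq, quadForm]
  simp
  ring

/-- The six forms with six zeros. -/
def oddForm : Fin 6 → (Fin 2 ⊕ Fin 2 → ZMod 2) → ZMod 2 :=
  fun i => quadForm (Sum.elim ((![![0, 1], ![0, 1], ![1, 0], ![1, 0], ![1, 1], ![1, 1]] :
    Fin 6 → Fin 2 → ZMod 2) i)
    ((![![0, 1], ![1, 1], ![1, 0], ![1, 1], ![0, 1], ![1, 0]] : Fin 6 → Fin 2 → ZMod 2) i))

theorem oddForm_injective : Function.Injective oddForm := by
  decide +kernel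

theorem card_oddForm : ∀ i, (Finset.univ.filter fun x => oddForm i x = 0).card = 6 := by
  decide +kernel

theorem exists_oddForm : ∀ b : Fin 2 ⊕ Fin 2 → ZMod 2,
    (Finset.univ.filter fun x => quadForm b x = 0).card = 6 → ∃ i, oddForm i = quadForm b := by
  decide +kernel

theorem oddForm_separates : ∀ x y : Fin 2 ⊕ Fin 2 → ZMod 2,
    (∀ i, oddForm i x = oddForm i y) → x = y := by
  decide +kernel

/-- The action of the symplectic group on the functions modulo `2`. -/
def formAct (γ : Sp4Z) (q : (Fin 2 ⊕ Fin 2 → ZMod 2) → ZMod 2) :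
    (Fin 2 ⊕ Fin 2 → ZMod 2) → ZMod 2 := fun x => q ((siegelMod γ⁻¹).mulVec x)

theorem siegelMod_mulVec_inv (γ : Sp4Z) (x : Fin 2 ⊕ Fin 2 → ZMod 2) :
    (siegelMod γ).mulVec ((siegelMod γ⁻¹).mulVec x) = x := by
  rw [Matrix.mulVec_mulVec, ← siegelMod_mul, mul_inv_cancel, siegelMod_one, Matrix.one_mulVec]

/-- A symplectic change of variables keeps the polar form and the number of zeros, and having six
zeros singles out the odd forms. -/
theorem exists_formAct (γ : Sp4Z) (i : Fin 6) : ∃ j, oddForm j = formAct γ (oddForm i) := by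
  have hp : IsPolar (formAct γ (oddForm i)) := fun x y => by
    change oddForm i _ = oddForm i _ + oddForm i _ + _
    rw [Matrix.mulVec_add, ← formMod_mulVec γ⁻¹ x y]
    exact isPolar_quadForm _ _ _
  rw [hp.eq_quadForm]
  refine exists_oddForm _ ?_
  rw [← hp.eq_quadForm, ← card_oddForm i]
  refine Finset.card_bij' (fun x _ => (siegelMod γ⁻¹).mulVec x)
    (fun x _ => (siegelMod γ).mulVec x) ?_ ?_ ?_ ?_
  · intro x hx
    exact Finset.mem_filter.mpr ⟨Finset.mem_univ _, (Finset.mem_filter.mp hx).2⟩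
  · intro x hx
    have := siegelMod_mulVec_inv γ⁻¹ x
    rw [inv_inv] at this
    refine Finset.mem_filter.mpr ⟨Finset.mem_univ _, ?_⟩
    rw [formAct, this]
    exact (Finset.mem_filter.mp hx).2
  · intro x _
    exact siegelMod_mulVec_inv γ x
  · intro x _
    have := siegelMod_mulVec_inv γ⁻¹ x
    rwa [inv_inv] at this

theorem closure_swap_finRotate :
    Subgroup.closure {Equiv.swap (0 : Fin 6) 1, finRotate 6} = ⊤ := by
  have h := Equiv.Perm.closure_cycle_adjacent_swap (σ := finRotate 6) isCycle_finRotate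
    support_finRotate 0
  have e : (finRotate 6) 0 = 1 := by decide
  rw [e, Set.pair_comm] at h
  exact h

theorem IsS6Identification.closure_le {φ : Sp4Z →* Equiv.Perm (Fin 6)}
    (hT : φ matTransposition = Equiv.swap 0 1) (hC : φ matCycle = finRotate 6)
    (g : Equiv.Perm (Fin 6)) :
    ∃ s ∈ Subgroup.closure {matTransposition, matCycle}, φ s = g := by
  have : (Subgroup.closure {matTransposition, matCycle}).map φ = ⊤ := by
    rw [MonoidHom.map_closure, Set.image_pair, hT, hC, closure_swap_finRotate]
  have hg : g ∈ (Subgroup.closure {matTransposition, matCycle}).map φ := by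
    rw [this]; trivial
  exact hg

/-- The numbering of the odd forms is arranged so that the two given matrices act as (0 1) and as
the cycle, and these generate S₆. The kernel is Γ[2] because the six forms together separate the
vectors modulo 2. -/
theorem exists_isS6Identification : ∃ φ, IsS6Identification φ := by
  obtain ⟨φ, hφ⟩ := exists_perm_hom formAct (fun q => by
      funext x
      rw [formAct, inv_one, siegelMod_one, Matrix.one_mulVec])
    (fun g h q => by
      funext x
      simp only [formAct]
      rw [mul_inv_rev, siegelMod_mul, Matrix.mulVec_mulVec])
    oddForm oddForm_injective exists_formAct
  have hT : φ matTransposition = Equiv.swap 0 1 := Equiv.ext fun i => oddForm_injective (by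
    rw [hφ]; revert i; decide +kernel)
  have hC : φ matCycle = finRotate 6 := Equiv.ext fun i => oddForm_injective (by
    rw [hφ]; revert i; decide +kernel)
  refine ⟨φ, fun g => ?_, ?_, hT, hC⟩
  · obtain ⟨s, -, hs⟩ := IsS6Identification.closure_le hT hC g
    exact ⟨s, hs⟩
  · ext γ
    rw [MonoidHom.mem_ker, mem_siegelGamma2]
    constructor
    · intro h
      have h2 : ∀ x, (siegelMod γ⁻¹).mulVec x = x := fun x => oddForm_separates _ _ fun i => by
        have := hφ γ i
        rw [h] at this
        exact (congrFun this x).symm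
      refine Matrix.ext_of_mulVec_single fun i => ?_
      have := siegelMod_mulVec_inv γ (Pi.single i 1)
      rw [h2] at this
      rw [this, Matrix.one_mulVec]
    · intro h
      have h' : siegelMod γ⁻¹ = 1 := by
        have := siegelMod_mul γ γ⁻¹
        rw [h, mul_inv_cancel, siegelMod_one, one_mul] at this
        exact this.symm
      refine Equiv.ext fun i => oddForm_injective ?_
      rw [hφ]
      funext x
      rw [formAct, h', Matrix.one_mulVec]
      rfl

/-- Every `γ` differs by an element of the common kernel from a word in the two prescribed matrices,
and on such words two identifications agree. -/
theorem existsUnique_isS6Identification : ∃! φ, IsS6Identification φ := by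
  obtain ⟨φ, hφ⟩ := exists_isS6Identification
  refine ⟨φ, hφ, fun ψ hψ => MonoidHom.ext fun γ => ?_⟩
  obtain ⟨s, hs, hs'⟩ := IsS6Identification.closure_le hφ.2.2.1 hφ.2.2.2 (φ γ)
  have h1 : ψ γ = ψ s := by
    rw [← mul_inv_eq_one, ← map_inv, ← map_mul, ← MonoidHom.mem_ker, hψ.2.1, ← hφ.2.1,
      MonoidHom.mem_ker, map_mul, map_inv, hs', mul_inv_cancel]
  have h2 : ψ s = φ s := by
    have : Set.EqOn ψ φ (Subgroup.closure {matTransposition, matCycle}) := by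
      refine MonoidHom.eqOn_closure ?_
      rintro x (rfl | rfl)
      · rw [hψ.2.2.1, hφ.2.2.1]
      · rw [hψ.2.2.2, hφ.2.2.2]
    exact this hs
  rw [h1, h2, hs']

end Symplectic

end

end LevelTwo

namespace LevelTwo

noncomputable section

/-! ### The image of the Klingen parabolic subgroup -/

section KlingenImage

/-- The transvection of the second basis vector. -/
def transvection₂ : Sp4Z :=
  ⟨Matrix.fromBlocks 1 !![0, 0; 0, 1] 0 1, by rw [SymplecticGroup.mem_iff]; decide⟩

/-- The transvection of `e₁ + e₂`. -/
def transvection₁₂ : Sp4Z :=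
  ⟨Matrix.fromBlocks 1 !![1, 1; 1, 1] 0 1, by rw [SymplecticGroup.mem_iff]; decide⟩

/-- The inverse of the transvection of the third basis vector. -/
def transvection₃ : Sp4Z :=
  ⟨Matrix.fromBlocks 1 0 !![1, 0; 0, 0] 1, by rw [SymplecticGroup.mem_iff]; decide⟩

/-- The inverse of the transvection of `e₂ + e₃`. -/
def transvection₂₃ : Sp4Z :=
  ⟨Matrix.fromBlocks !![1, 0; 1, 1] !![0, 0; 0, -1] !![1, 0; 0, 0] !![1, -1; 0, 1], by
    rw [SymplecticGroup.mem_iff]; decide⟩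

theorem mem_klingen (γ : Sp4Z) : γ ∈ klingen ↔
    γ.1.mulVec klingenVec = klingenVec ∨ γ.1.mulVec klingenVec = -klingenVec := Iff.rfl

theorem matTransposition_mem : matTransposition ∈ klingen := (mem_klingen _).mpr (by decide)
theorem transvection₂_mem : transvection₂ ∈ klingen := (mem_klingen _).mpr (by decide)
theorem transvection₁₂_mem : transvection₁₂ ∈ klingen := (mem_klingen _).mpr (by decide)
theorem transvection₃_mem : transvection₃ ∈ klingen := (mem_klingen _).mpr (by decide)
theorem transvection₂₃_mem : transvection₂₃ ∈ klingen := (mem_klingen _).mpr (by decide)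

theorem klingenBlock_matTransposition :
    klingenBlock ⟨matTransposition, matTransposition_mem⟩ = ModularGroup.T :=
  Subtype.ext (by decide)
theorem klingenBlock_transvection₂ :
    klingenBlock ⟨transvection₂, transvection₂_mem⟩ = 1 := Subtype.ext (by decide)
theorem klingenBlock_transvection₁₂ :
    klingenBlock ⟨transvection₁₂, transvection₁₂_mem⟩ = ModularGroup.T := Subtype.ext (by decide)
theorem klingenBlock_transvection₃ :
    klingenBlock ⟨transvection₃, transvection₃_mem⟩ = lowerUnipotent := Subtype.ext (by decide)
theorem klingenBlock_transvection₂₃ :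
    klingenBlock ⟨transvection₂₃, transvection₂₃_mem⟩ = lowerUnipotent := Subtype.ext (by decide)

variable {φ : Sp4Z →* Equiv.Perm (Fin 6)}

/-- It is applied with `ε = δ * matTransposition`, where `γ` is congruent to the conjugate of
`matTransposition` by `δ`. In this form no inverse has to be evaluated, and `φ γ` is the conjugated
transposition. -/
theorem IsS6Identification.apply_eq (hφ : IsS6Identification φ) {γ δ ε : Sp4Z}
    (h : siegelMod (γ * δ) = siegelMod ε) {x : Equiv.Perm (Fin 6)} (hx : x * φ δ = φ ε) :
    φ γ = x := by
  have := eq_of_siegelMod_eq hφ.2.1 h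
  rw [map_mul, ← hx] at this
  exact mul_right_cancel this

theorem IsS6Identification.transvection₂ (hφ : IsS6Identification φ) :
    φ transvection₂ = Equiv.swap 2 3 := by
  refine hφ.apply_eq (δ := matCycle ^ 2) (ε := matCycle ^ 2 * matTransposition)
    (by decide +kernel) ?_
  rw [map_mul, map_pow, hφ.2.2.1, hφ.2.2.2]
  decide +kernel

theorem IsS6Identification.transvection₁₂ (hφ : IsS6Identification φ) :
    φ transvection₁₂ = Equiv.swap 4 5 := by
  refine hφ.apply_eq (δ := matCycle ^ 4) (ε := matCycle ^ 4 * matTransposition)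
    (by decide +kernel) ?_
  rw [map_mul, map_pow, hφ.2.2.1, hφ.2.2.2]
  decide +kernel

theorem IsS6Identification.transvection₃ (hφ : IsS6Identification φ) :
    φ transvection₃ = Equiv.swap 0 4 := by
  refine hφ.apply_eq (δ := LevelTwo.transvection₁₂ * matCycle ^ 5)
    (ε := LevelTwo.transvection₁₂ * matCycle ^ 5 * matTransposition) (by decide +kernel) ?_
  simp only [map_mul, map_pow, hφ.2.2.1, hφ.2.2.2, hφ.transvection₁₂]
  decide +kernel

theorem IsS6Identification.transvection₂₃ (hφ : IsS6Identification φ) :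
    φ transvection₂₃ = Equiv.swap 1 5 := by
  refine hφ.apply_eq (δ := matTransposition * matCycle ^ 5)
    (ε := matTransposition * matCycle ^ 5 * matTransposition) (by decide +kernel) ?_
  simp only [map_mul, map_pow, hφ.2.2.1, hφ.2.2.2]
  decide +kernel

theorem stabPair_of_commute : ∀ g : Equiv.Perm (Fin 6),
    g * Equiv.swap 2 3 = Equiv.swap 2 3 * g → stabPair g := by
  decide +kernel

/-- Conjugating a transvection by `γ` gives the transvection of the image vector, and `γ` fixes the
second basis vector modulo 2. This is what places the image of the parabolic in the centraliser of
(2 3). -/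
theorem siegelMod_commute {γ : Sp4Z} (h : γ ∈ klingen) :
    siegelMod (γ * LevelTwo.transvection₂) = siegelMod (LevelTwo.transvection₂ * γ) := by
  have c : ∀ i, i ≠ Sum.inl 1 → siegelMod γ i (Sum.inl 1) = 0 := fun i hi => by
    change ((γ.1 i (Sum.inl 1) : ℤ) : ZMod 2) = 0
    rw [klingen_col ⟨γ, h⟩ i hi, Int.cast_zero]
  have r : ∀ j, j ≠ Sum.inr 1 → siegelMod γ (Sum.inr 1) j = 0 := fun j hj => by
    change ((γ.1 (Sum.inr 1) j : ℤ) : ZMod 2) = 0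
    rw [klingen_row ⟨γ, h⟩ j hj, Int.cast_zero]
  have hn : ∀ x : ZMod 2, x ≠ 0 → x = 1 := by decide
  have hdet : ∀ {i j}, (∀ l, l ≠ j → siegelMod γ i l = 0) → siegelMod γ i j = 1 := by
    intro i j hz
    refine hn _ fun h0 => ?_
    have := siegelMod_mul γ γ⁻¹
    rw [mul_inv_cancel, siegelMod_one] at this
    have := congrFun (congrFun this i) i
    rw [Matrix.one_apply_eq, Matrix.mul_apply, Finset.sum_eq_zero] at this
    · exact one_ne_zero this
    · intro l _
      by_cases hl : l = j
      · rw [hl, h0, zero_mul]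
      · rw [hz l hl, zero_mul]
  have hdet' : siegelMod γ (Sum.inl 1) (Sum.inl 1) = 1 := by
    refine hn _ fun h0 => ?_
    have := siegelMod_mul γ⁻¹ γ
    rw [inv_mul_cancel, siegelMod_one] at this
    have := congrFun (congrFun this (Sum.inl 1)) (Sum.inl 1)
    rw [Matrix.one_apply_eq, Matrix.mul_apply, Finset.sum_eq_zero] at this
    · exact one_ne_zero this
    · intro l _
      by_cases hl : l = Sum.inl 1
      · rw [hl, h0, mul_zero]
      · rw [c l hl, mul_zero]
  have hr := hdet (i := Sum.inr 1) (j := Sum.inr 1) r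
  have ht : siegelMod LevelTwo.transvection₂ = 1 + Matrix.single (Sum.inl 1) (Sum.inr 1) 1 := by
    decide +kernel
  rw [siegelMod_mul, siegelMod_mul, ht, mul_add, add_mul, mul_one, one_mul]
  congr 1
  ext i j
  rw [Matrix.mul_apply, Matrix.mul_apply, Finset.sum_eq_single (Sum.inl 1),
    Finset.sum_eq_single (Sum.inr 1)]
  · by_cases hi : i = Sum.inl 1
    · subst hi
      by_cases hj : j = Sum.inr 1
      · subst hj; rw [hdet', hr, mul_comm]
      · rw [r j hj, mul_zero, Matrix.single_apply_of_col_ne _ _ (Ne.symm hj), mul_zero]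
    · rw [c i hi, zero_mul, Matrix.single_apply_of_row_ne _ _ _ _, zero_mul]
      exact Ne.symm hi
  · intro l _ hl
    rw [Matrix.single_apply_of_col_ne _ _ (Ne.symm hl), zero_mul]
  · simp
  · intro l _ hl
    rw [Matrix.single_apply_of_row_ne _ _ _ _, mul_zero]
    exact Ne.symm hl
  · simp

theorem IsS6Identification.stabPair (hφ : IsS6Identification φ) {γ : Sp4Z} (h : γ ∈ klingen) :
    stabPair (φ γ) := by
  refine stabPair_of_commute _ ?_
  rw [← hφ.transvection₂, ← map_mul, ← map_mul]
  exact eq_of_siegelMod_eq hφ.2.1 (siegelMod_commute h)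

/-- One inclusion is the commutation with `transvection₂`. For the other, five transvections in the
parabolic map to (0 1), (2 3), (4 5), (0 4), (1 5), and the stabiliser of the pair consists of words
in these. -/
theorem IsS6Identification.mem_map_klingen (hφ : IsS6Identification φ)
    (g : Equiv.Perm (Fin 6)) : g ∈ klingen.map φ ↔ LevelTwo.stabPair g := by
  constructor
  · rintro ⟨γ, hγ, rfl⟩
    exact hφ.stabPair hγ
  · intro h
    obtain ⟨⟨i, j⟩, rfl⟩ := exists_centralizerWord g h
    have m01 : Equiv.swap 0 1 ∈ klingen.map φ := ⟨_, matTransposition_mem, hφ.2.2.1⟩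
    have m23 : Equiv.swap 2 3 ∈ klingen.map φ := ⟨_, transvection₂_mem, hφ.transvection₂⟩
    have m45 : Equiv.swap 4 5 ∈ klingen.map φ := ⟨_, transvection₁₂_mem, hφ.transvection₁₂⟩
    have m04 : Equiv.swap 0 4 ∈ klingen.map φ := ⟨_, transvection₃_mem, hφ.transvection₃⟩
    have m15 : Equiv.swap 1 5 ∈ klingen.map φ := ⟨_, transvection₂₃_mem, hφ.transvection₂₃⟩
    have ma := mul_mem m01 m45
    have mb := mul_mem m04 m15
    have mab := mul_mem ma mb
    have mw := mul_mem m01 m04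
    refine mul_mem ?_ ?_
    · fin_cases j
      exacts [one_mem _, ma, mb, mab, m23, mul_mem m23 ma, mul_mem m23 mb, mul_mem m23 mab]
    · fin_cases i
      exacts [one_mem _, m01, m04, mw, mul_mem m04 m01, mul_mem mw m01]

theorem cuspRep_eq_one {k : ℤ} {γ : SL(2, ℤ)} (h : γ ∈ Γ(2)) : cuspRep k γ = 1 := by
  ext f : 1
  refine DFunLike.coe_injective ?_
  exact SlashInvariantFormClass.slash_action_eq f (Matrix.SpecialLinearGroup.mapGL ℝ γ⁻¹)
    ⟨_, inv_mem h, rfl⟩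

theorem klingenBlock_mem_Gamma {γ : klingen} (h : γ.1 ∈ siegelGamma2) :
    klingenBlock γ ∈ Γ(2) := by
  rw [mem_siegelGamma2] at h
  rw [mem_Gamma_two]
  ext i j
  have e : ∀ a b, ((γ.1.1 a b : ℤ) : ZMod 2) = (1 : Matrix _ _ (ZMod 2)) a b := fun a b =>
    congrFun (congrFun h a) b
  fin_cases i <;> fin_cases j
  exacts [e (Sum.inl 0) (Sum.inl 0), e (Sum.inl 0) (Sum.inr 0), e (Sum.inr 0) (Sum.inl 0),
    e (Sum.inr 0) (Sum.inr 0)]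

theorem cuspRep_T_sq (k : ℤ) : cuspRep k ModularGroup.T * cuspRep k ModularGroup.T = 1 := by
  rw [← map_mul]
  exact cuspRep_eq_one ((mem_Gamma_two _).mpr (by decide))

theorem cuspRep_lower_sq (k : ℤ) : cuspRep k lowerUnipotent * cuspRep k lowerUnipotent = 1 := by
  rw [← map_mul]
  exact cuspRep_eq_one ((mem_Gamma_two _).mpr (by decide))

/-- The action of the Klingen parabolic on elliptic cusp forms factors through its image. -/
theorem IsS6Identification.exists_klingen_rep (hφ : IsS6Identification φ) (k : ℤ) :
    ∃ σ : Representation ℂ (klingen.map φ) (CuspForm Γ(2) k), ∀ p : klingen,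
      σ ⟨φ p.1, Subgroup.mem_map_of_mem φ p.2⟩ = cuspRep k (klingenBlock p) := by
  refine exists_comp_eq (φ.subgroupMap klingen) (φ.subgroupMap_surjective klingen)
    ((cuspRep k).comp klingenBlock) fun γ hγ => cuspRep_eq_one (klingenBlock_mem_Gamma ?_)
  rw [← hφ.2.1, MonoidHom.mem_ker]
  exact congrArg Subtype.val (MonoidHom.mem_ker.mp hγ)

/-- The transvections of `e₁` and `e₁ + e₂` have the same block in SL(2, ℤ), and so do the inverse
transvections of `e₃` and `e₂ + e₃`, while that of `e₂` has trivial block. This is the map S₂ × S₄ →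
S₃ seen on generators. -/
theorem IsS6Identification.isInflated (hφ : IsS6Identification φ) {k : ℤ}
    {σ : Representation ℂ (klingen.map φ) (CuspForm Γ(2) k)}
    (hσ : ∀ p : klingen,
      σ ⟨φ p.1, Subgroup.mem_map_of_mem φ p.2⟩ = cuspRep k (klingenBlock p)) :
    IsInflated σ (cuspRep k ModularGroup.T) (cuspRep k lowerUnipotent) := by
  have key : ∀ (γ : Sp4Z) (h : γ ∈ klingen) (g : Equiv.Perm (Fin 6)) (x : SL(2, ℤ)), φ γ = g →
      klingenBlock ⟨γ, h⟩ = x → extendZero σ g = cuspRep k x := by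
    rintro γ h g x rfl rfl
    rw [extendZero_mem σ (Subgroup.mem_map_of_mem φ h)]
    exact hσ ⟨γ, h⟩
  refine ⟨hφ.mem_map_klingen, ?_, ?_, ?_, ?_, ?_, cuspRep_T_sq k, cuspRep_lower_sq k⟩
  · exact key _ _ _ _ hφ.2.2.1 klingenBlock_matTransposition
  · exact key _ _ _ _ hφ.transvection₁₂ klingenBlock_transvection₁₂
  · exact key _ _ _ _ hφ.transvection₃ klingenBlock_transvection₃
  · exact key _ _ _ _ hφ.transvection₂₃ klingenBlock_transvection₂₃
  · rw [key _ _ _ _ hφ.transvection₂ klingenBlock_transvection₂, map_one]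

end KlingenImage

end

end LevelTwo

namespace LevelTwo

noncomputable section

/-! ### The decomposition of the space of elliptic cusp forms -/

section EllipticDecomposition

theorem exists_conj_swap : ∀ x y : Equiv.Perm (Fin 3),
    x * x = 1 ∧ y * y = 1 ∧ x ≠ 1 ∧ y ≠ 1 ∧ x ≠ y → ∃ g, g * x * g⁻¹ = Equiv.swap 0 1 ∧ g * y * g⁻¹ = Equiv.swap 0 2 := by
  decide +kernel

/-- An inner automorphism of the symmetric group does not change the isomorphism class of a
representation; the operator of `g⁻¹` is the intertwiner. -/
theorem hasDecomposition_conj {n : ℕ} {G V : Type*} [Group G] [AddCommGroup V] [Module ℂ V]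
    {ρ : Representation ℂ G V} {φ ψ : G →* Equiv.Perm (Fin n)} {m : n.Partition → ℕ}
    (g : Equiv.Perm (Fin n)) (h : ∀ x, ψ x = g * φ x * g⁻¹) (hψ : HasDecomposition ρ ψ m) :
    HasDecomposition ρ φ m := by
  obtain ⟨e⟩ := hψ
  have e' : Representation.Equiv ((isotypicSum m).comp ψ) ((isotypicSum m).comp φ) := by
    refine Representation.Equiv.mk
      (LinearEquiv.ofLinearMap (isotypicSum m g⁻¹) (isotypicSum m g) ?_ ?_) fun x => ?_
    · rw [← Module.End.mul_eq_comp, ← map_mul, inv_mul_cancel, map_one]; rfl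
    · rw [← Module.End.mul_eq_comp, ← map_mul, mul_inv_cancel, map_one]; rfl
    · change isotypicSum m g⁻¹ ∘ₗ isotypicSum m (ψ x) = isotypicSum m (φ x) ∘ₗ isotypicSum m g⁻¹
      rw [← Module.End.mul_eq_comp, ← Module.End.mul_eq_comp, ← map_mul, ← map_mul, h]
      congr 1
      group
  exact ⟨e.trans e'⟩

theorem hasDecomposition_of_factor {n : ℕ} {G V : Type*} [Group G] [AddCommGroup V] [Module ℂ V]
    {ρ : Representation ℂ G V} {φ : G →* Equiv.Perm (Fin n)} {m : n.Partition → ℕ}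
    {σ : Representation ℂ (Equiv.Perm (Fin n)) V} (hσ : ∀ g, σ (φ g) = ρ g)
    (h : Nonempty (σ.Equiv (isotypicSum m))) : HasDecomposition ρ φ m := by
  obtain ⟨e⟩ := h
  refine ⟨Representation.Equiv.mk e.toLinearEquiv fun g => ?_⟩
  rw [← hσ]
  exact LinearMap.ext fun v =>
    Representation.IntertwiningMap.isIntertwining _ _ e.toIntertwiningMap (φ g) v

/-- The images of `T` and `lowerUnipotent` are distinct transpositions, so a conjugation takes them
to (0 1) and (0 2). This reduces an arbitrary identification to the one in which the decomposition
was computed. -/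
theorem IsS3Identification.hasDecomposition {k : ℕ}
    [FiniteDimensional ℂ (CuspForm Γ(2) (2 * k))]
    {φ : SL(2, ℤ) →* Equiv.Perm (Fin 3)} (hφ : IsS3Identification φ)
    (h : IsCuspAction (cuspRep (2 * k) ModularGroup.T) (cuspRep (2 * k) lowerUnipotent)
      (newDim 1 (2 * k)) (newDim 2 (2 * k)) (newDim 4 (2 * k))) :
    HasDecomposition (cuspRep (2 * k)) φ (cuspMult k) := by
  have hone : ∀ γ, φ γ = 1 ↔ γ.1.map (Int.cast : ℤ → ZMod 2) = 1 := fun γ => by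
    rw [← mem_Gamma_two, ← hφ.2, MonoidHom.mem_ker]
  obtain ⟨g, hg1, hg2⟩ := exists_conj_swap (φ ModularGroup.T) (φ lowerUnipotent)
    ⟨by rw [← map_mul, hone]; decide, by rw [← map_mul, hone]; decide,
      by rw [ne_eq, hone]; decide, by rw [ne_eq, hone]; decide, by
        rw [ne_eq, ← mul_inv_eq_one, ← map_inv, ← map_mul, hone]
        decide⟩
  let ψ : SL(2, ℤ) →* Equiv.Perm (Fin 3) := (MulAut.conj g).toMonoidHom.comp φ
  have hψ : ∀ x, ψ x = g * φ x * g⁻¹ := fun x => rfl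
  refine hasDecomposition_conj g hψ ?_
  obtain ⟨σ, hσ⟩ := exists_comp_eq ψ ((MulAut.conj g).surjective.comp hφ.1) (cuspRep (2 * k))
    fun γ hγ => cuspRep_eq_one (by
      rw [← hφ.2, MonoidHom.mem_ker]
      exact (MulAut.conj g).injective (hγ.trans (map_one _).symm))
  refine hasDecomposition_of_factor hσ (IsCuspAction.equiv_isotypicSum k σ ?_)
  rw [← hg1, ← hg2, ← hψ, ← hψ, hσ, hσ]
  exact h

end EllipticDecomposition

/-! ### Multiplicities in an S₃-action from its fixed spaces -/

section LinearAlgebra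

variable {W : Type*} [AddCommGroup W] [Module ℂ W] [FiniteDimensional ℂ W]

/-- The multiplicities of an action of `S₃`, from the dimensions of the fixed spaces. -/
theorem isCuspAction_of_finrank {X Y : Module.End ℂ W} {d₁ d₂ d₄ : ℕ} (hX : X * X = 1)
    (hY : Y * Y = 1) (hXY : X * Y * X = Y * X * Y)
    (hinv : Module.finrank ℂ ↥(LinearMap.ker (X - 1) ⊓ LinearMap.ker (Y - 1)) = d₁)
    (hfix : Module.finrank ℂ ↥(LinearMap.ker (X - 1)) = 2 * d₁ + d₂)
    (htot : Module.finrank ℂ W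
      = d₄ + Module.finrank ℂ ↥(LinearMap.ker (X - 1) ⊔ LinearMap.ker (Y - 1))) :
    IsCuspAction X Y d₁ d₂ d₄ := by
  have hX' : ∀ w, X (X w) = w := fun w => LinearMap.congr_fun hX w
  have hY' : ∀ w, Y (Y w) = w := fun w => LinearMap.congr_fun hY w
  have hXY' : ∀ w, X (Y (X w)) = Y (X (Y w)) := fun w => LinearMap.congr_fun hXY w
  have hfixY : Module.finrank ℂ ↥(LinearMap.ker (Y - 1)) = 2 * d₁ + d₂ := by
    rw [← hfix]
    -- By the braid relation, conjugation by `X * Y` takes `X` to `Y`, so the two fixed spaces have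
    -- the same dimension.
    let e : W ≃ₗ[ℂ] W := LinearEquiv.ofLinearMap (X * Y) (Y * X)
      (LinearMap.ext fun w => by simp [hX', hY']) (LinearMap.ext fun w => by simp [hX', hY'])
    have : (LinearMap.ker (X - 1)).map (e : W →ₗ[ℂ] W) = LinearMap.ker (Y - 1) := by
      ext w
      constructor
      · rintro ⟨v, hv, rfl⟩
        have hv' := mem_ker_sub_one.mp hv
        refine mem_ker_sub_one.mpr ?_
        change Y (X (Y v)) = X (Y v)
        rw [← hXY', hv']
      · intro hw
        have hw' := mem_ker_sub_one.mp hw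
        refine ⟨Y (X w), mem_ker_sub_one.mpr ?_, ?_⟩
        · rw [hXY', hw']
        · change X (Y (Y (X w))) = w
          rw [hY', hX']
    rw [← this]
    exact (LinearEquiv.finrank_eq (e.submoduleMap _)).symm
  have hsup := Submodule.finrank_sup_add_finrank_inf_eq (LinearMap.ker (X - 1))
    (LinearMap.ker (Y - 1))
  refine ⟨hX, hY, hXY, hinv, hfix, ?_, ?_, ?_⟩
  -- The sum over the rotations sends the fixed space of `X` onto the invariants, with the standard
  -- part as kernel; rank and nullity give (2d₁ + d₂) - d₁.
  · let E : W →ₗ[ℂ] W := 1 + X * Y + Y * X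
    have hE : ∀ w, E w = w + X (Y w) + Y (X w) := fun w => rfl
    let F := E.domRestrict (LinearMap.ker (X - 1))
    have hrange : LinearMap.range F = LinearMap.ker (X - 1) ⊓ LinearMap.ker (Y - 1) := by
      ext w
      constructor
      · rintro ⟨v, rfl⟩
        have hv := mem_ker_sub_one.mp v.2
        change E v.1 ∈ _
        rw [hE, hv]
        refine ⟨mem_ker_sub_one.mpr ?_, mem_ker_sub_one.mpr ?_⟩
        · rw [map_add, map_add, hv, hX']; abel
        · rw [map_add, map_add, hY', ← hXY', hv]; abel
      · rintro ⟨h1, h2⟩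
        refine ⟨⟨(3 : ℂ)⁻¹ • w, Submodule.smul_mem _ _ h1⟩, ?_⟩
        change E ((3 : ℂ)⁻¹ • w) = w
        rw [map_smul, hE, mem_ker_sub_one.mp h1, mem_ker_sub_one.mp h2, mem_ker_sub_one.mp h1]
        module
    have hker : Module.finrank ℂ (LinearMap.ker F)
        = Module.finrank ℂ ↥(LinearMap.ker (X - 1) ⊓ LinearMap.ker (1 + X * Y + Y * X)) := by
      have : LinearMap.ker F = (LinearMap.ker E).comap (LinearMap.ker (X - 1)).subtype := rfl
      rw [this, ← Submodule.finrank_map_subtype_eq, Submodule.map_comap_subtype]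
    have := LinearMap.finrank_range_add_finrank_ker F
    rw [hrange, hinv, hfix, hker] at this
    omega
  -- The antisymmetrizer has the sign part as image. Its kernel is the sum of the two fixed spaces,
  -- so the multiplicity of the sign is the codimension of that sum.
  · let E : W →ₗ[ℂ] W := 1 - X - Y + X * Y + Y * X - X * Y * X
    have hE : ∀ w, E w = w - X w - Y w + X (Y w) + Y (X w) - X (Y (X w)) := fun w => rfl
    have hrange : LinearMap.range E = LinearMap.ker (X + 1) ⊓ LinearMap.ker (Y + 1) := by
      ext w
      constructor
      · rintro ⟨v, rfl⟩
        rw [hE]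
        refine ⟨mem_ker_add_one.mpr ?_, mem_ker_add_one.mpr ?_⟩
        · simp only [map_add, map_sub, hX']; abel
        · simp only [map_add, map_sub, hY', hXY']; abel
      · rintro ⟨h1, h2⟩
        have h1 := mem_ker_add_one.mp h1
        have h2 := mem_ker_add_one.mp h2
        refine ⟨(6 : ℂ)⁻¹ • w, ?_⟩
        rw [map_smul, hE]
        simp only [h1, h2, map_neg, neg_neg]
        module
    have hker : LinearMap.ker E = LinearMap.ker (X - 1) ⊔ LinearMap.ker (Y - 1) := by
      apply le_antisymm
      · intro w hw
        have hw : w - X w - Y w + X (Y w) + Y (X w) - X (Y (X w)) = 0 := hw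
        -- This is the identity 6 - E = (1 + X) A + (1 + Y) B in the group algebra, used where `E w
        -- = 0`. The image of `1 + X` lies in the fixed space of `X`, and likewise for `Y`.
        have e : w = ((6 : ℂ)⁻¹ • (w + X w + (w - Y w + X (w - Y w)) + (Y (X w) + X (Y (X w)))
              + (w + X w)))
            + ((6 : ℂ)⁻¹ • (w + Y w + (w - X w + Y (w - X w)) - (X w + Y (X w)))) := by
          rw [← smul_add, ← add_zero (_ + _ : W), ← hw, eq_inv_smul_iff₀ (by norm_num)]
          simp only [map_sub]
          module
        rw [e]
        refine Submodule.add_mem_sup (mem_ker_sub_one.mpr ?_) (mem_ker_sub_one.mpr ?_)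
        · simp only [map_smul, map_add, map_sub, hX']; congr 1; abel
        · simp only [map_smul, map_add, map_sub, hY']; congr 1; abel
      · refine sup_le (fun w hw => ?_) (fun w hw => ?_)
        · rw [LinearMap.mem_ker, hE, mem_ker_sub_one.mp hw]; abel
        · rw [LinearMap.mem_ker, hE, hXY', mem_ker_sub_one.mp hw]; abel
    have := LinearMap.finrank_range_add_finrank_ker E
    rw [hrange, hker, htot] at this
    omega
  · rw [hinv, hfix, hfixY] at hsup
    omega

end LinearAlgebra

end

end LevelTwo

namespace LevelTwo

noncomputable section

/-! ## Cusp forms as functions on the upper half plane -/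

section CuspSpace

open scoped Manifold Pointwise
open Matrix.SpecialLinearGroup ConjAct

/-- The holomorphic functions on the upper half plane that vanish at all cusps, for the weight
`k`, without a condition of invariance. -/
def cuspFun (k : ℤ) : Submodule ℂ (UpperHalfPlane → ℂ) where
  carrier := {F | MDiff F ∧ ∀ γ : SL(2, ℤ), UpperHalfPlane.IsZeroAtImInfty (F ∣[k] γ)}
  zero_mem' := ⟨mdifferentiable_const, fun γ => by
    rw [SlashAction.zero_slash]; exact Filter.zero_zeroAtFilter _⟩
  add_mem' := fun {F G} hF hG => ⟨hF.1.add hG.1, fun γ => by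
    rw [SlashAction.add_slash]; exact (hF.2 γ).add (hG.2 γ)⟩
  smul_mem' := fun c F hF => ⟨hF.1.const_smul c, fun γ => by
    rw [ModularForm.SL_smul_slash]; exact (hF.2 γ).smul c⟩

/-- The functions that are invariant under the weight `k` action of `Γ`. -/
def slashInvariants (Γ : Subgroup SL(2, ℤ)) (k : ℤ) : Submodule ℂ (UpperHalfPlane → ℂ) where
  carrier := {F | ∀ γ ∈ Γ, F ∣[k] γ = F}
  zero_mem' := fun γ _ => SlashAction.zero_slash k γ
  add_mem' := fun hF hG γ hγ => by rw [SlashAction.add_slash, hF γ hγ, hG γ hγ]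
  smul_mem' := fun c F hF γ hγ => by rw [ModularForm.SL_smul_slash, hF γ hγ]

/-- The cusp forms of weight `k` on `Γ`, as functions on the upper half plane. -/
def cuspSpace (Γ : Subgroup SL(2, ℤ)) (k : ℤ) : Submodule ℂ (UpperHalfPlane → ℂ) :=
  cuspFun k ⊓ slashInvariants Γ k

theorem cuspSpace_mono {Γ Γ' : Subgroup SL(2, ℤ)} (h : Γ ≤ Γ') (k : ℤ) :
    cuspSpace Γ' k ≤ cuspSpace Γ k :=
  inf_le_inf_left _ fun _ hF γ hγ => hF γ (h hγ)

theorem coe_mem_cuspSpace {Γ : Subgroup SL(2, ℤ)} [Γ.FiniteIndex] {k : ℤ} (f : CuspForm Γ k) :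
    ⇑f ∈ cuspSpace Γ k :=
  ⟨⟨CuspFormClass.holo f, fun γ => CuspFormClass.zero_at_infty_slash f γ⟩, fun γ hγ =>
    SlashInvariantFormClass.slash_action_eq f (mapGL ℝ γ) ⟨γ, hγ, rfl⟩⟩

/-- A function in `cuspSpace Γ k`, as a cusp form. -/
def cuspFormOfMem {Γ : Subgroup SL(2, ℤ)} [Γ.FiniteIndex] {k : ℤ} {F : UpperHalfPlane → ℂ}
    (hF : F ∈ cuspSpace Γ k) : CuspForm Γ k where
  toFun := F
  slash_action_eq' := by
    rintro _ ⟨δ, hδ, rfl⟩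
    exact hF.2 δ hδ
  holo' := hF.1.1
  zero_at_cusps' := fun {c} hc => by
    rw [Subgroup.IsArithmetic.isCusp_iff_isCusp_SL2Z] at hc
    exact (OnePoint.isZeroAt_iff_forall_SL2Z hc).mpr fun γ _ => hF.1.2 γ

/-- Cusp forms on `Γ` are the same as functions in `cuspSpace Γ k`. -/
def cuspSpaceEquiv (Γ : Subgroup SL(2, ℤ)) [Γ.FiniteIndex] (k : ℤ) :
    CuspForm Γ k ≃ₗ[ℂ] cuspSpace Γ k where
  toFun f := ⟨⇑f, coe_mem_cuspSpace f⟩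
  invFun F := cuspFormOfMem F.2
  map_add' _ _ := rfl
  map_smul' _ _ := rfl
  left_inv _ := rfl
  right_inv _ := rfl

/-- Conjugation by a rational matrix keeps a group arithmetic, so the translate is again a cusp form
and vanishes at every cusp. -/
theorem slash_mem_cuspFun {Γ : Subgroup SL(2, ℤ)} [Γ.FiniteIndex] {k : ℤ}
    {F : UpperHalfPlane → ℂ} (hF : F ∈ cuspSpace Γ k) (g : GL (Fin 2) ℚ) :
    F ∣[k] (Matrix.GeneralLinearGroup.map (Rat.castHom ℝ) g) ∈ cuspFun k := by
  have : (toConjAct (Matrix.GeneralLinearGroup.map (Rat.castHom ℝ) g)⁻¹ •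
      (Γ.map (mapGL ℝ))).IsArithmetic := by
    rw [← map_inv]
    exact Subgroup.IsArithmetic.conj _ _
  let f := CuspForm.translate (cuspFormOfMem hF) (Matrix.GeneralLinearGroup.map (Rat.castHom ℝ) g)
  exact ⟨CuspFormClass.holo f, fun γ => CuspFormClass.zero_at_infty_slash f γ⟩

theorem slash_mem_cuspSpace {Γ Γ' : Subgroup SL(2, ℤ)} [Γ.FiniteIndex] {k : ℤ}
    {F : UpperHalfPlane → ℂ} (hF : F ∈ cuspSpace Γ k) (g : GL (Fin 2) ℚ)
    (h : ∀ γ' ∈ Γ', ∃ γ ∈ Γ, mapGL ℚ γ * g = g * mapGL ℚ γ') :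
    F ∣[k] (Matrix.GeneralLinearGroup.map (Rat.castHom ℝ) g) ∈ cuspSpace Γ' k := by
  refine ⟨slash_mem_cuspFun hF g, fun γ' hγ' => ?_⟩
  obtain ⟨γ, hγ, e⟩ := h γ' hγ'
  have key : ∀ δ : SL(2, ℤ), Matrix.GeneralLinearGroup.map (Rat.castHom ℝ) (mapGL ℚ δ)
      = mapGL ℝ δ := fun δ => by
    ext i j
    simp
  have e' := congrArg (Matrix.GeneralLinearGroup.map (Rat.castHom ℝ)) e
  rw [map_mul, map_mul, key, key] at e'
  change (F ∣[k] _) ∣[k] (mapGL ℝ γ') = _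
  rw [← SlashAction.slash_mul, ← e', SlashAction.slash_mul]
  congr 1
  exact hF.2 γ hγ

end CuspSpace

end

end LevelTwo

namespace LevelTwo

noncomputable section

/-! ## The operator `F(τ) ↦ F(2τ)` -/

section Dilation

open Matrix.SpecialLinearGroup

theorem even_of_mem_Gamma_two {γ : SL(2, ℤ)} (h : γ ∈ Γ(2)) : 2 ∣ γ 0 1 ∧ 2 ∣ γ 1 0 := by
  rw [CongruenceSubgroup.Gamma_mem] at h
  exact ⟨(ZMod.intCast_zmod_eq_zero_iff_dvd _ 2).mp h.2.1,
    (ZMod.intCast_zmod_eq_zero_iff_dvd _ 2).mp h.2.2.1⟩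

theorem det_eq (γ : SL(2, ℤ)) : γ 0 0 * γ 1 1 - γ 0 1 * γ 1 0 = 1 := by
  have := γ.2
  rwa [Matrix.det_fin_two] at this

theorem mem_Gamma_two_of_even {γ : SL(2, ℤ)} (h₁ : 2 ∣ γ 0 1) (h₂ : 2 ∣ γ 1 0) : γ ∈ Γ(2) := by
  have hd := det_eq γ
  obtain ⟨b, hb⟩ := h₁
  obtain ⟨c, hc⟩ := h₂
  have ho : Odd (γ 0 0 * γ 1 1) := ⟨2 * b * c, by rw [hb, hc] at hd; linarith⟩
  rw [Int.odd_mul] at ho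
  have key : ∀ a : ℤ, Odd a → ((a : ℤ) : ZMod 2) = 1 := fun a ha => by
    obtain ⟨m, rfl⟩ := ha
    push_cast
    rw [show (2 : ZMod 2) = 0 from rfl]
    ring
  rw [CongruenceSubgroup.Gamma_mem]
  exact ⟨key _ ho.1, (ZMod.intCast_zmod_eq_zero_iff_dvd _ 2).mpr ⟨b, hb⟩,
    (ZMod.intCast_zmod_eq_zero_iff_dvd _ 2).mpr ⟨c, hc⟩, key _ ho.2⟩

theorem mem_Gamma0 {N : ℕ} {γ : SL(2, ℤ)} : γ ∈ CongruenceSubgroup.Gamma0 N ↔ (N : ℤ) ∣ γ 1 0 :=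
  CongruenceSubgroup.Gamma0_mem.trans (ZMod.intCast_zmod_eq_zero_iff_dvd _ N)

/-- The subgroup `Γ⁰(2)` of the matrices with an even entry in the upper right corner. -/
def GammaUpper : Subgroup SL(2, ℤ) where
  carrier := {γ | 2 ∣ γ 0 1}
  one_mem' := by simp
  mul_mem' := fun {γ δ} (hγ : 2 ∣ γ 0 1) (hδ : 2 ∣ δ 0 1) => by
    change 2 ∣ (γ * δ) 0 1
    have : (γ * δ) 0 1 = γ 0 0 * δ 0 1 + γ 0 1 * δ 1 1 := by
      simp [Matrix.mul_apply, Fin.sum_univ_two]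
    rw [this]
    exact dvd_add (Dvd.dvd.mul_left hδ _) (Dvd.dvd.mul_right hγ _)
  inv_mem' := fun {γ} (hγ : 2 ∣ γ 0 1) => by
    change 2 ∣ (γ⁻¹) 0 1
    have : (γ⁻¹) 0 1 = -γ 0 1 := by
      simp [Matrix.SpecialLinearGroup.SL2_inv_expl]
    rw [this]
    exact (dvd_neg).mpr hγ

theorem Gamma_two_le_GammaUpper : Γ(2) ≤ GammaUpper := fun _ h => (even_of_mem_Gamma_two h).1

theorem Gamma_two_le_Gamma0 : Γ(2) ≤ CongruenceSubgroup.Gamma0 2 := fun _ h =>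
  mem_Gamma0.mpr (even_of_mem_Gamma_two h).2

instance : GammaUpper.FiniteIndex := Subgroup.finiteIndex_of_le Gamma_two_le_GammaUpper

theorem dvd_or_dvd_add {a b : ℤ} (h : ¬ 2 ∣ a) : 2 ∣ b ∨ 2 ∣ b - a := by omega

/-- Γ₀(2) is the union of Γ(2) and Γ(2) T: with lower left entry even, the upper left entry is odd,
and one multiplication by `T⁻¹` corrects the parity of the upper right one. -/
theorem mem_cuspSpace_Gamma0_two {k : ℤ} {F : UpperHalfPlane → ℂ} :
    F ∈ cuspSpace (CongruenceSubgroup.Gamma0 2) k ↔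
      F ∈ cuspSpace Γ(2) k ∧ F ∣[k] ModularGroup.T = F := by
  constructor
  · exact fun h => ⟨cuspSpace_mono Gamma_two_le_Gamma0 k h,
      h.2 _ (mem_Gamma0.mpr (by simp [ModularGroup.T]))⟩
  · refine fun ⟨h, hT⟩ => ⟨h.1, fun γ hγ => ?_⟩
    have hc : (2 : ℤ) ∣ γ 1 0 := mem_Gamma0.mp hγ
    have hd := det_eq γ
    have ha : ¬ 2 ∣ γ 0 0 := fun h' => by
      have h1 : (2 : ℤ) ∣ 1 := by
        rw [← hd]
        exact dvd_sub (h'.mul_right _) (hc.mul_left _)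
      omega
    rcases dvd_or_dvd_add (b := γ 0 1) ha with h1 | h1
    · exact h.2 γ (mem_Gamma_two_of_even h1 hc)
    · have hm : γ * ModularGroup.T⁻¹ ∈ Γ(2) := by
        apply mem_Gamma_two_of_even
        · have : (γ * ModularGroup.T⁻¹) 0 1 = γ 0 1 - γ 0 0 := by
            simp [Matrix.mul_apply, Fin.sum_univ_two]; ring
          rwa [this]
        · have : (γ * ModularGroup.T⁻¹) 1 0 = γ 1 0 := by
            simp [Matrix.mul_apply, Fin.sum_univ_two]
          rwa [this]
      have e : γ = (γ * ModularGroup.T⁻¹) * ModularGroup.T := by group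
      rw [e, SlashAction.slash_mul, h.2 _ hm, hT]

theorem adjugate_lowerUnipotent : lowerUnipotent.1.adjugate = !![1, 0; -1, 1] := by
  simp [lowerUnipotent, Matrix.adjugate_fin_two]

theorem mem_cuspSpace_GammaUpper {k : ℤ} {F : UpperHalfPlane → ℂ} :
    F ∈ cuspSpace GammaUpper k ↔ F ∈ cuspSpace Γ(2) k ∧ F ∣[k] lowerUnipotent = F := by
  constructor
  · exact fun h => ⟨cuspSpace_mono Gamma_two_le_GammaUpper k h,
      h.2 _ (show (2 : ℤ) ∣ lowerUnipotent 0 1 by simp [lowerUnipotent])⟩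
  · refine fun ⟨h, hT⟩ => ⟨h.1, fun γ hγ => ?_⟩
    have hc : (2 : ℤ) ∣ γ 0 1 := hγ
    have hd := det_eq γ
    have ha : ¬ 2 ∣ γ 1 1 := fun h' => by
      have h1 : (2 : ℤ) ∣ 1 := by
        rw [← hd]
        exact dvd_sub (h'.mul_left _) (hc.mul_right _)
      omega
    rcases dvd_or_dvd_add (b := γ 1 0) ha with h1 | h1
    · exact h.2 γ (mem_Gamma_two_of_even hc h1)
    · have hm : γ * lowerUnipotent⁻¹ ∈ Γ(2) := by
        apply mem_Gamma_two_of_even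
        · have : (γ * lowerUnipotent⁻¹) 0 1 = γ 0 1 := by
            simp [Matrix.mul_apply, Fin.sum_univ_two, adjugate_lowerUnipotent]
          rwa [this]
        · have : (γ * lowerUnipotent⁻¹) 1 0 = γ 1 0 - γ 1 1 := by
            simp [Matrix.mul_apply, Fin.sum_univ_two, adjugate_lowerUnipotent]; ring
          rwa [this]
      have e : γ = (γ * lowerUnipotent⁻¹) * lowerUnipotent := by group
      rw [e, SlashAction.slash_mul, h.2 _ hm, hT]

theorem S_eq : ModularGroup.S = ModularGroup.T⁻¹ * lowerUnipotent * ModularGroup.T⁻¹ := by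
  decide

/-- `S` is a word in `T` and `lowerUnipotent`, so invariance under these two matrices is invariance
under all of SL(2, ℤ). -/
theorem cuspSpace_top (k : ℤ) :
    cuspSpace ⊤ k = cuspSpace (CongruenceSubgroup.Gamma0 2) k ⊓ cuspSpace GammaUpper k := by
  refine le_antisymm (le_inf (cuspSpace_mono le_top k) (cuspSpace_mono le_top k)) fun F hF => ?_
  obtain ⟨h1, h2⟩ := hF
  have hT := (mem_cuspSpace_Gamma0_two.mp h1).2
  have hL := (mem_cuspSpace_GammaUpper.mp h2).2
  have hT' : F ∣[k] ModularGroup.T⁻¹ = F := by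
    conv_lhs => rw [← hT]
    rw [← SlashAction.slash_mul, mul_inv_cancel, SlashAction.slash_one]
  refine ⟨h1.1, fun γ hγ => ?_⟩
  clear hγ
  have hγ : γ ∈ Subgroup.closure {ModularGroup.S, ModularGroup.T} := by
    simp [SpecialLinearGroup.SL2Z_generators]
  induction hγ using Subgroup.closure_induction with
  | mem x hx =>
    rcases hx with rfl | rfl
    · rw [S_eq, SlashAction.slash_mul, SlashAction.slash_mul, hT', hL, hT']
    · exact hT
  | one => exact SlashAction.slash_one k F
  | mul x y _ _ hx hy => rw [SlashAction.slash_mul, hx, hy]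
  | inv x _ hx =>
    conv_lhs => rw [← hx]
    rw [← SlashAction.slash_mul, mul_inv_cancel, SlashAction.slash_one]

/-- The matrix `diag(2, 1)`. -/
def diagTwo : GL (Fin 2) ℚ := Matrix.GeneralLinearGroup.mkOfDetNeZero !![2, 0; 0, 1] (by simp)

/-- The image of `diag(2, 1)` in `GL(2, ℝ)`. -/
def diagTwoReal : GL (Fin 2) ℝ := Matrix.GeneralLinearGroup.map (Rat.castHom ℝ) diagTwo

theorem diagTwoReal_coe : diagTwoReal.1 = !![2, 0; 0, 1] := by
  ext i j
  fin_cases i <;> fin_cases j <;>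
    simp [diagTwoReal, diagTwo, Matrix.GeneralLinearGroup.mkOfDetNeZero]

theorem det_diagTwoReal : diagTwoReal.det.val = 2 := by
  rw [Matrix.GeneralLinearGroup.val_det_apply, diagTwoReal_coe]
  simp

/-- The operator `F(τ) ↦ 2^(k-1) F(2τ)`, the slash operator of `diag(2, 1)`. -/
def dilate (k : ℤ) : (UpperHalfPlane → ℂ) ≃ₗ[ℂ] (UpperHalfPlane → ℂ) where
  toFun F := F ∣[k] diagTwoReal
  invFun F := F ∣[k] diagTwoReal⁻¹
  map_add' F G := SlashAction.add_slash k _ F G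
  map_smul' c F := by
    rw [ModularForm.smul_slash, UpperHalfPlane.σ, if_pos (by rw [det_diagTwoReal]; norm_num)]
    rfl
  left_inv F := by
    change (F ∣[k] _) ∣[k] _ = F
    rw [← SlashAction.slash_mul, mul_inv_cancel, SlashAction.slash_one]
  right_inv F := by
    change (F ∣[k] _) ∣[k] _ = F
    rw [← SlashAction.slash_mul, inv_mul_cancel, SlashAction.slash_one]

theorem coe_diagTwoReal_smul (τ : UpperHalfPlane) : ((diagTwoReal • τ : UpperHalfPlane) : ℂ)
    = 2 * (τ : ℂ) := by
  rw [UpperHalfPlane.coe_smul_of_det_pos (by rw [det_diagTwoReal]; norm_num)]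
  simp [UpperHalfPlane.num, UpperHalfPlane.denom, diagTwoReal_coe]

theorem dilate_apply (k : ℤ) (F : UpperHalfPlane → ℂ) {τ τ' : UpperHalfPlane}
    (h : (τ' : ℂ) = 2 * (τ : ℂ)) : dilate k F τ = 2 ^ (k - 1) * F τ' := by
  have e : diagTwoReal • τ = τ' := UpperHalfPlane.ext ((coe_diagTwoReal_smul τ).trans h.symm)
  change (F ∣[k] diagTwoReal) τ = _
  rw [ModularForm.slash_apply, UpperHalfPlane.σ, if_pos (by rw [det_diagTwoReal]; norm_num), e,
    det_diagTwoReal]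
  simp [UpperHalfPlane.denom, diagTwoReal_coe, mul_comm]

theorem exists_entries (a b c d : ℤ) (h : a * d - b * c = 1) :
    ∃ δ : SL(2, ℤ), δ 0 0 = a ∧ δ 0 1 = b ∧ δ 1 0 = c ∧ δ 1 1 = d :=
  ⟨⟨!![a, b; c, d], by rwa [Matrix.det_fin_two_of]⟩, rfl, rfl, rfl, rfl⟩

theorem exists_conj_diagTwo {γ : SL(2, ℤ)} (h : 2 ∣ γ 1 0) :
    ∃ δ : SL(2, ℤ), δ 0 1 = 2 * γ 0 1 ∧ 2 * δ 1 0 = γ 1 0 ∧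
      mapGL ℚ δ * diagTwo = diagTwo * mapGL ℚ γ := by
  obtain ⟨c, hc⟩ := h
  have hd := det_eq γ
  obtain ⟨δ, h1, h2, h3, h4⟩ := exists_entries (γ 0 0) (2 * γ 0 1) c (γ 1 1)
    (by rw [hc] at hd; linarith)
  refine ⟨δ, h2, by rw [h3, hc], ?_⟩
  ext i j
  fin_cases i <;> fin_cases j <;>
    simp [diagTwo, Matrix.GeneralLinearGroup.mkOfDetNeZero, Matrix.mul_apply,
      Fin.sum_univ_two, hc, mul_comm, h1, h2, h3, h4]

theorem exists_conj_diagTwo_inv {γ : SL(2, ℤ)} (h : 2 ∣ γ 0 1) :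
    ∃ δ : SL(2, ℤ), 2 * δ 0 1 = γ 0 1 ∧ δ 1 0 = 2 * γ 1 0 ∧
      mapGL ℚ δ * diagTwo⁻¹ = diagTwo⁻¹ * mapGL ℚ γ := by
  obtain ⟨b, hb⟩ := h
  have hd := det_eq γ
  obtain ⟨δ, h1, h2, h3, h4⟩ := exists_entries (γ 0 0) b (2 * γ 1 0) (γ 1 1)
    (by rw [hb] at hd; linarith)
  refine ⟨δ, by rw [h2, hb], h3, ?_⟩
  rw [mul_inv_eq_iff_eq_mul, mul_assoc, eq_inv_mul_iff_mul_eq]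
  ext i j
  fin_cases i <;> fin_cases j <;>
    simp [diagTwo, Matrix.GeneralLinearGroup.mkOfDetNeZero, Matrix.mul_apply,
      Fin.sum_univ_two, hb, mul_comm, h1, h2, h3, h4]

theorem dilate_mem {Γ Γ' : Subgroup SL(2, ℤ)} [Γ.FiniteIndex] {k : ℤ}
    (h : ∀ γ ∈ Γ', 2 ∣ γ 1 0 ∧ ∀ δ : SL(2, ℤ), δ 0 1 = 2 * γ 0 1 → 2 * δ 1 0 = γ 1 0 → δ ∈ Γ)
    {F : UpperHalfPlane → ℂ} (hF : F ∈ cuspSpace Γ k) : dilate k F ∈ cuspSpace Γ' k := by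
  refine slash_mem_cuspSpace hF diagTwo fun γ hγ => ?_
  obtain ⟨δ, h1, h2, h3⟩ := exists_conj_diagTwo (h γ hγ).1
  exact ⟨δ, (h γ hγ).2 δ h1 h2, h3⟩

theorem dilate_symm_mem {Γ Γ' : Subgroup SL(2, ℤ)} [Γ.FiniteIndex] {k : ℤ}
    (h : ∀ γ ∈ Γ', 2 ∣ γ 0 1 ∧ ∀ δ : SL(2, ℤ), 2 * δ 0 1 = γ 0 1 → δ 1 0 = 2 * γ 1 0 → δ ∈ Γ)
    {F : UpperHalfPlane → ℂ} (hF : F ∈ cuspSpace Γ k) : (dilate k).symm F ∈ cuspSpace Γ' k := by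
  have := slash_mem_cuspSpace (Γ' := Γ') hF diagTwo⁻¹ fun γ hγ => by
    obtain ⟨δ, h1, h2, h3⟩ := exists_conj_diagTwo_inv (h γ hγ).1
    exact ⟨δ, (h γ hγ).2 δ h1 h2, h3⟩
  rwa [map_inv] at this

/-- Conjugation by diag(2,1) takes (a, b; c, d) to (a, 2b; c/2, d), which carries Γ₀(4) onto Γ(2);
the parity of the diagonal entries is automatic from the determinant. -/
theorem map_dilate_Gamma_two (k : ℤ) :
    (cuspSpace Γ(2) k).map (dilate k).toLinearMap = cuspSpace (CongruenceSubgroup.Gamma0 4) k := by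
  apply le_antisymm
  · rintro _ ⟨F, hF, rfl⟩
    refine dilate_mem (fun γ hγ => ?_) hF
    obtain ⟨c, hc⟩ := mem_Gamma0.mp hγ
    push_cast at hc
    exact ⟨⟨2 * c, by rw [hc]; ring⟩, fun δ h1 h2 => mem_Gamma_two_of_even ⟨_, h1⟩ ⟨c, by linarith⟩⟩
  · refine fun F hF => ⟨(dilate k).symm F, dilate_symm_mem (fun γ hγ => ?_) hF, by simp⟩
    obtain ⟨h1, ⟨c, hc⟩⟩ := even_of_mem_Gamma_two hγ
    exact ⟨h1, fun δ _ h2 => mem_Gamma0.mpr ⟨c, by rw [h2, hc]; push_cast; ring⟩⟩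

theorem map_dilate_GammaUpper (k : ℤ) :
    (cuspSpace GammaUpper k).map (dilate k).toLinearMap
      = cuspSpace (CongruenceSubgroup.Gamma0 2) k := by
  apply le_antisymm
  · rintro _ ⟨F, hF, rfl⟩
    refine dilate_mem (fun γ hγ => ⟨mem_Gamma0.mp hγ, fun δ h1 _ =>
      show (2 : ℤ) ∣ δ 0 1 from ⟨_, h1⟩⟩) hF
  · exact fun F hF => ⟨(dilate k).symm F, dilate_symm_mem
      (fun γ hγ => ⟨hγ, fun δ _ h2 => mem_Gamma0.mpr ⟨_, h2⟩⟩) hF, by simp⟩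

theorem dilate_mem_of_top {k : ℤ} {F : UpperHalfPlane → ℂ} (hF : F ∈ cuspSpace ⊤ k) :
    dilate k F ∈ cuspSpace (CongruenceSubgroup.Gamma0 2) k :=
  dilate_mem (fun _ hγ => ⟨mem_Gamma0.mp hγ, fun _ _ _ => Subgroup.mem_top _⟩) hF

end Dilation

end

end LevelTwo

namespace LevelTwo

noncomputable section

/-! ## Cusp forms on `Γ(2)`: vanishing in small weight and finite dimension -/

section Sturm

open Asymptotics UpperHalfPlane Matrix.SpecialLinearGroup

/-- Decay forces vanishing at infinity, so division by the discriminant is possible. It lowers the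
weight by 12 and the decay rate by 2π, which preserves the inequality between them, and the process
ends in negative weight. -/
theorem levelOne_eq_zero_of_isBigO (n : ℕ) : ∀ {k : ℤ} (g : ModularForm 𝒮ℒ k) (c : ℝ), k < 12 * n →
    2 * Real.pi * k < 12 * c → (⇑g =O[atImInfty] fun τ => Real.exp (-c * τ.im)) → g = 0 := by
  induction n with
  | zero =>
    intro k g c hk _ _
    exact ModularForm.isZero_of_neg_weight (by simpa using hk) g
  | succ n ih =>
    intro k g c hk hc hg
    rcases lt_or_ge k 0 with hneg | hpos
    · exact ModularForm.isZero_of_neg_weight hneg g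
    have hc0 : 0 < c := by
      have h1 : (0 : ℝ) ≤ k := by exact_mod_cast hpos
      have h2 : 0 ≤ 2 * Real.pi * k := mul_nonneg Real.two_pi_pos.le h1
      linarith
    have hzero : IsZeroAtImInfty ⇑g := by
      refine hg.trans_tendsto ?_
      refine Real.tendsto_exp_atBot.comp ?_
      simp_rw [neg_mul]
      exact Filter.tendsto_neg_atTop_atBot.comp
        (Filter.Tendsto.const_mul_atTop hc0 Filter.tendsto_comap)
    have h0 : (qExpansion 1 g).coeff 0 = 0 := by
      simp [qExpansion_coeff, hzero.cuspFunction_apply_zero one_pos]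
    have hsmall : CuspForm.discriminantEquiv (ModularForm.toCuspForm g h0) = 0 := by
      refine ih _ (c - 2 * Real.pi) (by push_cast at hk; linarith) (by push_cast; linarith) ?_
      have hΔ : (fun τ => (ModularForm.discriminant τ)⁻¹) =O[atImInfty]
          fun τ : UpperHalfPlane => (Real.exp (-2 * Real.pi * τ.im))⁻¹ :=
        ModularForm.exp_isBigO_discriminant.inv_rev (Filter.Eventually.of_forall fun τ h =>
          absurd h (Real.exp_pos _).ne')
      have := hg.mul hΔ
      refine (this.congr_left fun τ => ?_).congr_right fun τ => ?_
      · rw [CuspForm.discriminantEquiv_apply, div_eq_mul_inv]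
        rfl
      · rw [← Real.exp_neg, ← Real.exp_add]
        congr 1
        ring
    rw [LinearEquiv.map_eq_zero_iff] at hsmall
    ext τ
    exact congrArg (fun F : CuspForm 𝒮ℒ k => F τ) hsmall

theorem two_mem_strictPeriods : (2 : ℝ) ∈ ((Γ(2)).map (mapGL ℝ)).strictPeriods := by
  rw [Subgroup.mem_strictPeriods_iff]
  refine ⟨ModularGroup.T * ModularGroup.T, mem_Gamma_two_of_even ?_ ?_, ?_⟩
  · simp [Matrix.mul_apply, Fin.sum_univ_two, ModularGroup.coe_T]
  · simp [ModularGroup.coe_T]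
  ext i j
  fin_cases i <;> fin_cases j <;>
    simp [Matrix.mul_apply, Fin.sum_univ_two, ModularGroup.coe_T]
  norm_num

theorem Gamma_two_isBigO {k : ℤ} (f : CuspForm Γ(2) k) :
    ⇑f =O[atImInfty] fun τ => Real.exp (-Real.pi * τ.im) := by
  refine (CuspFormClass.exp_decay_atImInfty f two_pos two_mem_strictPeriods).congr_right fun τ => ?_
  congr 1
  ring

/-- The number of translates of a cusp form on `Γ(2)` that enter its norm. -/
def normDegree : ℕ := Nat.card (𝒮ℒ ⧸ ((Γ(2)).map (mapGL ℝ)).subgroupOf 𝒮ℒ)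

theorem normDegree_pos : 0 < normDegree :=
  Nat.pos_of_ne_zero (Subgroup.relIndex_ne_zero (H := (Γ(2)).map (mapGL ℝ)) (K := 𝒮ℒ))

/-- Sturm's argument: the product of all translates has level one and weight `k * normDegree`. The
cusps have width 2, so each translate decays at least like exp(-π y), while the identity translate
contributes m + 1 times that rate. The hypothesis `hm` is exactly the level one bound for the rate π
(m + normDegree). -/
theorem Gamma_two_eq_zero_of_isBigO {k : ℤ} (f : CuspForm Γ(2) k) (m : ℕ)
    (hf : ⇑f =O[atImInfty] fun τ => Real.exp (-(Real.pi * (m + 1)) * τ.im))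
    (hm : k * normDegree < 6 * (m + normDegree)) : f = 0 := by
  classical
  suffices h : ModularForm.norm 𝒮ℒ f = 0 by
    rw [ModularForm.norm_eq_zero_iff] at h
    exact DFunLike.coe_injective h
  let Q := 𝒮ℒ ⧸ ((Γ(2)).map (mapGL ℝ)).subgroupOf 𝒮ℒ
  let : Fintype Q := Fintype.ofFinite Q
  have hcard : Fintype.card Q = normDegree := Nat.card_eq_fintype_card.symm
  let q₀ : Q := ⟦1⟧
  have hq : ∀ q : Q, SlashInvariantForm.quotientFunc f q =O[atImInfty]
      fun τ => Real.exp (-Real.pi * τ.im) := fun q => by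
    induction q using Quotient.inductionOn with
    | h r =>
      obtain ⟨_, ⟨γ, rfl⟩⟩ := r
      have := Gamma_two_isBigO (cuspRep k γ f)
      refine this.congr_left fun τ => ?_
      change (⇑f ∣[k] (mapGL ℝ γ⁻¹)) τ = (⇑f ∣[k] (mapGL ℝ γ)⁻¹) τ
      rw [map_inv]
  have hq0 : SlashInvariantForm.quotientFunc f q₀ =O[atImInfty]
      fun τ => Real.exp (-(Real.pi * (m + 1)) * τ.im) := by
    refine hf.congr_left fun τ => ?_
    change f τ = (⇑f ∣[k] (1 : GL (Fin 2) ℝ)⁻¹) τ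
    simp
  obtain ⟨n, hn⟩ := exists_nat_gt (k * normDegree : ℤ)
  refine levelOne_eq_zero_of_isBigO n _ (Real.pi * (m + normDegree)) ?_ ?_ ?_
  · have : (n : ℤ) ≤ 12 * n := by linarith [Int.natCast_nonneg n]
    exact lt_of_lt_of_le (by exact_mod_cast hn) this
  · have h1 : ((k * normDegree : ℤ) : ℝ) < 6 * (m + normDegree) := by exact_mod_cast hm
    have h2 := mul_lt_mul_of_pos_left h1 Real.two_pi_pos
    calc _ = 2 * Real.pi * ((k * normDegree : ℤ) : ℝ) := rfl
      _ < _ := h2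
      _ = _ := by ring
  · have hprod : (fun τ => ∏ q : Q, SlashInvariantForm.quotientFunc f q τ) =O[atImInfty]
        fun τ => ∏ q : Q, Real.exp (-(if q = q₀ then Real.pi * (m + 1) else Real.pi) * τ.im) := by
      refine IsBigO.finsetProd fun q _ => ?_
      by_cases h : q = q₀
      · rw [h]; simpa using hq0
      · simpa [h] using hq q
    refine (hprod.congr_left fun τ => ?_).congr_right fun τ => ?_
    · rw [ModularForm.coe_norm, Finset.prod_apply]
    · rw [← Real.exp_sum, ← Finset.sum_mul, Finset.sum_neg_distrib]
      congr 3
      have e : ∀ q : Q, (if q = q₀ then Real.pi * (m + 1) else Real.pi)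
          = Real.pi + if q = q₀ then Real.pi * m else 0 := fun q => by
        split_ifs <;> ring
      rw [Finset.sum_congr rfl fun q _ => e q, Finset.sum_add_distrib, Finset.sum_ite_eq']
      simp only [Finset.mem_univ, if_true, Finset.sum_const, Finset.card_univ, hcard, nsmul_eq_mul]
      ring

/-- There are no cusp forms of weight less than `6` on `Γ(2)`. -/
theorem Gamma_two_eq_zero {k : ℤ} (hk : k < 6) (f : CuspForm Γ(2) k) : f = 0 := by
  refine Gamma_two_eq_zero_of_isBigO f 0 ?_ ?_
  · simpa using Gamma_two_isBigO f
  · have := normDegree_pos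
    push_cast
    nlinarith

instance {k : ℤ} : FiniteDimensional ℂ (CuspForm Γ(2) k) := by
  -- This many coefficients are enough: `k * normDegree ≤ m` and `normDegree > 0` give the strict
  -- inequality of the Sturm bound.
  let m : ℕ := (k * normDegree).toNat
  have h2 := two_mem_strictPeriods
  let Φ : CuspForm Γ(2) k →ₗ[ℂ] (Fin (m + 1) → ℂ) :=
    { toFun := fun f i => (qExpansion 2 f).coeff i
      map_add' := fun f g => by
        funext i
        have := ModularForm.qExpansion_add two_pos h2 f g
        change (qExpansion 2 (⇑f + ⇑g)).coeff _ = _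
        rw [this]; simp
      map_smul' := fun c f => by
        funext i
        have := ModularForm.qExpansion_smul two_pos h2 c f
        change (qExpansion 2 (c • ⇑f)).coeff _ = _
        rw [this]; simp }
  refine FiniteDimensional.of_injective Φ ?_
  rw [injective_iff_map_eq_zero]
  intro f hf
  have hps : HasFPowerSeriesOnBall (cuspFunction 2 ⇑f) (qExpansionFormalMultilinearSeries 2 f) 0 1 :=
    hasFPowerSeries_cuspFunction _ two_pos
      (ModularFormClass.analyticAt_cuspFunction_zero f two_pos h2)
      (fun τ => by simpa using ModularForm.hasSum_qExpansion f two_pos h2 τ)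
  have hO := hps.hasFPowerSeriesAt.isBigO_sub_partialSum_pow (m + 1)
  have hpart : ∀ y, (qExpansionFormalMultilinearSeries 2 f).partialSum (m + 1) y = 0 := fun y => by
    refine Finset.sum_eq_zero fun i hi => ?_
    have hi' : (qExpansion 2 f).coeff i = 0 := congrFun hf ⟨i, Finset.mem_range.mp hi⟩
    simp [qExpansionFormalMultilinearSeries, FormalMultilinearSeries.ofScalars, hi']
  refine Gamma_two_eq_zero_of_isBigO f m ?_ ?_
  -- With period 2 the parameter q has absolute value exp(-π y), so the vanishing of the first m + 1
  -- coefficients gives decay of rate π (m + 1).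
  · have := hO.comp_tendsto (qParam_tendsto_atImInfty two_pos)
    refine (this.congr_left fun τ => ?_).congr_right fun τ => ?_
    · simp only [Function.comp_apply, hpart, zero_add, sub_zero]
      exact eq_cuspFunction τ two_ne_zero (SlashInvariantFormClass.periodic_comp_ofComplex f h2)
    · simp only [Function.comp_apply, Function.Periodic.norm_qParam, ← Real.exp_nat_mul]
      congr 1
      simp
      ring
  · have h1 : k * normDegree ≤ m := Int.self_le_toNat _
    have := normDegree_pos
    omega

end Sturm

end

end LevelTwo

namespace LevelTwo

noncomputable section

/-! ## The Petersson product -/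

section Petersson

open MeasureTheory UpperHalfPlane

/-- The complement of a subspace with respect to a positive definite Hermitian form has the
complementary dimension. -/
theorem finrank_add_finrank_orthogonal_of_form {V : Type*} [AddCommGroup V] [Module ℂ V]
    [FiniteDimensional ℂ V] (B : V → V → ℂ)
    (conj_symm : ∀ x y, (starRingEnd ℂ) (B y x) = B x y)
    (add_left : ∀ x y z, B (x + y) z = B x z + B y z)
    (smul_left : ∀ x y (r : ℂ), B (r • x) y = (starRingEnd ℂ) r * B x y)
    (nonneg : ∀ x, 0 ≤ (B x x).re) (definite : ∀ x, B x x = 0 → x = 0) (U : Submodule ℂ V) :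
    Module.finrank ℂ (Submodule.span ℂ {f | ∀ g ∈ U, B g f = 0}) + Module.finrank ℂ U
      = Module.finrank ℂ V := by
  let core : InnerProductSpace.Core ℂ V :=
    { inner := B, conj_inner_symm := conj_symm, re_inner_nonneg := nonneg, add_left := add_left,
      smul_left := smul_left, definite := definite }
  let : NormedAddCommGroup V := core.toNormedAddCommGroup
  let : InnerProductSpace ℂ V := InnerProductSpace.ofCore core.toCore
  have e : Submodule.span ℂ {f | ∀ g ∈ U, B g f = 0} = Uᗮ := by
    rw [← Submodule.span_eq Uᗮ]
    rfl
  rw [e, add_comm]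
  exact U.finrank_add_finrank_orthogonal

/-- The fundamental domain lies in the strip |x| ≤ 1/2, y > 1/2, on which dx dy / y² is integrable.
Bounded functions are therefore integrable on it, which covers the Petersson integrands. -/
theorem volume_fd_lt_top : volume (𝒟 : Set ℍ) < ⊤ := by
  rw [volume_eq_lintegral]
  let g : ℝ × ℝ → ℝ := fun p => 1 * p.2 ^ (-2 : ℝ)
  have hg : IntegrableOn g (Set.Icc (-(1 / 2)) (1 / 2) ×ˢ Set.Ioi (1 / 2)) := by
    rw [IntegrableOn, Measure.volume_eq_prod, ← Measure.prod_restrict]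
    refine Integrable.mul_prod (f := fun _ => (1 : ℝ)) (g := fun y : ℝ => y ^ (-2 : ℝ)) ?_ ?_
    · exact integrable_const _
    · exact integrableOn_Ioi_rpow_of_lt (by norm_num) (by norm_num)
  have hsub : (UpperHalfPlane.coe '' 𝒟 : Set ℂ) ⊆ Complex.measurableEquivRealProd ⁻¹'
      (Set.Icc (-(1 / 2)) (1 / 2) ×ˢ Set.Ioi (1 / 2)) := by
    rintro _ ⟨z, hz, rfl⟩
    have h1 := ModularGroup.three_le_four_mul_im_sq_of_mem_fd hz
    have h2 := z.im_pos
    refine ⟨abs_le.mp hz.2, ?_⟩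
    change (1 / 2 : ℝ) < z.im
    nlinarith
  refine (lintegral_mono_set hsub).trans_lt ?_
  have := (Complex.volume_preserving_equiv_real_prod).setLIntegral_comp_preimage_emb
    Complex.measurableEquivRealProd.measurableEmbedding
    (fun p : ℝ × ℝ => ((((1 / ‖p.2‖₊) ^ 2 : NNReal)) : ENNReal))
    (Set.Icc (-(1 / 2)) (1 / 2) ×ˢ Set.Ioi (1 / 2))
  refine lt_of_eq_of_lt this (lt_of_le_of_lt (setLIntegral_mono' ?_ fun p hp => ?_) hg.2)
  · exact measurableSet_Icc.prod measurableSet_Ioi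
  · have h0 : (0 : ℝ) < p.2 := lt_trans (by norm_num) hp.2
    rw [enorm_eq_nnnorm, ENNReal.coe_le_coe]
    apply le_of_eq
    ext
    simp [g]

theorem isOpen_eq_empty_of_volume {U : Set ℍ} (hU : IsOpen U) (h : volume U = 0) : U = ∅ := by
  have hopen : IsOpen (UpperHalfPlane.coe '' U) := isOpenEmbedding_coe.isOpenMap U hU
  rw [volume_eq_lintegral, setLIntegral_eq_zero_iff hopen.measurableSet (by fun_prop)] at h
  have hz : volume (UpperHalfPlane.coe '' U) = 0 := by
    refine measure_mono_null (fun z hz => ?_) h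
    obtain ⟨τ, -, rfl⟩ := id hz
    intro h0
    have h1 := h0 hz
    have h2 : (τ : ℂ).im ≠ 0 := τ.im_ne_zero
    simp at h1
    exact h2 h1
  rw [hopen.measure_eq_zero_iff (μ := (volume : Measure ℂ))] at hz
  exact Set.image_eq_empty.mp hz

variable {N : ℕ} {k : ℤ}

theorem integrableOn_petersson [NeZero N] (f g : CuspForm (CongruenceSubgroup.Gamma0 N) k) (γ : SL(2, ℤ)) :
    IntegrableOn (fun τ => petersson k f g (γ • τ)) 𝒟 := by
  obtain ⟨C, hC⟩ := CuspFormClass.petersson_bounded_left k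
    ((CongruenceSubgroup.Gamma0 N).map (Matrix.SpecialLinearGroup.mapGL ℝ)) f g
  have hcont : Continuous fun τ => petersson k f g (γ • τ) :=
    (petersson_continuous k (CuspFormClass.holo f).continuous
      (CuspFormClass.holo g).continuous).comp (continuous_const_smul (Matrix.SpecialLinearGroup.mapGL ℝ γ))
  exact Measure.integrableOn_of_bounded volume_fd_lt_top.ne hcont.aestronglyMeasurable
    (Filter.Eventually.of_forall fun τ => hC _)

theorem peterssonInner_eq_sum [Fintype (SL(2, ℤ) ⧸ CongruenceSubgroup.Gamma0 N)]
    (f g : CuspForm (CongruenceSubgroup.Gamma0 N) k) : peterssonInner N k f g =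
    ∑ q : SL(2, ℤ) ⧸ CongruenceSubgroup.Gamma0 N,
      ∫ τ in (𝒟 : Set ℍ), petersson k f g (q.out⁻¹ • τ) :=
  finsum_eq_sum_of_fintype _

theorem petersson_self (f : ℍ → ℂ) (τ : ℍ) :
    petersson k f f τ = ((‖f τ‖ ^ 2 * τ.im ^ k : ℝ) : ℂ) := by
  rw [petersson, ← Complex.normSq_eq_conj_mul_self, Complex.normSq_eq_norm_sq]
  push_cast
  rfl

/-- A vanishing integral of a continuous nonnegative function gives zero on the open fundamental
domain, and the identity theorem spreads this to the whole half plane. One coset thus suffices for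
definiteness. -/
theorem eq_zero_of_integral_petersson [NeZero N] (f : CuspForm (CongruenceSubgroup.Gamma0 N) k)
    (γ : SL(2, ℤ)) (h : ∫ τ in (𝒟 : Set ℍ), ‖f (γ • τ)‖ ^ 2 * (γ • τ).im ^ k = 0) : f = 0 := by
  have hcont : Continuous fun τ => f (γ • τ) :=
    (CuspFormClass.holo f).continuous.comp (continuous_const_smul (Matrix.SpecialLinearGroup.mapGL ℝ γ))
  have hint := integrableOn_petersson f f γ
  simp_rw [petersson_self] at hint
  have hint' : IntegrableOn (fun τ => ‖f (γ • τ)‖ ^ 2 * (γ • τ).im ^ k) 𝒟 := by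
    exact hint.re
  have hpos : ∀ τ : ℍ, 0 < (γ • τ).im ^ k := fun τ => zpow_pos (γ • τ).im_pos k
  rw [setIntegral_eq_zero_iff_of_nonneg_ae (Filter.Eventually.of_forall fun τ =>
    mul_nonneg (sq_nonneg _) (hpos τ).le) hint', Filter.EventuallyEq, ae_iff] at h
  have hnull : volume ((𝒟ᵒ : Set ℍ) ∩ {τ | f (γ • τ) ≠ 0}) = 0 := by
    refine measure_mono_null ?_ (le_antisymm ((Measure.le_restrict_apply _ _).trans_eq h) bot_le)
    exact fun τ hτ => ⟨fun h0 => hτ.2 (pow_eq_zero_iff two_ne_zero |>.mp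
      ((mul_eq_zero.mp h0).resolve_right (hpos τ).ne') |> norm_eq_zero.mp), ModularGroup.fdo_subset_fd hτ.1⟩
  have hempty := isOpen_eq_empty_of_volume
    (ModularGroup.isOpen_fdo.inter (isOpen_ne_fun hcont continuous_const)) hnull
  have hzero : ∀ τ ∈ (𝒟ᵒ : Set ℍ), (⇑f ∣[k] γ) τ = 0 := fun τ hτ => by
    by_contra hne
    have : τ ∈ (∅ : Set ℍ) := by
      rw [← hempty]
      refine ⟨hτ, fun h0 => hne ?_⟩
      rw [ModularForm.SL_slash_apply, h0, zero_mul]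
    exact this
  have hI : (⟨2 * Complex.I, by simp⟩ : ℍ) ∈ (𝒟ᵒ : Set ℍ) := by
    constructor <;> simp [Complex.normSq_apply, UpperHalfPlane.re]
    norm_num
  have hslash : ⇑f ∣[k] γ = 0 := by
    refine eq_zero_of_frequently (τ := ⟨2 * Complex.I, by simp⟩) ((CuspFormClass.holo f).slash k _)
      (Filter.Eventually.frequently ?_)
    exact Filter.mem_of_superset (nhdsWithin_le_nhds (ModularGroup.isOpen_fdo.mem_nhds hI)) hzero
  apply DFunLike.coe_injective
  have e : ⇑f = (⇑f ∣[k] γ) ∣[k] γ⁻¹ := by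
    rw [← SlashAction.slash_mul, mul_inv_cancel, SlashAction.slash_one]
  rw [e, hslash, SlashAction.zero_slash]
  rfl

/-- The Petersson product is a positive definite Hermitian form, so only the dimension of the old
space remains to be found. -/
theorem newDim_add_finrank_oldSubspace [NeZero N]
    [FiniteDimensional ℂ (CuspForm (CongruenceSubgroup.Gamma0 N) k)] :
    newDim N k + Module.finrank ℂ (oldSubspace N k)
      = Module.finrank ℂ (CuspForm (CongruenceSubgroup.Gamma0 N) k) := by
  let : Fintype (SL(2, ℤ) ⧸ CongruenceSubgroup.Gamma0 N) := Fintype.ofFinite _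
  have key : ∀ f : CuspForm (CongruenceSubgroup.Gamma0 N) k, peterssonInner N k f f =
      ((∑ q : SL(2, ℤ) ⧸ CongruenceSubgroup.Gamma0 N,
        ∫ τ in (𝒟 : Set ℍ), ‖f (q.out⁻¹ • τ)‖ ^ 2 * (q.out⁻¹ • τ).im ^ k : ℝ) : ℂ) := fun f => by
    rw [peterssonInner_eq_sum]
    push_cast
    refine Finset.sum_congr rfl fun q _ => ?_
    simp_rw [petersson_self]
    exact integral_ofReal
  have nn : ∀ (f : CuspForm (CongruenceSubgroup.Gamma0 N) k) (γ : SL(2, ℤ)),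
      0 ≤ ∫ τ in (𝒟 : Set ℍ), ‖f (γ • τ)‖ ^ 2 * (γ • τ).im ^ k := fun f γ =>
    integral_nonneg fun τ => mul_nonneg (sq_nonneg _) (zpow_pos (γ • τ).im_pos k).le
  refine finrank_add_finrank_orthogonal_of_form (peterssonInner N k) ?_ ?_ ?_ ?_ ?_ _
  · intro f g
    simp_rw [peterssonInner_eq_sum, map_sum, ← integral_conj, ← petersson_symm]
  · intro f g h
    simp_rw [peterssonInner_eq_sum]
    rw [← Finset.sum_add_distrib]
    refine Finset.sum_congr rfl fun q _ => ?_
    rw [← integral_add (integrableOn_petersson f h _) (integrableOn_petersson g h _)]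
    congr 1
    funext τ
    simp [petersson]
    ring
  · intro f g r
    simp_rw [peterssonInner_eq_sum]
    rw [Finset.mul_sum]
    refine Finset.sum_congr rfl fun q _ => ?_
    rw [← integral_const_mul]
    congr 1
    funext τ
    simp [petersson]
    ring
  · intro f
    rw [key, Complex.ofReal_re]
    exact Finset.sum_nonneg fun q _ => nn f _
  · intro f hf
    rw [key, Complex.ofReal_eq_zero, Finset.sum_eq_zero_iff_of_nonneg fun q _ => nn f _] at hf
    exact eq_zero_of_integral_petersson f _ (hf (QuotientGroup.mk 1) (Finset.mem_univ _))

end Petersson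

end

end LevelTwo

namespace LevelTwo

noncomputable section

/-! ## Old and new dimensions in the levels `1`, `2` and `4` -/

section Dimensions

open UpperHalfPlane

variable {k : ℤ}

theorem petersson_dilate (G : ℍ → ℂ) (τ : ℍ) :
    petersson k (dilate k G) (dilate k G) τ = 2 ^ (k - 2) * petersson k G G (diagTwoReal • τ) := by
  have h := petersson_slash k G G diagTwoReal τ
  rw [det_diagTwoReal, σ, if_pos (by rw [det_diagTwoReal]; norm_num)] at h
  refine h.trans ?_
  simp

theorem petersson_smul_of_mem_top {F : ℍ → ℂ} (hF : F ∈ cuspSpace ⊤ k) (γ : SL(2, ℤ)) (τ : ℍ) :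
    petersson k F F (γ • τ) = petersson k F F τ := by
  rw [← petersson_slash_SL, hF.2 γ (Subgroup.mem_top _)]

theorem diagTwo_S_diagTwo (τ : ℍ) :
    diagTwoReal • ModularGroup.S • diagTwoReal • τ = ModularGroup.S • τ := by
  apply UpperHalfPlane.ext
  rw [coe_diagTwoReal_smul, modular_S_smul, modular_S_smul]
  change 2 * (-((diagTwoReal • τ : ℍ) : ℂ))⁻¹ = (-(τ : ℂ))⁻¹
  rw [coe_diagTwoReal_smul]
  have := τ.ne_zero
  field_simp

/-- Let Φ(τ) be the invariant function |G|² y^k. The corresponding function of the dilate is a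
multiple of Φ(2τ). Its invariance under `S` at the point 2τ compares Φ(4τ) with Φ(2 S(2τ)) = Φ(Sτ) =
Φ(τ). -/
theorem petersson_four {G : ℍ → ℂ} (hG : G ∈ cuspSpace ⊤ k) (hF : dilate k G ∈ cuspSpace ⊤ k)
    (τ : ℍ) : petersson k G G (diagTwoReal • diagTwoReal • τ) = petersson k G G τ := by
  have h1 := petersson_dilate (k := k) G (diagTwoReal • τ)
  have h2 := petersson_dilate (k := k) G (ModularGroup.S • diagTwoReal • τ)
  rw [petersson_smul_of_mem_top hF, h1, diagTwo_S_diagTwo, petersson_smul_of_mem_top hG] at h2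
  exact mul_left_cancel₀ (zpow_ne_zero _ two_ne_zero) h2

/-- The invariant function of `G` is unchanged under τ ↦ 4τ, yet tends to zero along 4ⁿτ, so it
vanishes. This is the independence of a level one form from the dilates of level one forms. -/
theorem eq_zero_of_dilate_mem {G : ℍ → ℂ} (hG : G ∈ cuspSpace ⊤ k)
    (hF : dilate k G ∈ cuspSpace ⊤ k) : G = 0 := by
  let g : CuspForm (⊤ : Subgroup SL(2, ℤ)) k := cuspFormOfMem hG
  obtain ⟨a, ha, hO⟩ := IsZeroAtImInfty.petersson_exp_decay_left k
    ((⊤ : Subgroup SL(2, ℤ)).map (Matrix.SpecialLinearGroup.mapGL ℝ)) (f := g)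
    (CuspFormClass.zero_at_infty g) g
  have hlim : Filter.Tendsto (petersson k G G) atImInfty (nhds 0) := by
    refine hO.trans_tendsto (Real.tendsto_exp_atBot.comp ?_)
    simp_rw [neg_mul]
    exact Filter.tendsto_neg_atTop_atBot.comp
      (Filter.Tendsto.const_mul_atTop ha Filter.tendsto_comap)
  funext τ
  let d : ℍ → ℍ := fun z => diagTwoReal • diagTwoReal • z
  have him : ∀ n : ℕ, (d^[n] τ).im = 4 ^ n * τ.im := fun n => by
    induction n with
    | zero => simp
    | succ n ih =>
      rw [Function.iterate_succ_apply']
      change ((diagTwoReal • diagTwoReal • (d^[n] τ) : ℍ) : ℂ).im = _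
      rw [coe_diagTwoReal_smul, coe_diagTwoReal_smul, pow_succ]
      simp only [Complex.mul_im, Complex.re_ofNat, Complex.im_ofNat, coe_im, ih, zero_mul, add_zero]
      ring
  have hinv : ∀ n : ℕ, petersson k G G (d^[n] τ) = petersson k G G τ := fun n => by
    induction n with
    | zero => rfl
    | succ n ih => rw [Function.iterate_succ_apply', petersson_four hG hF, ih]
  have htend : Filter.Tendsto (fun n : ℕ => d^[n] τ) Filter.atTop atImInfty := by
    refine Filter.tendsto_comap_iff.mpr ?_
    refine (Filter.Tendsto.congr (fun n => (him n).symm) ?_)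
    exact (tendsto_pow_atTop_atTop_of_one_lt (by norm_num)).atTop_mul_const τ.im_pos
  have h0 : petersson k G G τ = 0 := by
    refine tendsto_nhds_unique ?_ (hlim.comp htend)
    exact tendsto_const_nhds.congr fun n => (hinv n).symm
  rw [petersson_self, Complex.ofReal_eq_zero] at h0
  have := (mul_eq_zero.mp h0).resolve_right (zpow_pos τ.im_pos k).ne'
  exact norm_eq_zero.mp (pow_eq_zero_iff two_ne_zero |>.mp this)

/-- Cusp forms on `Γ`, as functions. -/
def cuspFormCoe (Γ : Subgroup SL(2, ℤ)) [Γ.FiniteIndex] (k : ℤ) : CuspForm Γ k →ₗ[ℂ] (ℍ → ℂ) :=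
  (cuspSpace Γ k).subtype ∘ₗ (cuspSpaceEquiv Γ k).toLinearMap

theorem cuspFormCoe_apply {Γ : Subgroup SL(2, ℤ)} [Γ.FiniteIndex] (f : CuspForm Γ k) :
    cuspFormCoe Γ k f = ⇑f := rfl

theorem cuspFormCoe_injective (Γ : Subgroup SL(2, ℤ)) [Γ.FiniteIndex] :
    Function.Injective (cuspFormCoe Γ k) :=
  Subtype.val_injective.comp (cuspSpaceEquiv Γ k).injective

theorem exists_cuspForm {Γ : Subgroup SL(2, ℤ)} [Γ.FiniteIndex] {F : ℍ → ℂ}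
    (hF : F ∈ cuspSpace Γ k) : ∃ f : CuspForm Γ k, ⇑f = F := ⟨cuspFormOfMem hF, rfl⟩

theorem exists_double (τ : ℍ) : ∃ τ' : ℍ, (τ' : ℂ) = 2 * (τ : ℂ) :=
  ⟨_, coe_diagTwoReal_smul τ⟩

theorem forall_double_iff {f g : ℍ → ℂ} :
    (∀ τ τ' : ℍ, (τ' : ℂ) = ((2 : ℕ) : ℂ) * (τ : ℂ) → g τ = f τ') ↔
      dilate k f = (2 : ℂ) ^ (k - 1) • g := by
  constructor
  · intro h
    funext τ
    obtain ⟨τ', hτ'⟩ := exists_double τ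
    rw [dilate_apply k f hτ', Pi.smul_apply, smul_eq_mul, h τ τ' (by exact_mod_cast hτ')]
  · intro h τ τ' hτ'
    have := congrFun h τ
    rw [dilate_apply k f (by exact_mod_cast hτ'), Pi.smul_apply, smul_eq_mul] at this
    exact (mul_left_cancel₀ (zpow_ne_zero _ two_ne_zero) this).symm

theorem dilate_mem_of_forall_four {f g : ℍ → ℂ}
    (h : ∀ τ τ' : ℍ, (τ' : ℂ) = ((4 : ℕ) : ℂ) * (τ : ℂ) → g τ = f τ') :
    dilate k (dilate k f) = ((2 : ℂ) ^ (k - 1) * 2 ^ (k - 1)) • g := by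
  funext τ
  obtain ⟨τ₁, h1⟩ := exists_double τ
  obtain ⟨τ₂, h2⟩ := exists_double τ₁
  rw [dilate_apply k _ h1, dilate_apply k f h2, Pi.smul_apply, smul_eq_mul,
    h τ τ₂ (by rw [h2, h1]; push_cast; ring), mul_assoc]

theorem Gamma0_one : CongruenceSubgroup.Gamma0 1 = ⊤ := by
  refine eq_top_iff.mpr fun γ _ => mem_Gamma0.mpr ?_
  simp

/-- The old space of level `4` comes from two copies of the forms of level `2`. -/
theorem map_oldSubspace_four (k : ℤ) :
    (oldSubspace 4 k).map (cuspFormCoe (CongruenceSubgroup.Gamma0 4) k)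
      = (cuspSpace GammaUpper k ⊔ cuspSpace (CongruenceSubgroup.Gamma0 2) k).map
        (dilate k).toLinearMap := by
  rw [Submodule.map_sup, map_dilate_GammaUpper]
  have hle : CongruenceSubgroup.Gamma0 4 ≤ CongruenceSubgroup.Gamma0 2 := fun γ hγ =>
    mem_Gamma0.mpr (dvd_trans (by norm_num) (mem_Gamma0.mp hγ))
  apply le_antisymm
  · rw [oldSubspace, Submodule.map_span, Submodule.span_le]
    rintro _ ⟨g, ⟨M, d, hMd, hM, f, h⟩, rfl⟩
    rw [SetLike.mem_coe, cuspFormCoe_apply]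
    have hM4 : M ∣ 4 := (Dvd.intro _ rfl).trans hMd
    have hM0 : M ≤ 4 := Nat.le_of_dvd (by norm_num) hM4
    have hd0 : d ≤ 4 := Nat.le_of_dvd (by norm_num) ((Dvd.intro_left _ rfl).trans hMd)
    have hM1 : M = 1 ∨ M = 2 := by
      interval_cases M <;> simp_all
    -- Forms of level 1 are also of level 2, so only dilation by 4 needs separate treatment.
    have hf : ⇑f ∈ cuspSpace (CongruenceSubgroup.Gamma0 2) k := by
      rcases hM1 with rfl | rfl
      · exact cuspSpace_mono (by rw [Gamma0_one]; exact le_top) k (coe_mem_cuspSpace f)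
      · exact coe_mem_cuspSpace f
    have hd : d = 1 ∨ d = 2 ∨ (d = 4 ∧ M = 1) := by
      rcases hM1 with rfl | rfl <;> interval_cases d <;> simp_all
    rcases hd with rfl | rfl | ⟨rfl, rfl⟩
    · have e : ⇑g = ⇑f := funext fun τ => h τ τ (by simp)
      rw [e]
      exact Submodule.mem_sup_left hf
    · refine Submodule.mem_sup_right ⟨((2 : ℂ) ^ (k - 1))⁻¹ • ⇑f, Submodule.smul_mem _ _ hf, ?_⟩
      rw [map_smul]
      change _ • dilate k ⇑f = _
      rw [forall_double_iff.mp h, inv_smul_smul₀ (zpow_ne_zero _ two_ne_zero)]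
    -- Dilation by 4 is dilation by 2 twice, and the first dilation of a form of level 1 has level
    -- 2.
    · refine Submodule.mem_sup_right ((Submodule.smul_mem_iff _ (mul_ne_zero
        (zpow_ne_zero (k - 1) (two_ne_zero (α := ℂ))) (zpow_ne_zero (k - 1) two_ne_zero))).mp ?_)
      rw [← dilate_mem_of_forall_four h]
      refine ⟨_, dilate_mem_of_top ?_, rfl⟩
      rw [← Gamma0_one]
      exact coe_mem_cuspSpace f
  · refine sup_le (fun F hF => ?_) ?_
    · obtain ⟨f, rfl⟩ := exists_cuspForm hF
      obtain ⟨g, hg⟩ := exists_cuspForm (cuspSpace_mono hle k hF)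
      refine ⟨g, Submodule.subset_span ⟨2, 1, by norm_num, by norm_num, f, fun τ τ' hτ => ?_⟩, hg⟩
      rw [hg, show τ' = τ from UpperHalfPlane.ext (by simpa using hτ)]
    · rintro _ ⟨F, hF, rfl⟩
      obtain ⟨f, rfl⟩ := exists_cuspForm hF
      have hm : dilate k ⇑f ∈ cuspSpace (CongruenceSubgroup.Gamma0 4) k := by
        refine dilate_mem (fun γ hγ => ?_) hF
        obtain ⟨c, hc⟩ := mem_Gamma0.mp hγ
        push_cast at hc
        exact ⟨⟨2 * c, by rw [hc]; ring⟩, fun δ _ h2 => mem_Gamma0.mpr ⟨c, by push_cast; linarith⟩⟩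
      obtain ⟨g, hg⟩ := exists_cuspForm (Submodule.smul_mem _ ((2 : ℂ) ^ (k - 1))⁻¹ hm)
      refine ⟨(2 : ℂ) ^ (k - 1) • g, Submodule.smul_mem _ _ (Submodule.subset_span
        ⟨2, 2, by norm_num, by norm_num, f, (forall_double_iff (k := k)).mpr ?_⟩), ?_⟩
      · rw [hg, smul_inv_smul₀ (zpow_ne_zero _ two_ne_zero)]
      · rw [map_smul, cuspFormCoe_apply, hg, smul_inv_smul₀ (zpow_ne_zero _ two_ne_zero)]
        rfl

/-- The old space of level `2` comes from two copies of the forms of level `1`. -/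
theorem map_oldSubspace_two (k : ℤ) :
    (oldSubspace 2 k).map (cuspFormCoe (CongruenceSubgroup.Gamma0 2) k)
      = cuspSpace ⊤ k ⊔ (cuspSpace ⊤ k).map (dilate k).toLinearMap := by
  apply le_antisymm
  · rw [oldSubspace, Submodule.map_span, Submodule.span_le]
    rintro _ ⟨g, ⟨M, d, hMd, hM, f, h⟩, rfl⟩
    rw [SetLike.mem_coe, cuspFormCoe_apply]
    have hM0 : M ≤ 2 := Nat.le_of_dvd (by norm_num) ((Dvd.intro _ rfl).trans hMd)
    have hd0 : d ≤ 2 := Nat.le_of_dvd (by norm_num) ((Dvd.intro_left _ rfl).trans hMd)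
    obtain rfl : M = 1 := by
      interval_cases M <;> simp_all
    have hf : ⇑f ∈ cuspSpace ⊤ k := by
      rw [← Gamma0_one]
      exact coe_mem_cuspSpace f
    have hd : d = 1 ∨ d = 2 := by
      interval_cases d <;> simp_all
    rcases hd with rfl | rfl
    · have e : ⇑g = ⇑f := funext fun τ => h τ τ (by simp)
      rw [e]
      exact Submodule.mem_sup_left hf
    · refine Submodule.mem_sup_right ⟨((2 : ℂ) ^ (k - 1))⁻¹ • ⇑f, Submodule.smul_mem _ _ hf, ?_⟩
      rw [map_smul]
      change _ • dilate k ⇑f = _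
      rw [forall_double_iff.mp h, inv_smul_smul₀ (zpow_ne_zero _ two_ne_zero)]
  · refine sup_le (fun F hF => ?_) ?_
    · obtain ⟨g, hg⟩ := exists_cuspForm (cuspSpace_mono (le_top (a := CongruenceSubgroup.Gamma0 2))
        k hF)
      rw [← Gamma0_one] at hF
      obtain ⟨f, rfl⟩ := exists_cuspForm hF
      refine ⟨g, Submodule.subset_span ⟨1, 1, by norm_num, by norm_num, f, fun τ τ' hτ => ?_⟩, hg⟩
      rw [hg, show τ' = τ from UpperHalfPlane.ext (by simpa using hτ)]
    · rintro _ ⟨F, hF, rfl⟩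
      have hm := dilate_mem_of_top hF
      rw [← Gamma0_one] at hF
      obtain ⟨f, rfl⟩ := exists_cuspForm hF
      obtain ⟨g, hg⟩ := exists_cuspForm (Submodule.smul_mem _ ((2 : ℂ) ^ (k - 1))⁻¹ hm)
      refine ⟨(2 : ℂ) ^ (k - 1) • g, Submodule.smul_mem _ _ (Submodule.subset_span
        ⟨1, 2, by norm_num, by norm_num, f, (forall_double_iff (k := k)).mpr ?_⟩), ?_⟩
      · rw [hg, smul_inv_smul₀ (zpow_ne_zero _ two_ne_zero)]
      · rw [map_smul, cuspFormCoe_apply, hg, smul_inv_smul₀ (zpow_ne_zero _ two_ne_zero)]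
        rfl

theorem oldSubspace_one (k : ℤ) : oldSubspace 1 k = ⊥ := by
  rw [oldSubspace, Submodule.span_eq_bot]
  rintro g ⟨M, d, hMd, hM, -⟩
  exact absurd (Nat.eq_one_of_mul_eq_one_right (Nat.dvd_one.mp hMd)) hM

theorem slash_inv_eq_self_iff (F : ℍ → ℂ) (γ : SL(2, ℤ)) : F ∣[k] γ⁻¹ = F ↔ F ∣[k] γ = F := by
  constructor <;> intro h
  · conv_lhs => rw [← h]
    rw [← SlashAction.slash_mul, inv_mul_cancel, SlashAction.slash_one]
  · conv_lhs => rw [← h]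
    rw [← SlashAction.slash_mul, mul_inv_cancel, SlashAction.slash_one]

theorem mem_ker_cuspRep_sub_one (γ : SL(2, ℤ)) (f : CuspForm Γ(2) k) :
    f ∈ LinearMap.ker (cuspRep k γ - 1) ↔ ⇑f ∣[k] γ = ⇑f := by
  rw [mem_ker_sub_one, ← slash_inv_eq_self_iff]
  exact DFunLike.coe_injective.eq_iff.symm

theorem map_ker_T (k : ℤ) :
    (LinearMap.ker (cuspRep k ModularGroup.T - 1)).map (cuspFormCoe Γ(2) k)
      = cuspSpace (CongruenceSubgroup.Gamma0 2) k := by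
  apply le_antisymm
  · rintro _ ⟨f, hf, rfl⟩
    exact mem_cuspSpace_Gamma0_two.mpr
      ⟨coe_mem_cuspSpace f, (mem_ker_cuspRep_sub_one _ f).mp hf⟩
  · intro F hF
    obtain ⟨h1, h2⟩ := mem_cuspSpace_Gamma0_two.mp hF
    obtain ⟨f, rfl⟩ := exists_cuspForm h1
    exact ⟨f, (mem_ker_cuspRep_sub_one _ f).mpr h2, rfl⟩

theorem map_ker_lower (k : ℤ) :
    (LinearMap.ker (cuspRep k lowerUnipotent - 1)).map (cuspFormCoe Γ(2) k)
      = cuspSpace GammaUpper k := by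
  apply le_antisymm
  · rintro _ ⟨f, hf, rfl⟩
    exact mem_cuspSpace_GammaUpper.mpr
      ⟨coe_mem_cuspSpace f, (mem_ker_cuspRep_sub_one _ f).mp hf⟩
  · intro F hF
    obtain ⟨h1, h2⟩ := mem_cuspSpace_GammaUpper.mp hF
    obtain ⟨f, rfl⟩ := exists_cuspForm h1
    exact ⟨f, (mem_ker_cuspRep_sub_one _ f).mpr h2, rfl⟩

instance (k : ℤ) : FiniteDimensional ℂ (cuspSpace Γ(2) k) :=
  (cuspSpaceEquiv Γ(2) k).finiteDimensional

theorem finrank_cuspForm (Γ : Subgroup SL(2, ℤ)) [Γ.FiniteIndex] (k : ℤ) :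
    Module.finrank ℂ (CuspForm Γ k) = Module.finrank ℂ (cuspSpace Γ k) :=
  (cuspSpaceEquiv Γ k).finrank_eq

theorem finiteDimensional_cuspForm {Γ : Subgroup SL(2, ℤ)} [Γ.FiniteIndex] (h : Γ(2) ≤ Γ) (k : ℤ) :
    FiniteDimensional ℂ (CuspForm Γ k) := by
  have := Submodule.finiteDimensional_of_le (cuspSpace_mono h k)
  exact (cuspSpaceEquiv Γ k).symm.finiteDimensional

theorem finrank_map_cuspFormCoe {Γ : Subgroup SL(2, ℤ)} [Γ.FiniteIndex]
    (U : Submodule ℂ (CuspForm Γ k)) :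
    Module.finrank ℂ (U.map (cuspFormCoe Γ k)) = Module.finrank ℂ U :=
  (Submodule.equivMapOfInjective _ (cuspFormCoe_injective Γ) U).finrank_eq.symm

theorem finrank_map_dilate (U : Submodule ℂ (ℍ → ℂ)) :
    Module.finrank ℂ (U.map (dilate k).toLinearMap) = Module.finrank ℂ U :=
  LinearEquiv.finrank_map_eq (dilate k) U

theorem newDim_one (k : ℤ) : newDim 1 k = Module.finrank ℂ (cuspSpace ⊤ k) := by
  have := finiteDimensional_cuspForm (Γ := CongruenceSubgroup.Gamma0 1)
    (by rw [Gamma0_one]; exact le_top) k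
  have h := newDim_add_finrank_oldSubspace (N := 1) (k := k)
  rw [oldSubspace_one, finrank_bot, add_zero, finrank_cuspForm] at h
  rw [h, Gamma0_one]

/-- The two copies of the level one space in the old space are disjoint by `eq_zero_of_dilate_mem`,
so the old dimension is 2d₁. -/
theorem newDim_two (k : ℤ) : 2 * newDim 1 k + newDim 2 k
    = Module.finrank ℂ (cuspSpace (CongruenceSubgroup.Gamma0 2) k) := by
  have := finiteDimensional_cuspForm Gamma_two_le_Gamma0 k
  have h := newDim_add_finrank_oldSubspace (N := 2) (k := k)
  have hfd : FiniteDimensional ℂ (cuspSpace ⊤ k) :=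
    Submodule.finiteDimensional_of_le (cuspSpace_mono (le_top (a := Γ(2))) k)
  have hd : Disjoint (cuspSpace ⊤ k) ((cuspSpace ⊤ k).map (dilate k).toLinearMap) := by
    rw [Submodule.disjoint_def]
    rintro _ h1 ⟨G, hG, rfl⟩
    change dilate k G = 0
    rw [eq_zero_of_dilate_mem hG h1, map_zero]
  have hs := Submodule.finrank_sup_add_finrank_inf_eq (cuspSpace ⊤ k)
    ((cuspSpace ⊤ k).map (dilate k).toLinearMap)
  rw [hd.eq_bot, finrank_bot, add_zero, ← map_oldSubspace_two, finrank_map_cuspFormCoe,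
    finrank_map_dilate, ← newDim_one] at hs
  rw [← finrank_cuspForm, ← h, hs]
  ring

/-- Dilation identifies level Γ(2) with level Γ₀(4), and under it the old space becomes the sum of
the fixed spaces of two transpositions. -/
theorem newDim_four (k : ℤ) : newDim 4 k + Module.finrank ℂ
      (cuspSpace GammaUpper k ⊔ cuspSpace (CongruenceSubgroup.Gamma0 2) k : Submodule ℂ (ℍ → ℂ))
    = Module.finrank ℂ (CuspForm Γ(2) k) := by
  have h4 : Module.finrank ℂ (CuspForm (CongruenceSubgroup.Gamma0 4) k)
      = Module.finrank ℂ (CuspForm Γ(2) k) := by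
    rw [finrank_cuspForm, finrank_cuspForm, ← map_dilate_Gamma_two, finrank_map_dilate]
  have : FiniteDimensional ℂ (CuspForm (CongruenceSubgroup.Gamma0 4) k) := by
    have : FiniteDimensional ℂ (cuspSpace (CongruenceSubgroup.Gamma0 4) k) := by
      rw [← map_dilate_Gamma_two]
      infer_instance
    exact (cuspSpaceEquiv _ k).symm.finiteDimensional
  have h := newDim_add_finrank_oldSubspace (N := 4) (k := k)
  rw [← finrank_map_cuspFormCoe, map_oldSubspace_four, finrank_map_dilate, h4] at h
  exact h

theorem cuspRep_braid (k : ℤ) :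
    cuspRep k ModularGroup.T * cuspRep k lowerUnipotent * cuspRep k ModularGroup.T
      = cuspRep k lowerUnipotent * cuspRep k ModularGroup.T * cuspRep k lowerUnipotent := by
  have hm : (lowerUnipotent * ModularGroup.T * lowerUnipotent)⁻¹ *
      (ModularGroup.T * lowerUnipotent * ModularGroup.T) ∈ Γ(2) :=
    mem_Gamma_two_of_even (by decide) (by decide)
  have h := cuspRep_eq_one (k := k) hm
  have e : ModularGroup.T * lowerUnipotent * ModularGroup.T
      = (lowerUnipotent * ModularGroup.T * lowerUnipotent) *
        ((lowerUnipotent * ModularGroup.T * lowerUnipotent)⁻¹ *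
          (ModularGroup.T * lowerUnipotent * ModularGroup.T)) := by group
  rw [← map_mul, ← map_mul, ← map_mul, ← map_mul, e, map_mul, h, mul_one]

theorem isCuspAction_cuspRep (k : ℤ) :
    IsCuspAction (cuspRep k ModularGroup.T) (cuspRep k lowerUnipotent)
      (newDim 1 k) (newDim 2 k) (newDim 4 k) := by
  refine isCuspAction_of_finrank (cuspRep_T_sq k) (cuspRep_lower_sq k) (cuspRep_braid k) ?_ ?_ ?_
  · rw [← finrank_map_cuspFormCoe, Submodule.map_inf _ (cuspFormCoe_injective _), map_ker_T,
      map_ker_lower, ← cuspSpace_top, newDim_one]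
  · rw [← finrank_map_cuspFormCoe, map_ker_T, newDim_two]
  · rw [← finrank_map_cuspFormCoe, Submodule.map_sup, map_ker_T, map_ker_lower, sup_comm,
      newDim_four]

end Dimensions

end

end LevelTwo

namespace LevelTwo

noncomputable section

/-! ## Series of holomorphic functions of several variables, and sums over `ℤⁿ` -/

section Series

open Metric

/-- Cauchy's estimate on the disc of radius `r` in each complex line through `x`. -/
theorem norm_fderiv_le_of_ball {E : Type*} [NormedAddCommGroup E] [NormedSpace ℂ E] {f : E → ℂ}
    {x : E} {r C : ℝ} (hr : 0 < r) (hf : ∀ y ∈ ball x (2 * r), DifferentiableAt ℂ f y)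
    (hC : ∀ y ∈ ball x (2 * r), ‖f y‖ ≤ C) : ‖fderiv ℂ f x‖ ≤ C / r := by
  have hx : x ∈ ball x (2 * r) := mem_ball_self (by linarith)
  have hC0 : 0 ≤ C := (norm_nonneg _).trans (hC x hx)
  refine ContinuousLinearMap.opNorm_le_of_unit_norm (div_nonneg hC0 hr.le) fun v hv => ?_
  have hmem : ∀ z ∈ closedBall (0 : ℂ) r, x + z • v ∈ ball x (2 * r) := fun z hz => by
    rw [mem_ball, dist_eq_norm, add_sub_cancel_left, norm_smul, hv, mul_one]
    rw [mem_closedBall, dist_zero_right] at hz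
    linarith
  have hd : ∀ z ∈ closedBall (0 : ℂ) r,
      HasDerivAt (fun z : ℂ => f (x + z • v)) (fderiv ℂ f (x + z • v) v) z := fun z hz => by
    have h1 : HasDerivAt (fun z : ℂ => x + z • v) v z := by
      simpa using ((hasDerivAt_id z).smul_const v).const_add x
    exact (hf _ (hmem z hz)).hasFDerivAt.comp_hasDerivAt z h1
  have h0 := hd 0 (mem_closedBall_self hr.le)
  rw [zero_smul, add_zero] at h0
  rw [← h0.deriv]
  refine Complex.norm_deriv_le_of_forall_mem_sphere_norm_le hr ?_ fun z hz =>
    hC _ (hmem z (sphere_subset_closedBall hz))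
  refine DifferentiableOn.diffContOnCl_ball (U := closedBall 0 r) (fun z hz =>
    (hd z hz).differentiableAt.differentiableWithinAt) subset_rfl

/-- A summable majorant of the terms also majorises their derivatives by Cauchy's estimate. The
radius 3r leaves a ball of radius 2r about each point of the ball of radius r. -/
theorem differentiableAt_tsum_of_norm_le {E : Type*} [NormedAddCommGroup E] [NormedSpace ℂ E]
    {ι : Type*} {f : ι → E → ℂ} {u : ι → ℝ} (hu : Summable u) {x : E} {r : ℝ} (hr : 0 < r)
    (hf : ∀ i, ∀ y ∈ ball x (3 * r), DifferentiableAt ℂ (f i) y)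
    (hle : ∀ i, ∀ y ∈ ball x (3 * r), ‖f i y‖ ≤ u i) :
    DifferentiableAt ℂ (fun y => ∑' i, f i y) x := by
  let : NormedSpace ℝ E := NormedSpace.restrictScalars ℝ ℂ E
  have hsub : ∀ y ∈ ball x r, ball y (2 * r) ⊆ ball x (3 * r) := fun y hy =>
    ball_subset_ball' (by rw [mem_ball] at hy; linarith)
  have hx : x ∈ ball x r := mem_ball_self hr
  have hx3 : x ∈ ball x (3 * r) := mem_ball_self (by linarith)
  exact (hasFDerivAt_tsum_of_isPreconnected (𝕜 := ℂ) (hu.div_const r) isOpen_ball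
    (convex_ball x r).isPreconnected
    (fun i y hy => (hf i y (hsub y hy (mem_ball_self (by linarith)))).hasFDerivAt)
    (fun i y hy => norm_fderiv_le_of_ball hr (fun z hz => hf i z (hsub y hy hz))
      fun z hz => hle i z (hsub y hy hz)) hx
    (Summable.of_norm_bounded hu fun i => hle i x hx3) hx).differentiableAt

/-- A vector of integers, as a real vector. -/
def intVec {ι : Type*} (l : ι → ℤ) : ι → ℝ := fun i => l i

theorem intVec_mem_span {ι : Type*} [Fintype ι] (l : ι → ℤ) :
    intVec l ∈ Submodule.span ℤ (Set.range (Pi.basisFun ℝ ι)) := by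
  rw [Module.Basis.mem_span_iff_repr_mem ℤ]
  exact fun i => ⟨l i, by simp [intVec]⟩

theorem finrank_span_basisFun (ι : Type*) [Fintype ι] :
    Module.finrank ℤ (Submodule.span ℤ (Set.range (Pi.basisFun ℝ ι))) = Fintype.card ι := by
  rw [ZLattice.rank ℝ (Submodule.span ℤ (Set.range (Pi.basisFun ℝ ι))),
    Module.finrank_fintype_fun_eq_card]

theorem summable_norm_intVec {ι : Type*} [Fintype ι] {s : ℝ} (hs : s < -Fintype.card ι) :
    Summable fun l : ι → ℤ => ‖intVec l‖ ^ s := by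
  have h := ZLattice.summable_norm_rpow (Submodule.span ℤ (Set.range (Pi.basisFun ℝ ι))) s
    (by rw [finrank_span_basisFun]; exact hs)
  have hinj : Function.Injective fun l : ι → ℤ =>
      (⟨intVec l, intVec_mem_span l⟩ : Submodule.span ℤ (Set.range (Pi.basisFun ℝ ι))) :=
    fun l l' e => by
      funext i
      exact Int.cast_injective (congrFun (congrArg Subtype.val e : intVec l = intVec l') i)
  have := h.comp_injective hinj
  exact this

end Series

end

end LevelTwo

namespace LevelTwo

noncomputable section

/-! ## The quadratic form that bounds the terms of the Klingen series -/

section RowForm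

open Metric

/-- The vector `(x, -y)`, where `(y, x)` is the row `c τ + d` for the row `l = (c, d)`. -/
def rowVec (τ : Matrix (Fin 2) (Fin 2) ℂ) (l : Fin 2 ⊕ Fin 2 → ℝ) : Fin 2 → ℂ :=
  ![l (Sum.inl 0) * τ 0 1 + l (Sum.inl 1) * τ 1 1 + l (Sum.inr 1),
    -(l (Sum.inl 0) * τ 0 0 + l (Sum.inl 1) * τ 1 0 + l (Sum.inr 0))]

/-- The value of `Im τ` at the vector `rowVec τ l`, a positive definite quadratic form in `l`. -/
def rowForm (τ : Matrix (Fin 2) (Fin 2) ℂ) (l : Fin 2 ⊕ Fin 2 → ℝ) : ℝ :=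
  (star (rowVec τ l) ⬝ᵥ τ.mulVec (rowVec τ l)).im

theorem rowVec_smul (τ : Matrix (Fin 2) (Fin 2) ℂ) (c : ℝ) (l : Fin 2 ⊕ Fin 2 → ℝ) :
    rowVec τ (c • l) = (c : ℂ) • rowVec τ l := by
  funext i
  fin_cases i <;> simp [rowVec] <;> ring

theorem rowForm_smul (τ : Matrix (Fin 2) (Fin 2) ℂ) (c : ℝ) (l : Fin 2 ⊕ Fin 2 → ℝ) :
    rowForm τ (c • l) = c ^ 2 * rowForm τ l := by
  have e : star (rowVec τ (c • l)) ⬝ᵥ τ.mulVec (rowVec τ (c • l))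
      = ((c ^ 2 : ℝ) : ℂ) * (star (rowVec τ l) ⬝ᵥ τ.mulVec (rowVec τ l)) := by
    rw [rowVec_smul, star_smul, Matrix.mulVec_smul, smul_dotProduct, dotProduct_smul]
    simp
    ring
  rw [rowForm, e, Complex.im_ofReal_mul]
  rfl

/-- The imaginary parts of the two entries are, up to sign, Im τ applied to the first half of `l`.
Since Im τ is invertible, that half vanishes, and then so does the other. -/
theorem rowVec_ne_zero (τ : SiegelHalfSpace) {l : Fin 2 ⊕ Fin 2 → ℝ} (hl : l ≠ 0) :
    rowVec τ.1 l ≠ 0 := by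
  intro h
  have h0 := congrFun h 0
  have h1 := congrFun h 1
  have hs : τ.1 1 0 = τ.1 0 1 := congrFun (congrFun τ.2.1 0) 1
  simp only [rowVec, Matrix.cons_val_zero, Matrix.cons_val_one, Pi.zero_apply, neg_eq_zero, hs]
    at h0 h1
  have hdet := τ.2.2.det_pos
  rw [Matrix.det_fin_two] at hdet
  simp only [Matrix.map_apply, hs] at hdet
  have i0 := congrArg Complex.im h0
  have i1 := congrArg Complex.im h1
  simp at i0 i1
  have z0 : l (Sum.inl 0) = 0 := by
    have : l (Sum.inl 0) * ((τ.1 0 0).im * (τ.1 1 1).im - (τ.1 0 1).im * (τ.1 0 1).im) = 0 := by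
      linear_combination (τ.1 1 1).im * i1 - (τ.1 0 1).im * i0
    exact (mul_eq_zero.mp this).resolve_right hdet.ne'
  have z1 : l (Sum.inl 1) = 0 := by
    have : l (Sum.inl 1) * ((τ.1 0 0).im * (τ.1 1 1).im - (τ.1 0 1).im * (τ.1 0 1).im) = 0 := by
      linear_combination (τ.1 0 0).im * i0 - (τ.1 0 1).im * i1
    exact (mul_eq_zero.mp this).resolve_right hdet.ne'
  simp only [z0, z1, Complex.ofReal_zero, zero_mul, zero_add, Complex.ofReal_eq_zero] at h0 h1
  apply hl
  funext i
  rcases i with i | i <;> fin_cases i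
  exacts [z0, z1, h1, h0]

theorem rowForm_pos (τ : SiegelHalfSpace) {l : Fin 2 ⊕ Fin 2 → ℝ} (hl : l ≠ 0) :
    0 < rowForm τ.1 l :=
  SiegelHalfSpace.im_pos τ (rowVec_ne_zero τ hl)

/-- The last row of a symplectic matrix. -/
def lastRow (γ : Sp4Z) : Fin 2 ⊕ Fin 2 → ℤ := γ.1 (Sum.inr 1)

theorem rowVec_lastRow (γ : Sp4Z) (τ : SiegelHalfSpace) :
    rowVec τ.1 (intVec (lastRow γ)) = ![siegelDen γ τ 1 1, -siegelDen γ τ 1 0] := by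
  funext i
  fin_cases i <;>
    simp [rowVec, intVec, lastRow, siegelDen, Matrix.mul_apply, Fin.sum_univ_two,
      Matrix.toBlocks₂₁, Matrix.toBlocks₂₂]

/-- The imaginary part of `(γ τ)₁₁`. -/
theorem im_entry_smul (γ : Sp4Z) (τ : SiegelHalfSpace) :
    ((γ • τ).1 0 0).im * ‖(siegelDen γ τ).det‖ ^ 2 = rowForm τ.1 (intVec (lastRow γ)) := by
  have hN : siegelNum γ τ = (γ • τ).1 * siegelDen γ τ := (SiegelHalfSpace.act_mul_den γ τ).symm
  -- The vector is the first column of the adjugate of c τ + d, so it is sent to (det, 0) and the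
  -- invariance of the imaginary form isolates the entry (γ τ)₁₁.
  have hD : (siegelDen γ τ).mulVec (rowVec τ.1 (intVec (lastRow γ)))
      = ![(siegelDen γ τ).det, 0] := by
    rw [rowVec_lastRow, Matrix.det_fin_two]
    funext i
    fin_cases i <;> simp [Matrix.mulVec, dotProduct, Fin.sum_univ_two] <;> ring
  rw [rowForm, ← SiegelHalfSpace.im_num_den γ τ, hN, ← Matrix.mulVec_mulVec, hD]
  have e : star ![(siegelDen γ τ).det, 0] ⬝ᵥ (γ • τ).1.mulVec ![(siegelDen γ τ).det, 0]
      = ((‖(siegelDen γ τ).det‖ ^ 2 : ℝ) : ℂ) * (γ • τ).1 0 0 := by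
    rw [← Complex.normSq_eq_norm_sq, Complex.normSq_eq_conj_mul_self]
    simp [Matrix.mulVec, dotProduct, Fin.sum_univ_two]
    ring
  rw [e, Complex.im_ofReal_mul, mul_comm]

theorem lastRow_ne_zero (γ : Sp4Z) : intVec (lastRow γ) ≠ 0 := by
  intro h
  let τ : SiegelHalfSpace := ⟨Complex.I • 1, by
    constructor
    · simp
    · have : (Complex.I • (1 : Matrix (Fin 2) (Fin 2) ℂ)).map Complex.im = 1 := by
        ext i j
        fin_cases i <;> fin_cases j <;> simp
      rw [this]
      exact Matrix.PosDef.one⟩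
  have h1 := im_entry_smul γ τ
  rw [h] at h1
  have h2 : rowForm τ.1 0 = 0 := by simp [rowForm, rowVec]
  rw [h2] at h1
  have h3 : 0 < ‖(siegelDen γ τ).det‖ := norm_pos_iff.mpr (SiegelHalfSpace.isUnit_den γ τ).ne_zero
  exact (mul_pos (im_entry_pos (γ • τ)) (pow_pos h3 2)).ne' h1

/-- The bound |f(z)| ≤ C y^(-w/2) combines with the factor |det|^(-w) to a power of Im (γτ)₁₁ ·
|det|², and that product depends on `γ` only through its last row. -/
theorem norm_siegelSlash_klingenLift_le {w : ℤ} {f : CuspForm Γ(2) w} {C : ℝ}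
    (hC : ∀ z : UpperHalfPlane, ‖f z‖ ≤ C / z.im ^ (w / 2 : ℝ)) (γ : Sp4Z) (τ : SiegelHalfSpace) :
    ‖siegelSlash w γ (klingenLift f) τ‖
      ≤ C * rowForm τ.1 (intVec (lastRow γ)) ^ (-(w / 2 : ℝ)) := by
  have h3 : 0 < ‖(siegelDen γ τ).det‖ := norm_pos_iff.mpr (SiegelHalfSpace.isUnit_den γ τ).ne_zero
  have hi := im_entry_pos (γ • τ)
  rw [siegelSlash, norm_mul, norm_zpow, ← im_entry_smul]
  refine (mul_le_mul_of_nonneg_left (hC _) (zpow_nonneg h3.le _)).trans_eq ?_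
  change _ * (C / ((γ • τ).1 0 0).im ^ (w / 2 : ℝ)) = _
  rw [Real.mul_rpow hi.le (by positivity), ← Real.rpow_natCast, ← Real.rpow_mul h3.le,
    Real.rpow_neg hi.le, ← Real.rpow_intCast]
  have e : ((2 : ℕ) : ℝ) * -(w / 2 : ℝ) = ((-w : ℤ) : ℝ) := by push_cast; ring
  rw [e]
  ring

/-- The coordinates of the points of the Siegel upper half space. -/
def siegelDomain : Set (Fin 3 → ℂ) := {p | ((symMat p).map Complex.im).PosDef}

theorem symMat_transpose (p : Fin 3 → ℂ) : (symMat p).transpose = symMat p := by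
  ext i j
  fin_cases i <;> fin_cases j <;> rfl

/-- The point with given coordinates. -/
def siegelPoint (p : Fin 3 → ℂ) (hp : p ∈ siegelDomain) : SiegelHalfSpace :=
  ⟨symMat p, symMat_transpose p, hp⟩

theorem exists_siegelPoint (τ : SiegelHalfSpace) : ∃ p hp, siegelPoint p hp = τ := by
  have hs : τ.1 1 0 = τ.1 0 1 := congrFun (congrFun τ.2.1 0) 1
  have e : symMat ![τ.1 0 0, τ.1 0 1, τ.1 1 1] = τ.1 := by
    ext i j
    fin_cases i <;> fin_cases j <;> simp [symMat, hs]
  refine ⟨![τ.1 0 0, τ.1 0 1, τ.1 1 1], ?_, Subtype.ext e⟩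
  change ((symMat _).map Complex.im).PosDef
  rw [e]
  exact τ.2.2

theorem mem_siegelDomain (p : Fin 3 → ℂ) :
    p ∈ siegelDomain ↔ 0 < (p 0).im ∧ 0 < (p 0).im * (p 2).im - (p 1).im * (p 1).im := by
  constructor
  · intro h
    have h1 := h.diag_pos (i := 0)
    have h2 := h.det_pos
    rw [Matrix.det_fin_two] at h2
    exact ⟨h1, h2⟩
  · rintro ⟨h1, h2⟩
    refine Matrix.PosDef.of_dotProduct_mulVec_pos ?_ fun x hx => ?_
    · change ((symMat p).map Complex.im).conjTranspose = _
      rw [Matrix.conjTranspose_eq_transpose_of_trivial, ← Matrix.transpose_map, symMat_transpose]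
    · have e : star x ⬝ᵥ ((symMat p).map Complex.im).mulVec x
          = (p 0).im * x 0 ^ 2 + 2 * (p 1).im * x 0 * x 1 + (p 2).im * x 1 ^ 2 := by
        simp [symMat, dotProduct, Matrix.mulVec, Fin.sum_univ_two]
        ring
      rw [e]
      have h3 : (p 0).im * ((p 0).im * x 0 ^ 2 + 2 * (p 1).im * x 0 * x 1 + (p 2).im * x 1 ^ 2)
          = ((p 0).im * x 0 + (p 1).im * x 1) ^ 2
            + ((p 0).im * (p 2).im - (p 1).im * (p 1).im) * x 1 ^ 2 := by ring
      refine pos_of_mul_pos_right (a := (p 0).im) ?_ h1.le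
      rw [h3]
      by_cases hx1 : x 1 = 0
      · have hx0 : x 0 ≠ 0 := fun h0 => hx (by
          funext i; fin_cases i
          exacts [h0, hx1])
        rw [hx1]
        have : 0 < ((p 0).im * x 0) ^ 2 := by positivity
        simpa using this
      · have := mul_pos h2 (show 0 < x 1 ^ 2 by positivity)
        positivity

theorem isOpen_siegelDomain : IsOpen siegelDomain := by
  have : siegelDomain = {p | 0 < (p 0).im} ∩
      {p | 0 < (p 0).im * (p 2).im - (p 1).im * (p 1).im} := Set.ext mem_siegelDomain
  rw [this]
  exact (isOpen_lt (by fun_prop) (by fun_prop)).inter (isOpen_lt (by fun_prop) (by fun_prop))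

theorem continuous_rowForm : Continuous fun x : (Fin 3 → ℂ) × (Fin 2 ⊕ Fin 2 → ℝ) =>
    rowForm (symMat x.1) x.2 := by
  simp only [rowForm, rowVec, symMat, dotProduct, Matrix.mulVec, Fin.sum_univ_two, Pi.star_apply,
    Matrix.cons_val_zero, Matrix.cons_val_one, Matrix.of_apply, Matrix.cons_val', Matrix.cons_val_fin_one]
  fun_prop

/-- Locally uniformly, the form is bounded below by a multiple of the square of the norm. -/
theorem exists_rowForm_bound {p : Fin 3 → ℂ} (hp : p ∈ siegelDomain) :
    ∃ r > 0, ∃ c > 0, ball p (3 * r) ⊆ siegelDomain ∧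
      ∀ p' ∈ ball p (3 * r), ∀ l, c * ‖l‖ ^ 2 ≤ rowForm (symMat p') l := by
  obtain ⟨R, hR, hball⟩ := nhds_basis_closedBall.mem_iff.mp (isOpen_siegelDomain.mem_nhds hp)
  have hK : IsCompact (closedBall p R ×ˢ sphere (0 : Fin 2 ⊕ Fin 2 → ℝ) 1) :=
    (isCompact_closedBall p R).prod (isCompact_sphere 0 1)
  have hne : (closedBall p R ×ˢ sphere (0 : Fin 2 ⊕ Fin 2 → ℝ) 1).Nonempty :=
    ⟨(p, fun _ => 1), mem_closedBall_self hR.le, by simp⟩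
  -- The constant is the minimum of the form over a compact neighbourhood times the unit sphere,
  -- positive by definiteness; homogeneity of degree 2 extends the bound to all `l`.
  obtain ⟨⟨p₀, l₀⟩, ⟨h1, h2⟩, hmin⟩ := hK.exists_isMinOn hne continuous_rowForm.continuousOn
  have hl₀ : l₀ ≠ 0 := by
    rintro rfl
    simp at h2
  refine ⟨R / 3, by positivity, rowForm (symMat p₀) l₀,
    rowForm_pos (siegelPoint p₀ (hball h1)) hl₀, ?_, ?_⟩
  · rw [show 3 * (R / 3) = R by ring]
    exact ball_subset_closedBall.trans hball
  · rw [show 3 * (R / 3) = R by ring]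
    intro p' hp' l
    by_cases hl : l = 0
    · simp [hl, rowForm, rowVec]
    · have hn : 0 < ‖l‖ := norm_pos_iff.mpr hl
      have hs : ‖l‖⁻¹ • l ∈ sphere (0 : Fin 2 ⊕ Fin 2 → ℝ) 1 := by
        rw [mem_sphere_zero_iff_norm, norm_smul, norm_inv, norm_norm, inv_mul_cancel₀ hn.ne']
      have h3 : rowForm (symMat p₀) l₀ ≤ rowForm (symMat p') (‖l‖⁻¹ • l) :=
        isMinOn_iff.mp hmin (p', ‖l‖⁻¹ • l) (Set.mk_mem_prod (ball_subset_closedBall hp') hs)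
      rw [rowForm_smul] at h3
      calc _ ≤ ‖l‖⁻¹ ^ 2 * rowForm (symMat p') l * ‖l‖ ^ 2 := by gcongr
        _ = _ := by field_simp

end RowForm

end

end LevelTwo

namespace LevelTwo

noncomputable section

/-! ## Klingen-Eisenstein series -/

section KlingenSeries

open Metric

theorem lastRow_mul (γ δ : Sp4Z) : lastRow (γ * δ) = Matrix.vecMul (lastRow γ) δ.1 := by
  funext j
  rfl

/-- By the symplectic relation the last row of `γ` is, up to signs and order, the second column of
`γ⁻¹`. So `γ⁻¹` multiplies the second basis vector by an integer, which must be a unit. -/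
theorem mem_klingen_of_lastRow {γ : Sp4Z} (h : ∀ j, j ≠ Sum.inr 1 → γ.1 (Sum.inr 1) j = 0) :
    γ ∈ klingen := by
  have hinv : (γ⁻¹).1 = -(Matrix.J (Fin 2) ℤ * γ.1.transpose * Matrix.J (Fin 2) ℤ) := by
    rw [SymplecticGroup.coe_inv]; simp
  have hcol : (γ⁻¹).1.mulVec klingenVec = γ.1 (Sum.inr 1) (Sum.inr 1) • klingenVec := by
    have r0 := h (Sum.inl 0) (by decide)
    have r1 := h (Sum.inl 1) (by decide)
    have r2 := h (Sum.inr 0) (by decide)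
    funext i
    rw [hinv]
    rcases i with i | i <;> fin_cases i <;>
      simp [klingenVec, Matrix.mul_apply, Matrix.J, Matrix.one_apply, r0, r1, r2]
  have hone : γ.1.mulVec ((γ⁻¹).1.mulVec klingenVec) = klingenVec := by
    rw [Matrix.mulVec_mulVec]
    have : γ.1 * (γ⁻¹).1 = 1 := congrArg Subtype.val (mul_inv_cancel γ)
    rw [this, Matrix.one_mulVec]
  rw [hcol, Matrix.mulVec_smul] at hone
  have hu := congrFun hone (Sum.inl 1)
  have hu' : γ.1 (Sum.inr 1) (Sum.inr 1) * (γ.1.mulVec klingenVec) (Sum.inl 1) = 1 := by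
    simpa [klingenVec] using hu
  rw [← inv_mem_iff]
  rcases Int.isUnit_iff.mp (IsUnit.of_mul_eq_one _ hu') with h1 | h1
  · exact Or.inl (by rw [hcol, h1, one_smul])
  · exact Or.inr (by rw [hcol, h1, neg_smul, one_smul])

theorem lastRow_unit (p : klingen) : p.1.1 (Sum.inr 1) (Sum.inr 1) = 1 ∨
    p.1.1 (Sum.inr 1) (Sum.inr 1) = -1 := by
  have h := SymplecticGroup.mem_iff'.mp p.1.2
  have h' := congrFun (congrFun h (Sum.inl 1)) (Sum.inr 1)
  have c0 := klingen_col p (Sum.inl 0) (by decide)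
  have c1 := klingen_col p (Sum.inr 0) (by decide)
  have c2 := klingen_col p (Sum.inr 1) (by decide)
  simp [Matrix.mul_apply, Matrix.J, Fin.sum_univ_two, Matrix.one_apply, c0, c1, c2] at h'
  exact Int.isUnit_iff.mp (IsUnit.of_mul_eq_one _ (by rw [mul_comm]; exact h'))

variable {w : ℤ}

/-- The translates of the lift of an elliptic cusp form. -/
def klingenTerm (f : CuspForm Γ(2) w) (γ : Sp4Z) : SiegelHalfSpace → ℂ :=
  siegelSlash w γ (klingenLift f)

theorem klingenTerm_mul (f : CuspForm Γ(2) w) (γ δ : Sp4Z) (τ : SiegelHalfSpace) :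
    klingenTerm f (γ * δ) τ = (siegelDen δ τ).det ^ (-w) * klingenTerm f γ (δ • τ) := by
  rw [klingenTerm, siegelSlash_mul]
  rfl

/-- For `p` in the parabolic, (pτ)₁₁ depends only on τ₁₁ and is moved by the block of `p`, and
det(cτ + d) is the automorphy factor of the block up to a sign. An even weight removes the sign. -/
theorem siegelSlash_klingenLift (hw : Even w) (f : CuspForm Γ(2) w) (p : klingen) :
    siegelSlash w p.1 (klingenLift f)
      = klingenLift (cuspRep w (klingenBlock p)⁻¹ f) := by
  funext τ
  have c0 := klingen_col p (Sum.inl 0) (by decide)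
  have c1 := klingen_col p (Sum.inr 0) (by decide)
  have r0 := klingen_row p (Sum.inl 0) (by decide)
  have r1 := klingen_row p (Sum.inl 1) (by decide)
  have r2 := klingen_row p (Sum.inr 0) (by decide)
  let z : UpperHalfPlane := ⟨τ.1 0 0, im_entry_pos τ⟩
  obtain ⟨g, hg⟩ : ∃ g, g = klingenBlock p := ⟨_, rfl⟩
  have g00 : g 0 0 = p.1.1 (Sum.inl 0) (Sum.inl 0) := by rw [hg]; rfl
  have g01 : g 0 1 = p.1.1 (Sum.inl 0) (Sum.inr 0) := by rw [hg]; rfl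
  have g10 : g 1 0 = p.1.1 (Sum.inr 0) (Sum.inl 0) := by rw [hg]; rfl
  have g11 : g 1 1 = p.1.1 (Sum.inr 0) (Sum.inr 0) := by rw [hg]; rfl
  rw [← hg]
  have hD00 : siegelDen p.1 τ 0 0 = UpperHalfPlane.denom g z := by
    simp [siegelDen, Matrix.mul_apply, Fin.sum_univ_two, Matrix.toBlocks₂₁, Matrix.toBlocks₂₂, c1,
      UpperHalfPlane.denom, g10, g11, z]
  have hN00 : siegelNum p.1 τ 0 0 = UpperHalfPlane.num g z := by
    simp [siegelNum, Matrix.mul_apply, Fin.sum_univ_two, Matrix.toBlocks₁₁, Matrix.toBlocks₁₂, c0,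
      UpperHalfPlane.num, g00, g01, z]
  have hD10 : siegelDen p.1 τ 1 0 = 0 := by
    simp [siegelDen, Matrix.mul_apply, Fin.sum_univ_two, Matrix.toBlocks₂₁, Matrix.toBlocks₂₂, r0,
      r1, r2]
  have hD11 : siegelDen p.1 τ 1 1 = (p.1.1 (Sum.inr 1) (Sum.inr 1) : ℂ) := by
    simp [siegelDen, Matrix.mul_apply, Fin.sum_univ_two, Matrix.toBlocks₂₁, Matrix.toBlocks₂₂, r0,
      r1]
  have hdet : (siegelDen p.1 τ).det ^ (-w) = UpperHalfPlane.denom g z ^ (-w) := by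
    rw [Matrix.det_fin_two, hD00, hD10, hD11, mul_zero, sub_zero, mul_zpow]
    rcases lastRow_unit p with h | h <;> rw [h] <;> simp [hw.neg.neg_one_zpow]
  have hact : (p.1 • τ).1 0 0 = ((g • z : UpperHalfPlane) : ℂ) := by
    have h1 := congrFun (congrFun (SiegelHalfSpace.act_mul_den p.1 τ) 0) 0
    rw [Matrix.mul_apply, Fin.sum_univ_two, hD10, mul_zero, add_zero, hD00, hN00] at h1
    have h2 : ((g • z : UpperHalfPlane) : ℂ)
        = UpperHalfPlane.num g z / UpperHalfPlane.denom g z :=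
      UpperHalfPlane.coe_smul_of_det_pos (by simp) z
    rw [h2, ← h1, mul_div_cancel_right₀ _ (UpperHalfPlane.denom_ne_zero g z)]
    rfl
  change (siegelDen p.1 τ).det ^ (-w) * f ⟨(p.1 • τ).1 0 0, _⟩ = (⇑f ∣[w] g⁻¹⁻¹) z
  rw [inv_inv, ModularForm.SL_slash_apply, hdet, mul_comm]
  congr 2
  exact UpperHalfPlane.ext hact

theorem klingenTerm_klingen_mul (hw : Even w) (f : CuspForm Γ(2) w) (p : klingen) (δ : Sp4Z) :
    klingenTerm f (p.1 * δ) = klingenTerm (cuspRep w (klingenBlock p)⁻¹ f) δ := by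
  rw [klingenTerm, siegelSlash_mul, siegelSlash_klingenLift hw]
  rfl

theorem klingenTerm_congr (hw : Even w) (f : CuspForm Γ(2) w) (p : klingen)
    (hp : p.1 ∈ siegelGamma2) (δ : Sp4Z) : klingenTerm f (p.1 * δ) = klingenTerm f δ := by
  rw [klingenTerm_klingen_mul hw, cuspRep_eq_one (inv_mem (klingenBlock_mem_Gamma hp))]
  rfl

/-- The cosets over which the Klingen series is summed. -/
abbrev KlingenCosets := siegelGamma2 ⧸ klingen.subgroupOf siegelGamma2

/-- The representative of a coset. -/
def cosetRep (q : KlingenCosets) : Sp4Z := ((q.out : siegelGamma2)⁻¹ : siegelGamma2).1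

theorem cosetRep_mem (q : KlingenCosets) : cosetRep q ∈ siegelGamma2 :=
  ((q.out : siegelGamma2)⁻¹ : siegelGamma2).2

/-- The terms do not depend on the chosen representatives, so sums over cosets can be reindexed. -/
theorem klingenTerm_cosetRep_mk (hw : Even w) (f : CuspForm Γ(2) w) (g : siegelGamma2) (δ : Sp4Z) :
    klingenTerm f (cosetRep (QuotientGroup.mk g) * δ) = klingenTerm f ((g⁻¹ : siegelGamma2).1 * δ) := by
  obtain ⟨h, hh⟩ := QuotientGroup.mk_out_eq_mul (klingen.subgroupOf siegelGamma2) g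
  have hk : ((h : siegelGamma2)⁻¹ : siegelGamma2).1 ∈ klingen := inv_mem (Subgroup.mem_subgroupOf.mp h.2)
  rw [cosetRep, hh, mul_inv_rev]
  have := klingenTerm_congr hw f ⟨_, hk⟩ ((h : siegelGamma2)⁻¹).2 ((g⁻¹ : siegelGamma2).1 * δ)
  rw [← this, ← mul_assoc]
  rfl

theorem mk_eq_of_klingen {g h : siegelGamma2} (hk : (g⁻¹ * h).1 ∈ klingen) :
    (QuotientGroup.mk g : KlingenCosets) = QuotientGroup.mk h :=
  QuotientGroup.eq.mpr (Subgroup.mem_subgroupOf.mpr hk)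

theorem eq_of_cosetRep {q q' : KlingenCosets} (h : cosetRep q * (cosetRep q')⁻¹ ∈ klingen) :
    q = q' := by
  rw [← QuotientGroup.out_eq' q, ← QuotientGroup.out_eq' q']
  refine mk_eq_of_klingen ?_
  have e : ((q.out)⁻¹ * q'.out : siegelGamma2).1 = cosetRep q * (cosetRep q')⁻¹ := by
    simp [cosetRep]
  rw [e]
  exact h

/-- Two matrices with the same last row differ by a left factor whose last row is that of the
identity, hence by an element of the parabolic. The series is thereby dominated by a sum over ℤ⁴. -/
theorem lastRow_cosetRep_injective (γ : Sp4Z) :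
    Function.Injective fun q : KlingenCosets => lastRow (cosetRep q * γ) := by
  intro q q' h
  have h : lastRow (cosetRep q * γ) = lastRow (cosetRep q' * γ) := h
  refine eq_of_cosetRep (mem_klingen_of_lastRow fun j hj => ?_)
  have e : cosetRep q * (cosetRep q')⁻¹ = (cosetRep q * γ) * (cosetRep q' * γ)⁻¹ := by group
  have h1 : lastRow (cosetRep q * (cosetRep q')⁻¹)
      = lastRow ((cosetRep q' * γ) * (cosetRep q' * γ)⁻¹) := by
    rw [e, lastRow_mul, h, ← lastRow_mul]
  rw [mul_inv_cancel] at h1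
  have := congrFun h1 j
  change (cosetRep q * (cosetRep q')⁻¹).1 (Sum.inr 1) j = (1 : Matrix _ _ ℤ) (Sum.inr 1) j at this
  rw [this, Matrix.one_apply_ne hj.symm]

theorem summable_klingenBound (hw : 6 ≤ w) (γ : Sp4Z) (C c : ℝ) (hc : 0 < c) :
    Summable fun q : KlingenCosets =>
      C * (c * ‖intVec (lastRow (cosetRep q * γ))‖ ^ 2) ^ (-(w / 2 : ℝ)) := by
  refine Summable.mul_left C ?_
  have hw' : (6 : ℝ) ≤ w := by exact_mod_cast hw
  have h : Summable fun l : Fin 2 ⊕ Fin 2 → ℤ => ‖intVec l‖ ^ (-(w : ℝ)) :=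
    summable_norm_intVec (by simp; linarith)
  have h2 := (h.comp_injective (lastRow_cosetRep_injective γ)).mul_left (c ^ (-(w / 2 : ℝ)))
  refine h2.congr fun q => ?_
  rw [Real.mul_rpow hc.le (by positivity), ← Real.rpow_natCast, ← Real.rpow_mul (norm_nonneg _)]
  have e : ((2 : ℕ) : ℝ) * -(w / 2 : ℝ) = -(w : ℝ) := by push_cast; ring
  rw [e]
  rfl

/-- One locally uniform summable majorant serves both convergence and holomorphy. The sum over ℤ⁴ of
‖l‖^(-w) needs w > 4, and below weight 6 the cusp form is zero. -/
theorem exists_klingen_bound (f : CuspForm Γ(2) w) (γ : Sp4Z) {p : Fin 3 → ℂ}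
    (hp : p ∈ siegelDomain) : ∃ r > 0, ball p (3 * r) ⊆ siegelDomain ∧
      ∃ u : KlingenCosets → ℝ, Summable u ∧ ∀ q, ∀ p' ∈ ball p (3 * r), ∀ hp',
        ‖klingenTerm f (cosetRep q * γ) (siegelPoint p' hp')‖ ≤ u q := by
  obtain ⟨r, hr, c, hc, hball, hb⟩ := exists_rowForm_bound hp
  refine ⟨r, hr, hball, ?_⟩
  rcases lt_or_ge w 6 with hw | hw
  · rw [Gamma_two_eq_zero hw f]
    exact ⟨0, summable_zero, fun q p' _ hp' => by simp [klingenTerm, siegelSlash, klingenLift]⟩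
  · obtain ⟨C, hC⟩ := CuspFormClass.exists_bound f
    have hC0 : 0 ≤ C := by
      have h1 := (norm_nonneg _).trans (hC UpperHalfPlane.I)
      simpa using h1
    refine ⟨_, summable_klingenBound hw γ C c hc, fun q p' hp1 hp' => ?_⟩
    refine (norm_siegelSlash_klingenLift_le hC _ _).trans (mul_le_mul_of_nonneg_left ?_ hC0)
    have hn : 0 < ‖intVec (lastRow (cosetRep q * γ))‖ := norm_pos_iff.mpr (lastRow_ne_zero _)
    have hw' : (6 : ℝ) ≤ w := by exact_mod_cast hw
    exact Real.rpow_le_rpow_of_nonpos (by positivity) (hb p' hp1 _) (by linarith)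

/-- The Klingen series of a cusp form. -/
def klingenSeries (f : CuspForm Γ(2) w) : SiegelHalfSpace → ℂ :=
  fun τ => ∑' q : KlingenCosets, klingenTerm f (cosetRep q) τ

theorem summable_klingenTerm (f : CuspForm Γ(2) w) (γ : Sp4Z) (τ : SiegelHalfSpace) :
    Summable fun q : KlingenCosets => klingenTerm f (cosetRep q * γ) τ := by
  obtain ⟨p, hp, rfl⟩ := exists_siegelPoint τ
  obtain ⟨r, hr, -, u, hu, hle⟩ := exists_klingen_bound f γ hp
  exact Summable.of_norm_bounded hu fun q => hle q p (mem_ball_self (by linarith)) hp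

theorem isKlingenSeries_klingenSeries (f : CuspForm Γ(2) w) :
    IsKlingenSeries w f (klingenSeries f) := fun τ => by
  have := (summable_klingenTerm f 1 τ).hasSum
  simp only [mul_one] at this
  exact this

theorem IsKlingenSeries.eq {f : CuspForm Γ(2) w} {F : SiegelHalfSpace → ℂ}
    (h : IsKlingenSeries w f F) : F = klingenSeries f :=
  funext fun τ => (h τ).unique (isKlingenSeries_klingenSeries f τ)

theorem siegelSlash_klingenSeries (f : CuspForm Γ(2) w) (γ : Sp4Z) (τ : SiegelHalfSpace) :
    siegelSlash w γ (klingenSeries f) τ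
      = ∑' q : KlingenCosets, klingenTerm f (cosetRep q * γ) τ := by
  simp_rw [klingenTerm_mul]
  rw [tsum_mul_left]
  rfl

/-- Right translation by an element of Γ[2] permutes the cosets. -/
theorem siegelSlash_klingenSeries_of_mem (hw : Even w) (f : CuspForm Γ(2) w) {γ : Sp4Z}
    (hγ : γ ∈ siegelGamma2) : siegelSlash w γ (klingenSeries f) = klingenSeries f := by
  funext τ
  rw [siegelSlash_klingenSeries, klingenSeries]
  let g : siegelGamma2 := ⟨γ, hγ⟩
  rw [← (MulAction.toPerm g⁻¹ : Equiv.Perm KlingenCosets).tsum_eq fun q =>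
    klingenTerm f (cosetRep q) τ]
  refine tsum_congr fun q => ?_
  have h1 : (MulAction.toPerm g⁻¹ : Equiv.Perm KlingenCosets) q
      = QuotientGroup.mk (g⁻¹ * q.out) := by
    conv_lhs => rw [← QuotientGroup.out_eq' q]
    rfl
  have h2 := klingenTerm_cosetRep_mk hw f (g⁻¹ * q.out) 1
  rw [mul_one, mul_one] at h2
  rw [h1, h2]
  congr 1
  simp [cosetRep, g]

instance : siegelGamma2.Normal := MonoidHom.normal_ker _

/-- The bijection of the cosets given by conjugation by an element of the parabolic. -/
def conjCosets (p : klingen) : KlingenCosets ≃ KlingenCosets :=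
  Quotient.congr (MulAut.conjNormal p.1 : siegelGamma2 ≃* siegelGamma2).toEquiv fun a b => by
    rw [QuotientGroup.leftRel_apply, QuotientGroup.leftRel_apply, Subgroup.mem_subgroupOf,
      Subgroup.mem_subgroupOf]
    have e : (((MulAut.conjNormal p.1 : siegelGamma2 ≃* siegelGamma2).toEquiv a)⁻¹
        * (MulAut.conjNormal p.1 : siegelGamma2 ≃* siegelGamma2).toEquiv b : siegelGamma2).1
        = p.1 * (a⁻¹ * b : siegelGamma2).1 * p.1⁻¹ := by
      simp [mul_assoc]
    change _ ↔ (((MulAut.conjNormal p.1 : siegelGamma2 ≃* siegelGamma2).toEquiv a)⁻¹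
        * (MulAut.conjNormal p.1 : siegelGamma2 ≃* siegelGamma2).toEquiv b : siegelGamma2).1 ∈ klingen
    rw [e]
    constructor
    · exact fun h => mul_mem (mul_mem p.2 h) (inv_mem p.2)
    · intro h
      have := mul_mem (mul_mem (inv_mem p.2) h) p.2
      simpa [mul_assoc] using this

/-- Γ[2] is normal, so conjugation by `p` permutes the cosets; what is left of `p` acts on the cusp
form through its block. This is the compatibility that makes the induced representation map to the
Klingen space. -/
theorem siegelRep_klingenSeries_klingen (hw : Even w) (f : CuspForm Γ(2) w) (p : klingen) :
    siegelRep w p.1 (klingenSeries f) = klingenSeries (cuspRep w (klingenBlock p) f) := by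
  funext τ
  change siegelSlash w p.1⁻¹ (klingenSeries f) τ = _
  rw [siegelSlash_klingenSeries, klingenSeries, ← (conjCosets p).tsum_eq fun q =>
    klingenTerm (cuspRep w (klingenBlock p) f) (cosetRep q) τ]
  refine tsum_congr fun q => ?_
  have h1 : conjCosets p q = QuotientGroup.mk (MulAut.conjNormal p.1 q.out) := by
    conv_lhs => rw [← QuotientGroup.out_eq' q]
    rfl
  have h2 := klingenTerm_cosetRep_mk hw (cuspRep w (klingenBlock p) f)
    (MulAut.conjNormal p.1 q.out) 1
  rw [mul_one, mul_one] at h2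
  have h3 := klingenTerm_klingen_mul hw f p⁻¹
    (((MulAut.conjNormal p.1 q.out : siegelGamma2)⁻¹ : siegelGamma2).1)
  rw [← map_inv klingenBlock, inv_inv] at h3
  rw [h1, h2, ← h3]
  congr 1
  simp [cosetRep, mul_assoc]

open Classical in
/-- A function on the Siegel upper half space in coordinates, extended by zero. -/
def siegelExt (F : SiegelHalfSpace → ℂ) (p : Fin 3 → ℂ) : ℂ :=
  if h : p ∈ siegelDomain then F (siegelPoint p h) else 0

theorem siegelExt_of_mem (F : SiegelHalfSpace → ℂ) {p : Fin 3 → ℂ} (hp : p ∈ siegelDomain) :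
    siegelExt F p = F (siegelPoint p hp) :=
  dif_pos hp

theorem isHolomorphic_of_differentiableAt {F : SiegelHalfSpace → ℂ}
    (h : ∀ p ∈ siegelDomain, DifferentiableAt ℂ (siegelExt F) p) : IsHolomorphic F := by
  intro p hp
  refine DifferentiableWithinAt.congr (h p hp).differentiableWithinAt (fun p' hp' => ?_) ?_
  · rw [dif_pos ⟨symMat_transpose p', hp'⟩]
    exact (siegelExt_of_mem F hp').symm
  · rw [dif_pos ⟨symMat_transpose p, hp⟩]
    exact (siegelExt_of_mem F hp).symm

theorem differentiable_symMat_mul (A B : Matrix (Fin 2) (Fin 2) ℂ) (i j : Fin 2) :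
    Differentiable ℂ fun p => (A * symMat p + B) i j := by
  fin_cases j <;> simp [Matrix.mul_apply, Fin.sum_univ_two, symMat] <;> fun_prop

theorem act_entry (γ : Sp4Z) (τ : SiegelHalfSpace) : (γ • τ).1 0 0
    = (siegelNum γ τ 0 0 * siegelDen γ τ 1 1 - siegelNum γ τ 0 1 * siegelDen γ τ 1 0)
      * ((siegelDen γ τ).det)⁻¹ := by
  change (siegelNum γ τ * (siegelDen γ τ)⁻¹) 0 0 = _
  rw [Matrix.inv_def, Ring.inverse_eq_inv', Matrix.adjugate_fin_two]
  simp [Matrix.mul_apply, Fin.sum_univ_two]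
  ring

theorem differentiableAt_klingenTerm (f : CuspForm Γ(2) w) (γ : Sp4Z) {p : Fin 3 → ℂ}
    (hp : p ∈ siegelDomain) : DifferentiableAt ℂ (siegelExt (klingenTerm f γ)) p := by
  let N : (Fin 3 → ℂ) → Matrix (Fin 2) (Fin 2) ℂ := fun p =>
    γ.1.toBlocks₁₁.map Int.cast * symMat p + γ.1.toBlocks₁₂.map Int.cast
  let D : (Fin 3 → ℂ) → Matrix (Fin 2) (Fin 2) ℂ := fun p =>
    γ.1.toBlocks₂₁.map Int.cast * symMat p + γ.1.toBlocks₂₂.map Int.cast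
  have hN : ∀ i j, Differentiable ℂ fun p => N p i j := differentiable_symMat_mul _ _
  have hD : ∀ i j, Differentiable ℂ fun p => D p i j := differentiable_symMat_mul _ _
  have hdet : Differentiable ℂ fun p => (D p).det := by
    simp only [Matrix.det_fin_two]
    exact ((hD 0 0).mul (hD 1 1)).sub ((hD 0 1).mul (hD 1 0))
  have hne : (D p).det ≠ 0 := (SiegelHalfSpace.isUnit_den γ (siegelPoint p hp)).ne_zero
  have hdp : DifferentiableAt ℂ (fun p => (D p).det) p := hdet p
  let z : (Fin 3 → ℂ) → ℂ := fun p => (N p 0 0 * D p 1 1 - N p 0 1 * D p 1 0) * ((D p).det)⁻¹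
  have hz : DifferentiableAt ℂ z p :=
    DifferentiableAt.mul (((hN 0 0).mul (hD 1 1)).sub ((hN 0 1).mul (hD 1 0)) p) (hdp.fun_inv hne)
  have hzp : ∀ p' (hp' : p' ∈ siegelDomain), z p' = (γ • siegelPoint p' hp').1 0 0 :=
    fun p' hp' => (act_entry γ (siegelPoint p' hp')).symm
  have hf : DifferentiableAt ℂ (⇑f ∘ UpperHalfPlane.ofComplex) (z p) := by
    refine (UpperHalfPlane.mdifferentiable_iff.mp (CuspFormClass.holo f)).differentiableAt
      ((isOpen_lt continuous_const Complex.continuous_im).mem_nhds ?_)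
    rw [hzp p hp]
    exact im_entry_pos _
  have hmain : DifferentiableAt ℂ
      (fun p => (D p).det ^ (-w) * (⇑f ∘ UpperHalfPlane.ofComplex) (z p)) p :=
    (hdp.zpow (Or.inl hne)).mul (DifferentiableAt.comp (g := ⇑f ∘ UpperHalfPlane.ofComplex) p hf hz)
  refine hmain.congr_of_eventuallyEq ?_
  filter_upwards [isOpen_siegelDomain.mem_nhds hp] with p' hp'
  rw [siegelExt, dif_pos hp', Function.comp_apply, hzp p' hp',
    UpperHalfPlane.ofComplex_apply_of_im_pos (im_entry_pos (γ • siegelPoint p' hp'))]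
  rfl

theorem isHolomorphic_siegelSlash (f : CuspForm Γ(2) w) (γ : Sp4Z) :
    IsHolomorphic (siegelSlash w γ (klingenSeries f)) := by
  refine isHolomorphic_of_differentiableAt fun p hp => ?_
  obtain ⟨r, hr, hball, u, hu, hle⟩ := exists_klingen_bound f γ hp
  have e : siegelExt (siegelSlash w γ (klingenSeries f))
      = fun p => ∑' q : KlingenCosets, siegelExt (klingenTerm f (cosetRep q * γ)) p := by
    funext p'
    by_cases hp' : p' ∈ siegelDomain
    · simp only [siegelExt, dif_pos hp', siegelSlash_klingenSeries]
    · simp only [siegelExt, dif_neg hp', tsum_zero]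
  rw [e]
  refine differentiableAt_tsum_of_norm_le hu hr
    (fun q p' hp' => differentiableAt_klingenTerm f _ (hball hp')) fun q p' hp' => ?_
  rw [siegelExt, dif_pos (hball hp')]
  exact hle q p' hp' _

/-- Invariance passes from the series to all its translates because Γ[2] is normal. -/
theorem isSiegelForm_siegelRep (hw : Even w) (f : CuspForm Γ(2) w) (γ : Sp4Z) :
    IsSiegelForm w (siegelRep w γ (klingenSeries f)) := by
  refine ⟨isHolomorphic_siegelSlash f γ⁻¹, fun δ hδ τ => ?_⟩
  have h : siegelSlash w δ (siegelSlash w γ⁻¹ (klingenSeries f))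
      = siegelSlash w γ⁻¹ (klingenSeries f) := by
    have e : γ⁻¹ * δ = (γ⁻¹ * δ * γ) * γ⁻¹ := by group
    have hm : γ⁻¹ * δ * γ ∈ siegelGamma2 := by
      simpa using (inferInstance : siegelGamma2.Normal).conj_mem δ hδ γ⁻¹
    rw [← siegelSlash_mul, e, siegelSlash_mul, siegelSlash_klingenSeries_of_mem hw f hm]
  have h1 := congrFun h τ
  change siegelSlash w γ⁻¹ (klingenSeries f) (δ • τ)
    = _ * siegelSlash w γ⁻¹ (klingenSeries f) τ
  rw [← h1]
  conv_rhs => rw [siegelSlash]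
  have hne := (SiegelHalfSpace.isUnit_den δ τ).ne_zero
  rw [← mul_assoc, ← zpow_add₀ hne, add_neg_cancel, zpow_zero, one_mul]

theorem IsHolomorphic.add {F G : SiegelHalfSpace → ℂ} (hF : IsHolomorphic F)
    (hG : IsHolomorphic G) : IsHolomorphic (F + G) := by
  refine (DifferentiableOn.add hF hG).congr fun p hp => ?_
  have h : (symMat p).transpose = symMat p ∧ ((symMat p).map Complex.im).PosDef :=
    ⟨symMat_transpose p, hp⟩
  simp only [Pi.add_apply, dif_pos h]
  rfl

theorem IsHolomorphic.const_smul {F : SiegelHalfSpace → ℂ} (hF : IsHolomorphic F) (c : ℂ) :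
    IsHolomorphic (c • F) := by
  refine (DifferentiableOn.const_smul hF c).congr fun p hp => ?_
  have h : (symMat p).transpose = symMat p ∧ ((symMat p).map Complex.im).PosDef :=
    ⟨symMat_transpose p, hp⟩
  simp only [Pi.smul_apply, dif_pos h]
  rfl

theorem isSiegelForm_of_mem_klingenEisenstein (hw : Even w) {F : SiegelHalfSpace → ℂ}
    (hF : F ∈ klingenEisenstein w) : IsSiegelForm w F := by
  replace hF : F ∈ Submodule.span ℂ
    {F | ∃ (γ : Sp4Z) (f : CuspForm Γ(2) w) (F₀ : SiegelHalfSpace → ℂ),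
      IsKlingenSeries w f F₀ ∧ F = siegelRep w γ F₀} := hF
  induction hF using Submodule.span_induction with
  | mem x hx =>
    obtain ⟨γ, f, F₀, h, rfl⟩ := hx
    rw [h.eq]
    exact isSiegelForm_siegelRep hw f γ
  | zero =>
    refine ⟨?_, fun γ _ τ => by simp⟩
    have := (isSiegelForm_siegelRep hw (0 : CuspForm Γ(2) w) 1).1.const_smul 0
    rwa [zero_smul] at this
  | add x y _ _ hx hy =>
    exact ⟨hx.1.add hy.1, fun γ h τ => by
      rw [Pi.add_apply, Pi.add_apply, hx.2 γ h, hy.2 γ h, mul_add]⟩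
  | smul c x _ hx =>
    exact ⟨hx.1.const_smul c, fun γ h τ => by
      rw [Pi.smul_apply, Pi.smul_apply, hx.2 γ h, smul_eq_mul, smul_eq_mul, mul_left_comm]⟩

end KlingenSeries

end

end LevelTwo

namespace LevelTwo

noncomputable section

/-! ## The values of Klingen series at the boundary component -/

section Boundary

open Filter Topology

variable {w : ℤ}

/-- A sequence of points that tends to the point `z` of the one-dimensional boundary component
stabilised by the Klingen parabolic. -/
def cuspPoint (z : UpperHalfPlane) (n : ℕ) : SiegelHalfSpace :=
  siegelPoint ![z, 0, (n + 1) * Complex.I] <| by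
    have h := z.im_pos
    have hn : (0 : ℝ) < n + 1 := by positivity
    rw [mem_siegelDomain]
    simp
    exact ⟨h, mul_pos h hn⟩

theorem rowForm_cuspPoint (z : UpperHalfPlane) (n : ℕ) (l : Fin 2 ⊕ Fin 2 → ℝ) :
    rowForm (cuspPoint z n).1 l
      = (l (Sum.inr 1) ^ 2 + l (Sum.inl 1) ^ 2 * (n + 1) ^ 2) * z.im
        + Complex.normSq (l (Sum.inl 0) * z + l (Sum.inr 0)) * (n + 1) := by
  simp [rowForm, rowVec, cuspPoint, siegelPoint, symMat, dotProduct, Matrix.mulVec,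
    Fin.sum_univ_two, Complex.normSq_apply]
  ring

/-- Monotonicity along the sequence lets the majorant at its first point dominate all later ones. -/
theorem rowForm_cuspPoint_mono (z : UpperHalfPlane) (n : ℕ) (l : Fin 2 ⊕ Fin 2 → ℝ) :
    rowForm (cuspPoint z 0).1 l ≤ rowForm (cuspPoint z n).1 l := by
  have h := z.im_pos
  have hn : (1 : ℝ) ≤ n + 1 := by simp
  have hn2 : (1 : ℝ) ≤ (n + 1) ^ 2 := one_le_pow₀ hn
  rw [rowForm_cuspPoint, rowForm_cuspPoint]
  push_cast
  simp only [zero_add, one_pow, mul_one]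
  have h1 : l (Sum.inl 1) ^ 2 ≤ l (Sum.inl 1) ^ 2 * (n + 1) ^ 2 :=
    le_mul_of_one_le_right (sq_nonneg _) hn2
  have h2 := le_mul_of_one_le_right
    (Complex.normSq_nonneg (l (Sum.inl 0) * z + l (Sum.inr 0))) hn
  gcongr

/-- Every part of the form except the square of the last coordinate grows with `n`, and for real
coefficients `l₁ z + l₃` vanishes only if both do. -/
theorem tendsto_rowForm_cuspPoint (z : UpperHalfPlane) {l : Fin 2 ⊕ Fin 2 → ℝ} {j}
    (hj : j ≠ Sum.inr 1) (hl : l j ≠ 0) :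
    Tendsto (fun n => rowForm (cuspPoint z n).1 l) atTop atTop := by
  have h := z.im_pos
  have hpos : 0 < l (Sum.inl 1) ^ 2 * z.im
      + Complex.normSq (l (Sum.inl 0) * z + l (Sum.inr 0)) := by
    by_cases h1 : l (Sum.inl 1) = 0
    · have : (l (Sum.inl 0) * z + l (Sum.inr 0) : ℂ) ≠ 0 := by
        intro h0
        have hi := congrArg Complex.im h0
        simp [h.ne'] at hi
        have hr := congrArg Complex.re h0
        simp [hi] at hr
        rcases j with j | j <;> fin_cases j
        exacts [hl hi, hl h1, hl hr, hj rfl]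
      have := Complex.normSq_pos.mpr this
      rw [h1]
      simpa using this
    · have := Complex.normSq_nonneg (l (Sum.inl 0) * z + l (Sum.inr 0))
      positivity
  refine tendsto_atTop_mono (f := fun n : ℕ => (l (Sum.inl 1) ^ 2 * z.im
      + Complex.normSq (l (Sum.inl 0) * z + l (Sum.inr 0))) * (n : ℝ)) (fun n => ?_)
    (tendsto_natCast_atTop_atTop.const_mul_atTop hpos)
  rw [rowForm_cuspPoint]
  have h0 := Complex.normSq_nonneg (l (Sum.inl 0) * z + l (Sum.inr 0))
  have h2 : (n : ℝ) ≤ (n + 1) ^ 2 := by nlinarith [(Nat.cast_nonneg n : (0 : ℝ) ≤ n)]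
  have h3 : l (Sum.inl 1) ^ 2 * z.im * n ≤ l (Sum.inl 1) ^ 2 * z.im * (n + 1) ^ 2 :=
    mul_le_mul_of_nonneg_left h2 (by positivity)
  have h4 : 0 ≤ l (Sum.inr 1) ^ 2 * z.im := by positivity
  linarith

theorem tendsto_klingenTerm_zero (f : CuspForm Γ(2) w) {γ : Sp4Z} (hγ : γ ∉ klingen)
    (z : UpperHalfPlane) :
    Tendsto (fun n => klingenTerm f γ (cuspPoint z n)) atTop (𝓝 0) := by
  rcases lt_or_ge w 6 with hw | hw
  · rw [Gamma_two_eq_zero hw f]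
    refine tendsto_const_nhds.congr fun n => ?_
    simp [klingenTerm, siegelSlash, klingenLift]
  · obtain ⟨C, hC⟩ := CuspFormClass.exists_bound f
    have hw' : (6 : ℝ) ≤ w := by exact_mod_cast hw
    have : ∃ j, j ≠ Sum.inr 1 ∧ γ.1 (Sum.inr 1) j ≠ 0 := by
      by_contra! h
      exact hγ (mem_klingen_of_lastRow h)
    obtain ⟨j, hj, hl⟩ := this
    have h1 := tendsto_rowForm_cuspPoint z (l := intVec (lastRow γ)) hj
      (Int.cast_ne_zero.mpr hl)
    have h2 := ((tendsto_rpow_neg_atTop (show (0 : ℝ) < w / 2 by linarith)).comp h1).const_mul C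
    rw [mul_zero] at h2
    exact squeeze_zero_norm (fun n => norm_siegelSlash_klingenLift_le hC γ _) h2

/-- Dominated convergence allows the passage to the boundary component term by term. -/
theorem tendsto_siegelSlash_klingenSeries (f : CuspForm Γ(2) w) (γ : Sp4Z) (z : UpperHalfPlane)
    {g : KlingenCosets → ℂ}
    (hg : ∀ q, Tendsto (fun n => klingenTerm f (cosetRep q * γ) (cuspPoint z n)) atTop (𝓝 (g q))) :
    Tendsto (fun n => siegelSlash w γ (klingenSeries f) (cuspPoint z n)) atTop
      (𝓝 (∑' q, g q)) := by
  simp_rw [siegelSlash_klingenSeries]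
  have hb : ∃ u : KlingenCosets → ℝ, Summable u ∧ ∀ n q,
      ‖klingenTerm f (cosetRep q * γ) (cuspPoint z n)‖ ≤ u q := by
    rcases lt_or_ge w 6 with hw | hw
    · rw [Gamma_two_eq_zero hw f]
      exact ⟨0, summable_zero, fun n q => by simp [klingenTerm, siegelSlash, klingenLift]⟩
    · obtain ⟨p, hp, hpz⟩ := exists_siegelPoint (cuspPoint z 0)
      obtain ⟨r, hr, c, hc, -, hle⟩ := exists_rowForm_bound hp
      obtain ⟨C, hC⟩ := CuspFormClass.exists_bound f
      have hC0 : 0 ≤ C := by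
        have h1 := (norm_nonneg _).trans (hC UpperHalfPlane.I)
        simpa using h1
      have hw' : (6 : ℝ) ≤ w := by exact_mod_cast hw
      refine ⟨_, summable_klingenBound hw γ C c hc, fun n q => ?_⟩
      refine (norm_siegelSlash_klingenLift_le hC _ _).trans (mul_le_mul_of_nonneg_left ?_ hC0)
      have hn : 0 < ‖intVec (lastRow (cosetRep q * γ))‖ := norm_pos_iff.mpr (lastRow_ne_zero _)
      refine Real.rpow_le_rpow_of_nonpos (by positivity) ?_ (by linarith)
      refine (hle p (Metric.mem_ball_self (by linarith)) _).trans ?_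
      have e : symMat p = (cuspPoint z 0).1 := congrArg Subtype.val hpz
      rw [e]
      exact rowForm_cuspPoint_mono z n _
  obtain ⟨u, hu, hle⟩ := hb
  exact tendsto_tsum_of_dominated_convergence hu hg (Eventually.of_forall hle)

theorem tendsto_siegelSlash_klingenSeries_zero (f : CuspForm Γ(2) w) {γ : Sp4Z}
    (hγ : ∀ δ ∈ siegelGamma2, δ * γ ∉ klingen) (z : UpperHalfPlane) :
    Tendsto (fun n => siegelSlash w γ (klingenSeries f) (cuspPoint z n)) atTop (𝓝 0) := by
  have := tendsto_siegelSlash_klingenSeries f γ z (g := 0) fun q =>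
    tendsto_klingenTerm_zero f (hγ _ (cosetRep_mem q)) z
  simpa using this

/-- Only the coset of the identity lies in the parabolic, and its term is constantly `f z` along the
sequence. So the Siegel operator recovers `f` from its series. -/
theorem tendsto_klingenSeries (hw : Even w) (f : CuspForm Γ(2) w) (z : UpperHalfPlane) :
    Tendsto (fun n => klingenSeries f (cuspPoint z n)) atTop (𝓝 (f z)) := by
  classical
  obtain ⟨q₀, hq₀⟩ : ∃ q₀ : KlingenCosets, q₀ = QuotientGroup.mk 1 := ⟨_, rfl⟩
  have h0 : ∀ q, q ≠ q₀ → cosetRep q ∉ klingen := fun q hq h => hq <| by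
    rw [hq₀, ← QuotientGroup.out_eq' q]
    refine mk_eq_of_klingen ?_
    rw [mul_one]
    exact h
  have h1 : klingenTerm f (cosetRep q₀ * 1) = klingenLift f := by
    have h2 := klingenTerm_cosetRep_mk hw f 1 1
    rw [← hq₀, mul_one ((1 : siegelGamma2)⁻¹ : siegelGamma2).1, inv_one] at h2
    exact h2.trans (siegelSlash_one _ _)
  have := tendsto_siegelSlash_klingenSeries f 1 z (g := Pi.single q₀ (f z)) fun q => by
    by_cases hq : q = q₀
    · subst hq
      rw [h1, Pi.single_eq_same]
      refine tendsto_const_nhds.congr fun n => ?_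
      rfl
    · rw [Pi.single_eq_of_ne hq, mul_one]
      exact tendsto_klingenTerm_zero f (h0 q hq) z
  rw [tsum_pi_single] at this
  simpa only [siegelSlash_one] using this

end Boundary

end

end LevelTwo

namespace LevelTwo

noncomputable section

/-! ## The space of Klingen series as an induced representation -/

section KlingenInduced

open Filter Topology

variable {w : ℤ}

theorem klingenTerm_add (f g : CuspForm Γ(2) w) (γ : Sp4Z) (τ : SiegelHalfSpace) :
    klingenTerm (f + g) γ τ = klingenTerm f γ τ + klingenTerm g γ τ :=
  mul_add _ _ _

theorem klingenTerm_smul (c : ℂ) (f : CuspForm Γ(2) w) (γ : Sp4Z) (τ : SiegelHalfSpace) :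
    klingenTerm (c • f) γ τ = c * klingenTerm f γ τ :=
  mul_left_comm _ _ _

/-- The translates of Klingen series, as a linear function of the cusp form. -/
def klingenTranslate (γ : Sp4Z) : CuspForm Γ(2) w →ₗ[ℂ] (SiegelHalfSpace → ℂ) where
  toFun f := siegelSlash w γ (klingenSeries f)
  map_add' f g := by
    funext τ
    simp only [Pi.add_apply, siegelSlash_klingenSeries, klingenTerm_add]
    exact (summable_klingenTerm f γ τ).tsum_add (summable_klingenTerm g γ τ)
  map_smul' c f := by
    funext τ
    simp only [Pi.smul_apply, siegelSlash_klingenSeries, klingenTerm_smul, tsum_mul_left]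
    rfl

theorem siegelRep_klingenTranslate (γ δ : Sp4Z) (f : CuspForm Γ(2) w) :
    siegelRep w δ (klingenTranslate γ f) = klingenTranslate (γ * δ⁻¹) f :=
  (siegelSlash_mul w γ δ⁻¹ (klingenSeries f)).symm

theorem klingenTranslate_mul_of_mem (hw : Even w) {κ : Sp4Z} (hκ : κ ∈ siegelGamma2) (γ : Sp4Z)
    (f : CuspForm Γ(2) w) : klingenTranslate (κ * γ) f = klingenTranslate γ f := by
  change siegelSlash w (κ * γ) (klingenSeries f) = siegelSlash w γ (klingenSeries f)
  rw [siegelSlash_mul, siegelSlash_klingenSeries_of_mem hw f hκ]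

theorem klingenTranslate_klingen_mul (hw : Even w) (p : klingen) (γ : Sp4Z)
    (f : CuspForm Γ(2) w) :
    klingenTranslate (p.1 * γ) (cuspRep w (klingenBlock p) f) = klingenTranslate γ f := by
  change siegelSlash w (p.1 * γ) (klingenSeries _) = siegelSlash w γ (klingenSeries f)
  rw [← siegelRep_klingenSeries_klingen hw f p]
  change siegelSlash w (p.1 * γ) (siegelSlash w p.1⁻¹ (klingenSeries f)) = _
  rw [← siegelSlash_mul, inv_mul_cancel_left]

theorem klingenEisenstein_eq_span (w : ℤ) : (klingenEisenstein w).toSubmodule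
    = Submodule.span ℂ {F | ∃ γ, ∃ f : CuspForm Γ(2) w, F = klingenTranslate γ f} := by
  change Submodule.span ℂ _ = _
  congr 1
  ext F
  constructor
  · rintro ⟨γ, f, F₀, h, rfl⟩
    exact ⟨γ⁻¹, f, by rw [h.eq]; rfl⟩
  · rintro ⟨γ, f, rfl⟩
    refine ⟨γ⁻¹, f, _, isKlingenSeries_klingenSeries f, ?_⟩
    change siegelSlash w γ _ = siegelSlash w γ⁻¹⁻¹ _
    rw [inv_inv]

variable {φ : Sp4Z →* Equiv.Perm (Fin 6)}

theorem IsS6Identification.klingenTranslate_congr (hφ : IsS6Identification φ) (hw : Even w)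
    {γ δ : Sp4Z} (h : φ γ = φ δ) (f : CuspForm Γ(2) w) :
    klingenTranslate γ f = klingenTranslate δ f := by
  have hm : γ * δ⁻¹ ∈ siegelGamma2 := by
    rw [← hφ.2.1, MonoidHom.mem_ker, map_mul, map_inv, h, mul_inv_cancel]
  rw [← klingenTranslate_mul_of_mem hw hm δ f, inv_mul_cancel_right]

/-- The map sends `h ⊗ f` to the translate of the series of `f` by a lift of `h`. It is independent
of the lift by invariance under Γ[2] and respects the relations over `H` by compatibility with the
parabolic. Injectivity comes from the values at the boundary components. -/
theorem IsS6Identification.klingen_ind_equiv (hφ : IsS6Identification φ) (hw : Even w)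
    {σ : Representation ℂ (klingen.map φ) (CuspForm Γ(2) w)}
    (hσ : ∀ p : klingen,
      σ ⟨φ p.1, Subgroup.mem_map_of_mem φ p.2⟩ = cuspRep w (klingenBlock p)) :
    Nonempty ((klingenEisenstein w).toRepresentation.Equiv
      ((Representation.ind (klingen.map φ).subtype σ).comp φ)) := by
  let s : Equiv.Perm (Fin 6) → Sp4Z := Function.surjInv hφ.1
  have hs : ∀ h, φ (s h) = h := Function.surjInv_eq hφ.1
  let Ψ : Representation.IndV (klingen.map φ).subtype σ →ₗ[ℂ] (SiegelHalfSpace → ℂ) :=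
    indLift σ (fun h => klingenTranslate (s h)) <| by
      rintro ⟨_, p, hp, rfl⟩ h f
      rw [hσ ⟨p, hp⟩, ← klingenTranslate_klingen_mul hw ⟨p, hp⟩ (s h) f]
      exact hφ.klingenTranslate_congr hw (by rw [map_mul, hs, hs]) _
  have hΨ : ∀ γ f, Ψ (indMk σ (φ γ) f) = klingenTranslate γ f := fun γ f => by
    rw [indLift_indMk]
    exact hφ.klingenTranslate_congr hw (hs _) f
  have hrange : LinearMap.range Ψ = (klingenEisenstein w).toSubmodule := by
    rw [klingenEisenstein_eq_span]
    apply le_antisymm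
    · rintro _ ⟨v, rfl⟩
      induction v using ind_induction with
      | hmk h f =>
        rw [← hs h, hΨ]
        exact Submodule.subset_span ⟨_, f, rfl⟩
      | hadd x y hx hy => rw [map_add]; exact Submodule.add_mem _ hx hy
    · rw [Submodule.span_le]
      rintro _ ⟨γ, f, rfl⟩
      exact ⟨_, hΨ γ f⟩
  have hequiv : ∀ δ v, Ψ (Representation.ind (klingen.map φ).subtype σ (φ δ) v)
      = siegelRep w δ (Ψ v) := fun δ v => by
    induction v using ind_induction with
    | hmk h f =>
      obtain ⟨γ, rfl⟩ := hφ.1 h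
      rw [ind_indMk, ← map_inv, ← map_mul, hΨ, hΨ, siegelRep_klingenTranslate]
    | hadd x y hx hy => rw [map_add, map_add, hx, hy, map_add, map_add]
  have hinj : Function.Injective Ψ := by
    classical
    rw [← LinearMap.ker_eq_bot, LinearMap.ker_eq_bot']
    intro v hv
    have := Fintype.ofFinite (Equiv.Perm (Fin 6) ⧸ klingen.map φ)
    obtain ⟨a, rfl⟩ := indMk_sum_surjective σ v
    suffices a = 0 by rw [this, map_zero]
    funext q₀
    refine DFunLike.ext _ _ fun z => ?_
    -- The relation is translated so that the coset `q₀` sits at the standard boundary component. In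
    -- the limit only its summand survives, with value `a q₀ z`.
    have h0 : ∑ q : Equiv.Perm (Fin 6) ⧸ klingen.map φ,
        klingenTranslate ((s q.out)⁻¹ * s q₀.out) (a q) = 0 := by
      have h1 := congrArg (siegelRep w (s q₀.out)⁻¹) hv
      rw [map_zero, LinearMap.sum_apply, map_sum, map_sum] at h1
      rw [← h1]
      refine Finset.sum_congr rfl fun q _ => ?_
      have e : q.out⁻¹ = φ (s q.out)⁻¹ := by rw [map_inv, hs]
      rw [LinearMap.comp_apply, LinearMap.proj_apply, e, hΨ, siegelRep_klingenTranslate, inv_inv]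
    have hlim : Tendsto (fun n => ∑ q : Equiv.Perm (Fin 6) ⧸ klingen.map φ,
        klingenTranslate ((s q.out)⁻¹ * s q₀.out) (a q) (cuspPoint z n)) atTop
        (𝓝 (∑ q, if q = q₀ then a q₀ z else 0)) := by
      refine tendsto_finsetSum _ fun q _ => ?_
      split_ifs with hq
      · rw [hq, inv_mul_cancel]
        refine (tendsto_klingenSeries hw (a q₀) z).congr fun n => ?_
        exact (congrFun (siegelSlash_one w _) _).symm
      · refine tendsto_siegelSlash_klingenSeries_zero (a q) (fun δ hδ hm => hq ?_) z
        -- If some element of Γ[2] moved this translate into the parabolic, then applying `φ` would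
        -- make `q` and `q₀` the same coset.
        rw [← QuotientGroup.out_eq' q, ← QuotientGroup.out_eq' q₀, QuotientGroup.eq]
        have h2 := Subgroup.mem_map_of_mem φ hm
        rw [← hφ.2.1, MonoidHom.mem_ker] at hδ
        rwa [map_mul, hδ, one_mul, map_mul, map_inv, hs, hs] at h2
    rw [Finset.sum_ite_eq' Finset.univ q₀, if_pos (Finset.mem_univ _)] at hlim
    refine tendsto_nhds_unique hlim (tendsto_const_nhds.congr fun n => ?_)
    rw [← Finset.sum_apply, h0]
    rfl
  let e : Representation.IndV (klingen.map φ).subtype σ ≃ₗ[ℂ]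
      (klingenEisenstein w).toSubmodule :=
    (LinearEquiv.ofInjective Ψ hinj).trans (LinearEquiv.ofEq _ _ hrange)
  refine ⟨(Representation.Equiv.mk e fun δ => LinearMap.ext fun v => Subtype.ext ?_).symm⟩
  exact hequiv δ v

end KlingenInduced

end

end LevelTwo

theorem mainTheorem4 :
    (∃ φ₃, LevelTwo.IsS3Identification φ₃) ∧
    (∃! φ₆, LevelTwo.IsS6Identification φ₆) ∧
    ∀ (φ₃ : SL(2, ℤ) →* Equiv.Perm (Fin 3)) (φ₆ : LevelTwo.Sp4Z →* Equiv.Perm (Fin 6)),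
      LevelTwo.IsS3Identification φ₃ → LevelTwo.IsS6Identification φ₆ → ∀ k : ℕ,
        LevelTwo.HasDecomposition (LevelTwo.cuspRep (2 * k)) φ₃ (LevelTwo.cuspMult k) ∧
        (∀ F ∈ LevelTwo.klingenEisenstein (2 * k), LevelTwo.IsSiegelForm (2 * k) F) ∧
        (∃ σ : Representation ℂ (LevelTwo.klingen.map φ₆) (CuspForm Γ(2) (2 * k)),
          (∀ p : LevelTwo.klingen,
            σ ⟨φ₆ p.1, Subgroup.mem_map_of_mem φ₆ p.2⟩
              = LevelTwo.cuspRep (2 * k) (LevelTwo.klingenBlock p)) ∧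
          Nonempty ((LevelTwo.klingenEisenstein (2 * k)).toRepresentation.Equiv
            ((Representation.ind (LevelTwo.klingen.map φ₆).subtype σ).comp φ₆))) ∧
        LevelTwo.HasDecomposition (LevelTwo.klingenEisenstein (2 * k)).toRepresentation φ₆
          (LevelTwo.klingenMult k) := by
  refine ⟨LevelTwo.exists_isS3Identification, LevelTwo.existsUnique_isS6Identification, ?_⟩
  intro φ₃ φ₆ h₃ h₆ k
  have hcusp := LevelTwo.isCuspAction_cuspRep (2 * (k : ℤ))
  have hw : Even (2 * (k : ℤ)) := even_two_mul _
  obtain ⟨σ, hσ⟩ := h₆.exists_klingen_rep (2 * (k : ℤ))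
  obtain ⟨e⟩ := h₆.klingen_ind_equiv hw hσ
  refine ⟨h₃.hasDecomposition hcusp,
    fun F hF => LevelTwo.isSiegelForm_of_mem_klingenEisenstein hw hF, ⟨σ, hσ, ⟨e⟩⟩, ?_⟩
  -- The same dimension data `hcusp` that decompose the elliptic cusp forms determine the
  -- multiplicities in the induced representation.
  obtain ⟨e'⟩ := LevelTwo.IsCuspAction.ind_equiv_isotypicSum k (h₆.isInflated hσ) hcusp
  refine ⟨e.trans (Representation.Equiv.mk e'.toLinearEquiv fun g => LinearMap.ext fun v => ?_)⟩
  exact Representation.IntertwiningMap.isIntertwining _ _ e'.toIntertwiningMap (φ₆ g) v
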